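/- Let $L=\{0,1,+,-,\cdot,<\}\cup\mathbb{R}$ be the language of ordered rings with a constant symbol for every real number, and let $\mathbb{R}^*=\mathbb{R}((t^{\mathbb{Q}}))$ be the field of Hahn series over $\mathbb{R}$ with rational exponents, ordered so that a nonzero series is positive if and only if its leading coefficient is, and with valuation $v(x)=\min\operatorname{supp}x$, $v(0)=\infty$. View $\mathbb{R}\subset\mathbb{R}^*$ as the constant series, so that $\mathbb{R}^*$ is an $L$-structure. For $\underline a\in(\mathbb{R}^*)^n$ put $v(\underline a)=\min_i v(a_i)$ and $B(\underline a,>0)=\{\underline b\in(\mathbb{R}^*)^n : v(\underline b-\underline a)>0\}$. Write $\underline a\approx\underline b$ if $v(\underline a-\underline b)>v(\underline a)$ or $\underline a=\underline b=0$. A risometry is a bijection $\alpha\colon U\to U'$ between subsets of $(\mathbb{R}^*)^n$ with $\alpha(\underline a_1)-\alpha(\underline a_2)\approx\underline a_1-\underline a_2$ for all $\underline a_1,\underline a_2\in U$. A set $Z\subset(\mathbb{R}^*)^n$ is $d$-riso-trivial on a ball $B$ if there are a $d$-dimensional $\mathbb{R}^*$-linear subspace $V\subset(\mathbb{R}^*)^n$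 and a risometry $\alpha\colon B\to B'\subset(\mathbb{R}^*)^n$ such that for all $\underline b_1,\underline b_2\in B'$ with $\underline b_1-\underline b_2\in V$ we have $\underline b_1\in\alpha(Z\cap B)\iff\underline b_2\in\alpha(Z\cap B)$. The riso-triviality dimension of $Z$ on $B$ is the maximal $d$ such that $Z$ is $d$-riso-trivial on $B$. **Proposition.** Let $n,d\ge 0$ be integers, let $X\subset\mathbb{R}^n$ be the set defined by an $L$-formula $\phi(x_1,\dots,x_n)$ in $\mathbb{R}$, and let $X^*\subset(\mathbb{R}^*)^n$ be the set defined by $\phi$ in $\mathbb{R}^*$. Then $X$ is a $d$-dimensional (embedded) $C^1$-submanifold of $\mathbb{R}^n$ if and only if, for every $\underline a\in X$, the riso-triviality dimension of $X^*$ on the infinitesimal neighbourhood $B(\underline a,>0)$ is equal to $d$. (The empty set counts as a $d$-dimensional submanifold for every $d$.) -/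

import Mathlib

open FirstOrder

namespace RisoTriviality

/-! ### The language and definable sets -/

/-- The only relation symbol of the language of ordered rings: the binary symbol `<`. -/
inductive OrderedRingRel : ℕ → Type
  | lt : OrderedRingRel 2

/-- The language `{0, 1, +, -, ·, <}` of ordered rings. -/
def orderedRing : FirstOrder.Language :=
  { Functions := ringFunc
    Relations := OrderedRingRel }

/-- The language `L`: ordered rings together with a constant symbol for every real number. -/
abbrev L : FirstOrder.Language := orderedRing[[ℝ]]

/-- The natural interpretation of the language of ordered rings in a ring with an order. -/
abbrev orderedRingStructure (K : Type) [Ring K] [LT K] : orderedRing.Structure K where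
  funMap {_} f := match f with
    | .add => fun x => x 0 + x 1
    | .mul => fun x => x 0 * x 1
    | .neg => fun x => -x 0
    | .zero => fun _ => 0
    | .one => fun _ => 1
  RelMap {_} r := match r with
    | .lt => fun x => x 0 < x 1

/-- The `L`-structure on an ordered ring `K`, where the constant symbol of the real number `r` is
interpreted as `c r`. -/
abbrev lStructure (K : Type) [Ring K] [LT K] (c : ℝ → K) : L.Structure K :=
  letI : orderedRing.Structure K := orderedRingStructure K
  letI : (Language.constantsOn ℝ).Structure K := Language.constantsOn.structure c
  Language.withConstantsStructure orderedRing ℝ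

/-- The subset of `K ^ n` defined by an `L`-formula in `n` free variables. -/
def definedSet (K : Type) [Ring K] [LT K] (c : ℝ → K) {n : ℕ} (φ : L.Formula (Fin n)) :
    Set (Fin n → K) :=
  letI : L.Structure K := lStructure K c
  {x | φ.Realize x}

/-! ### The field of Hahn series -/

/-- The field `ℝ* = ℝ((t^ℚ))` of Hahn series, with its lexicographic order: a series is positive
if and only if its leading coefficient is. -/
abbrev RStar : Type := Lex (HahnSeries ℚ ℝ)

/-- The embedding of `ℝ` into `ℝ*` as constant series. -/
noncomputable def toStar (r : ℝ) : RStar := toLex (HahnSeries.C r)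

/-- The subset `X` of `ℝ ^ n` defined by an `L`-formula. -/
def realSet {n : ℕ} (φ : L.Formula (Fin n)) : Set (Fin n → ℝ) := definedSet ℝ id φ

/-- The subset `X*` of `(ℝ*) ^ n` defined by the same formula. -/
def starSet {n : ℕ} (φ : L.Formula (Fin n)) : Set (Fin n → RStar) := definedSet RStar toStar φ

/-- The valuation on `ℝ*`: the least exponent of a nonzero series, and `⊤` at `0`. -/
noncomputable def val : AddValuation RStar (WithTop ℚ) := HahnSeries.addVal ℚ ℝ

theorem val_apply (x : RStar) : val x = (ofLex x).orderTop := rfl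

/-! ### Risometries and riso-triviality over a valued field -/

section ValuedField

variable {K Γ : Type} [Field K] [LinearOrderedAddCommMonoidWithTop Γ] {n : ℕ}

/-- The valuation of a tuple: the minimum of the valuations of its entries
(`⊤` for the empty tuple). -/
def tupleVal (v : AddValuation K Γ) (a : Fin n → K) : Γ := Finset.univ.inf fun i => v (a i)

/-- The open valuative ball `B(a, > r)`. -/
def openBall (v : AddValuation K Γ) (a : Fin n → K) (r : Γ) : Set (Fin n → K) :=
  {b | r < tupleVal v (b - a)}

/-- The relation `a ≈ b`: equality of leading terms. -/
def AlmostEq (v : AddValuation K Γ) (a b : Fin n → K) : Prop :=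
  tupleVal v a < tupleVal v (a - b) ∨ (a = 0 ∧ b = 0)

/-- `α` restricts to a risometry from `U` onto `U'` (its values outside `U` are irrelevant). -/
def IsRisometry (v : AddValuation K Γ) (α : (Fin n → K) → (Fin n → K))
    (U U' : Set (Fin n → K)) : Prop :=
  Set.BijOn α U U' ∧ ∀ a₁ ∈ U, ∀ a₂ ∈ U, AlmostEq v (α a₁ - α a₂) (a₁ - a₂)

/-- `Y` is translation invariant in the direction of `V` within `B'`. -/
def IsTranslationInvariant (V : Submodule K (Fin n → K)) (Y B' : Set (Fin n → K)) : Prop :=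
  ∀ b₁ ∈ B', ∀ b₂ ∈ B', b₁ - b₂ ∈ V → (b₁ ∈ Y ↔ b₂ ∈ Y)

/-- `Z` is `V`-riso-trivial on `B`. -/
def IsRisoTrivialAlong (v : AddValuation K Γ) (V : Submodule K (Fin n → K))
    (Z B : Set (Fin n → K)) : Prop :=
  ∃ (B' : Set (Fin n → K)) (α : (Fin n → K) → (Fin n → K)),
    IsRisometry v α B B' ∧ IsTranslationInvariant V (α '' (Z ∩ B)) B'

/-- `Z` is `d`-riso-trivial on `B`. -/
def IsRisoTrivial (v : AddValuation K Γ) (d : ℕ) (Z B : Set (Fin n → K)) : Prop :=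
  ∃ V : Submodule K (Fin n → K), Module.finrank K V = d ∧ IsRisoTrivialAlong v V Z B

/-- The riso-triviality dimension of `Z` on `B`: the maximal `d` such that `Z` is `d`-riso-trivial
on `B`. The maximum exists, see `isGreatest_rtrdim`. -/
noncomputable def rtrdim (v : AddValuation K Γ) (Z B : Set (Fin n → K)) : ℕ :=
  sSup {d | IsRisoTrivial v d Z B}

theorem isGreatest_rtrdim (v : AddValuation K Γ) (hv : ∀ x, v x = ⊤ → x = 0)
    (Z B : Set (Fin n → K)) : IsGreatest {d | IsRisoTrivial v d Z B} (rtrdim v Z B) := by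
  have hb : BddAbove {d | IsRisoTrivial v d Z B} := by
    refine ⟨n, ?_⟩
    rintro d ⟨V, rfl, -⟩
    simpa using V.finrank_le
  refine ⟨Nat.sSup_mem ⟨0, ⊥, by simp, B, id, ⟨Set.bijOn_id B, ?_⟩, ?_⟩ hb,
    fun d hd => le_csSup hb hd⟩
  · intro a₁ _ a₂ _
    simp only [id, AlmostEq, sub_self, and_self]
    by_cases h : a₁ - a₂ = 0
    · exact Or.inr h
    · left
      obtain ⟨i, hi⟩ := Function.ne_iff.mp h
      have h1 : tupleVal v (0 : Fin n → K) = ⊤ := by simp [tupleVal]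
      rw [h1, lt_top_iff_ne_top]
      intro htop
      refine hi (hv _ (top_le_iff.mp ?_))
      rw [← htop]
      exact Finset.inf_le (Finset.mem_univ i)
  · intro b₁ _ b₂ _ h
    rw [Submodule.mem_bot, sub_eq_zero] at h
    rw [h]

end ValuedField

/-- The infinitesimal neighbourhood `B(a, > 0)` of a point `a` of `ℝ ^ n` in `(ℝ*) ^ n`. -/
noncomputable def infNhd {n : ℕ} (a : Fin n → ℝ) : Set (Fin n → RStar) :=
  openBall val (fun i => toStar (a i)) 0

/-! ### Submanifolds -/

/-- `X` is a `d`-dimensional `C^1`-submanifold of `ℝ ^ n`: around every point of `X` there is a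
`C^1`-diffeomorphism between open subsets of `ℝ ^ n` which maps `X` to (an open part of) a
`d`-dimensional linear subspace. -/
def IsC1Submanifold {n : ℕ} (d : ℕ) (X : Set (Fin n → ℝ)) : Prop :=
  ∀ a ∈ X, ∃ (Φ : OpenPartialHomeomorph (Fin n → ℝ) (Fin n → ℝ)) (W : Submodule ℝ (Fin n → ℝ)),
    a ∈ Φ.source ∧ ContDiffOn ℝ 1 Φ Φ.source ∧ ContDiffOn ℝ 1 Φ.symm Φ.target ∧
    Module.finrank ℝ W = d ∧ ∀ x ∈ Φ.source, (x ∈ X ↔ Φ x ∈ W)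

end RisoTriviality

namespace RisoTriviality

/-! ### Spherical completeness of Hahn series -/

/-! The two sides are linked by two conditions on a linear projection `P` at a point `a` of X.
`IsFlatAt`: secants of X near `a` are fixed by `P` up to a factor tending to 0. `IsFullAt`: X meets
every fibre of `P` near `a`, with linear control of the distance to `a`. X is a d-dimensional
C^1-submanifold exactly when each of its points has a flat and full projection of rank d
(`HasC1ChartAt.exists_isFlatAt_isFullAt`, `isC1Submanifold_of_isFlatAt_isFullAt`): X is then locally
a graph over its tangent space.

For fixed constants these conditions are first-order, so they pass between ℝ and ℝ*. The transfer
rests on the intermediate value property of ℝ* (`polynomialIVT_rStar`), which holds because ℂ((t^ℚ))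
is algebraically closed, and on a quantifier elimination uniform in all real closed extensions of ℝ
(`exists_isDiagram`, `IsSemialgebraic.exists_one`). In ℝ*, flatness for every real ε becomes a
strict inequality of valuations.

From manifold to dimension: a flat and full `P` gives a shear that straightens X* near `a`, so the
dimension is at least d (`isRisoTrivial_of_isFlatAt_isFullAt`). Conversely, a trivialization along
an e-dimensional V has a real projection of rank e as its reduction (`exists_real_projection`). A
fixed point argument makes this projection full (`Trivialization.exists_rel`), and comparison with a
flat projection of rank d yields e ≤ d.

From dimension to manifold: the trivialization at `a` provides a projection `P` of rank d which is
full around `a`, and only flatness is missing. Points with a chart are dense in X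
(`exists_hasC1ChartAt`); by the first implication their charts have dimension d, so those near `a`
are isolated in their fibres of `P`. Take such an isolated point infinitely near `a` in X*. The
trivialization moves it into the fibre through `a` and keeps it isolated there. The isolated points
of that fibre form a finite set already over ℝ, so the moved point is `a` itself
(`isolatedInFiber_of_rtrdim_eq`). Hence every point of X* infinitely near `a` can be moved to `a`,
all secants there lie along V up to the risometry, and `P` is flat (`isFlatAt_of_rtrdim_eq`). -/

/-- Two series agree below one of their two radii, so the limit can be glued coefficient by
coefficient, with 0 at exponents beyond all radii. Its support is well ordered: a sequence in it
either returns above its first term or stays below a single radius, hence inside the support of one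
series. -/
theorem exists_pseudoLimit {ι k : Type*} [AddGroup k] (x : ι → HahnSeries ℚ k)
    (r : ι → WithTop ℚ)
    (h : ∀ i j, r i ≤ (x i - x j).orderTop ∨ r j ≤ (x i - x j).orderTop) :
    ∃ z : HahnSeries ℚ k, ∀ i, r i ≤ (z - x i).orderTop := by
  classical
  have hcoh : ∀ (q : ℚ) i j, (q : WithTop ℚ) < r i → (q : WithTop ℚ) < r j →
      (x i).coeff q = (x j).coeff q := by
    intro q i j hi hj
    have : (x i - x j).coeff q = 0 := by
      apply HahnSeries.coeff_eq_zero_of_lt_orderTop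
      rcases h i j with h | h
      · exact hi.trans_le h
      · exact hj.trans_le h
    rw [HahnSeries.coeff_sub] at this
    exact sub_eq_zero.mp this
  let c : ℚ → k := fun q => if h : ∃ i, (q : WithTop ℚ) < r i then (x h.choose).coeff q else 0
  have hc : ∀ (q : ℚ) i, (q : WithTop ℚ) < r i → c q = (x i).coeff q := by
    intro q i hi
    have hex : ∃ i, (q : WithTop ℚ) < r i := ⟨i, hi⟩
    simp only [c, dif_pos hex]
    exact hcoh q _ _ hex.choose_spec hi
  have hpwo : (Function.support c).IsPWO := by
    intro f
    have h0 : ∃ i, ((f 0 : ℚ) : WithTop ℚ) < r i := by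
      by_contra hne
      exact (f 0).2 (dif_neg hne)
    obtain ⟨i, hi⟩ := h0
    by_cases hn : ∃ n, 0 < n ∧ (f 0 : ℚ) ≤ f n
    · obtain ⟨n, hn, hle⟩ := hn
      exact ⟨0, n, hn, hle⟩
    · push Not at hn
      have hsupp : ∀ n, (f n : ℚ) ∈ (x i).support := by
        intro n
        have hlt : ((f n : ℚ) : WithTop ℚ) < r i := by
          rcases Nat.eq_zero_or_pos n with rfl | hpos
          · exact hi
          · exact (WithTop.coe_lt_coe.mpr (hn n hpos)).trans hi
        rw [HahnSeries.mem_support, ← hc _ i hlt]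
        exact (f n).2
      exact (x i).isPWO_support fun n => ⟨f n, hsupp n⟩
  refine ⟨⟨c, hpwo⟩, fun i => ?_⟩
  rw [HahnSeries.le_orderTop_iff_forall]
  intro q hq
  rw [HahnSeries.coeff_sub, sub_eq_zero]
  exact hc q i hq

/-- A form of the fixed point theorem in spherically complete ultrametric spaces: if the radius
`r x` can always be enlarged within the ball of radius `r x` around `x`, then it is somewhere
infinite. -/
theorem exists_radius_eq_top {E : Type*} (dist : E → E → WithTop ℚ) (B : Set E)
    (hB : B.Nonempty) (r : E → WithTop ℚ)
    (hself : ∀ x, dist x x = ⊤)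
    (htri : ∀ x y z, min (dist x y) (dist y z) ≤ dist x z)
    (hcomplete : ∀ S : Set E,
      (∀ x ∈ S, ∀ y ∈ S, r x ≤ dist x y ∨ r y ≤ dist x y) → ∃ z, ∀ x ∈ S, r x ≤ dist z x)
    (hsymm : ∀ x y, dist x y = dist y x)
    (hmem : ∀ x ∈ B, ∀ y, r x ≤ dist x y → y ∈ B ∧ r x ≤ r y)
    (hnext : ∀ x ∈ B, r x < ⊤ → ∃ y, r x ≤ dist x y ∧ r x < r y) :
    ∃ x ∈ B, r x = ⊤ := by
  -- The relation says that `y` lies in the ball of radius `r x` around `x`. Radii grow along it,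
  -- which makes it transitive, and completeness bounds its chains. At a maximal element, `hnext`
  -- forbids a finite radius.
  let R : B → B → Prop := fun x y => r x ≤ dist x y
  have hne : Nonempty B := hB.to_subtype
  have hmax : ∃ m : B, ∀ a, R m a → R a m := by
    refine exists_maximal_of_chains_bounded (r := R) ?_ ?_
    · intro S hS
      rcases S.eq_empty_or_nonempty with rfl | ⟨x₀, hx₀⟩
      · exact ⟨hne.some, by simp⟩
      obtain ⟨z, hz⟩ := hcomplete (Subtype.val '' S) (by
        rintro _ ⟨x, hx, rfl⟩ _ ⟨y, hy, rfl⟩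
        by_cases hxy : x = y
        · left; rw [hxy, hself]; exact le_top
        rcases hS hx hy hxy with h | h
        · exact Or.inl h
        · right; rw [hsymm]; exact h)
      have hz' : ∀ x ∈ S, r x ≤ dist x z := fun x hx => by
        rw [hsymm]; exact hz x ⟨x, hx, rfl⟩
      exact ⟨⟨z, (hmem x₀ x₀.2 z (hz' x₀ hx₀)).1⟩, hz'⟩
    · intro x y z hxy hyz
      exact (le_min hxy ((hmem x x.2 y hxy).2.trans hyz)).trans (htri _ _ _)
  obtain ⟨m, hm⟩ := hmax
  refine ⟨m, m.2, ?_⟩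
  by_contra hlt
  obtain ⟨y, hy, hry⟩ := hnext m m.2 (lt_top_iff_ne_top.mpr hlt)
  have hy' := hmem m m.2 y hy
  have := hm ⟨y, hy'.1⟩ hy
  exact absurd (hmem y hy'.1 m this).2 (not_le.mpr hry)

/-! ### Valuations of tuples -/

section TupleVal

variable {n : ℕ}

theorem le_tupleVal_iff {K Γ : Type} [Field K] [LinearOrderedAddCommMonoidWithTop Γ]
    {v : AddValuation K Γ} {a : Fin n → K} {r : Γ} : r ≤ tupleVal v a ↔ ∀ i, r ≤ v (a i) := by
  simp [tupleVal]

theorem tupleVal_le {K Γ : Type} [Field K] [LinearOrderedAddCommMonoidWithTop Γ]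
    (v : AddValuation K Γ) (a : Fin n → K) (i : Fin n) : tupleVal v a ≤ v (a i) :=
  le_tupleVal_iff.mp le_rfl i

theorem min_tupleVal_le_add {K Γ : Type} [Field K] [LinearOrderedAddCommMonoidWithTop Γ]
    (v : AddValuation K Γ) (a b : Fin n → K) :
    min (tupleVal v a) (tupleVal v b) ≤ tupleVal v (a + b) :=
  le_tupleVal_iff.mpr fun i => (min_le_min (tupleVal_le v a i) (tupleVal_le v b i)).trans
    (v.map_add _ _)

theorem tupleVal_neg {K Γ : Type} [Field K] [LinearOrderedAddCommMonoidWithTop Γ]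
    (v : AddValuation K Γ) (a : Fin n → K) : tupleVal v (-a) = tupleVal v a := by
  simp [tupleVal]

theorem tupleVal_sub_comm {K Γ : Type} [Field K] [LinearOrderedAddCommMonoidWithTop Γ]
    (v : AddValuation K Γ) (a b : Fin n → K) : tupleVal v (a - b) = tupleVal v (b - a) := by
  rw [← tupleVal_neg, neg_sub]

theorem min_tupleVal_le_sub {K Γ : Type} [Field K] [LinearOrderedAddCommMonoidWithTop Γ]
    (v : AddValuation K Γ) (a b : Fin n → K) :
    min (tupleVal v a) (tupleVal v b) ≤ tupleVal v (a - b) := by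
  rw [sub_eq_add_neg, ← tupleVal_neg v b]
  exact min_tupleVal_le_add v a (-b)

theorem tupleVal_zero {K Γ : Type} [Field K] [LinearOrderedAddCommMonoidWithTop Γ]
    (v : AddValuation K Γ) : tupleVal v (0 : Fin n → K) = ⊤ := by
  simp [tupleVal]

theorem val_eq_top_iff {x : RStar} : val x = ⊤ ↔ x = 0 := by
  rw [val_apply, HahnSeries.orderTop_eq_top]
  exact ofLex_eq_zero

theorem tupleVal_val_eq_top_iff {a : Fin n → RStar} : tupleVal val a = ⊤ ↔ a = 0 := by
  rw [← top_le_iff, le_tupleVal_iff, funext_iff]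
  simp

/-- The contraction principle on valuative balls of `(ℝ*) ^ n`. -/
theorem exists_fixedPoint (a : Fin n → RStar) (f : (Fin n → RStar) → Fin n → RStar)
    (hf : Set.MapsTo f (openBall val a 0) (openBall val a 0))
    (hcontr : ∀ x ∈ openBall val a 0, ∀ y ∈ openBall val a 0, x ≠ y →
      tupleVal val (x - y) < tupleVal val (f x - f y)) :
    ∃ x ∈ openBall val a 0, f x = x := by
  have hcontr' : ∀ x ∈ openBall val a 0, ∀ y ∈ openBall val a 0,
      tupleVal val (x - y) ≤ tupleVal val (f x - f y) := by
    intro x hx y hy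
    by_cases hxy : x = y
    · subst hxy; simp
    · exact (hcontr x hx y hy hxy).le
  have hpos : ∀ x ∈ openBall val a 0, ∀ y ∈ openBall val a 0, 0 < tupleVal val (x - y) := by
    intro x hx y hy
    have := min_tupleVal_le_sub val (x - a) (y - a)
    rw [sub_sub_sub_cancel_right] at this
    exact (lt_min hx hy).trans_le this
  -- The radius at `x` is the valuation of `x - f x`, which is infinite exactly at fixed points; `f
  -- x` itself is the improved approximation.
  obtain ⟨x, hx, hx'⟩ := exists_radius_eq_top (fun x y => tupleVal val (x - y)) (openBall val a 0)
    ⟨a, by simp [openBall, tupleVal_zero]⟩ (fun x => tupleVal val (x - f x))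
    (fun x => by simp [tupleVal_zero])
    (fun x y z => by
      have := min_tupleVal_le_add val (x - y) (y - z)
      rwa [sub_add_sub_cancel] at this)
    (by
      intro S hS
      have : ∀ i, ∃ z : HahnSeries ℚ ℝ, ∀ x : S,
          tupleVal val (x.1 - f x) ≤ (z - ofLex (x.1 i)).orderTop := by
        intro i
        refine exists_pseudoLimit (fun x : S => ofLex (x.1 i)) _ ?_
        intro x y
        rcases hS x x.2 y y.2 with h | h
        · exact Or.inl (h.trans (tupleVal_le val _ i))
        · exact Or.inr (h.trans (tupleVal_le val _ i))
      choose z hz using this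
      exact ⟨fun i => toLex (z i), fun x hx => le_tupleVal_iff.mpr fun i => hz i ⟨x, hx⟩⟩)
    (fun x y => tupleVal_sub_comm val x y)
    (by
      intro x hx y hxy
      have hfx := hf hx
      have hy : y ∈ openBall val a 0 := by
        have h1 := min_tupleVal_le_sub val (x - a) (x - y)
        rw [sub_sub_sub_cancel_left] at h1
        exact (lt_min hx ((hpos x hx _ hfx).trans_le hxy)).trans_le h1
      refine ⟨hy, ?_⟩
      have h1 := min_tupleVal_le_add val (x - f x) (f x - f y)
      have h2 := min_tupleVal_le_sub val (x - f y) (x - y)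
      rw [sub_add_sub_cancel] at h1
      rw [sub_sub_sub_cancel_left] at h2
      exact (le_min ((le_min le_rfl (hxy.trans (hcontr' x hx y hy))).trans h1) hxy).trans h2)
    (by
      intro x hx hlt
      refine ⟨f x, le_rfl, hcontr x hx _ (hf hx) ?_⟩
      intro h
      rw [← h] at hlt
      simp [tupleVal_zero] at hlt)
  refine ⟨x, hx, ?_⟩
  rw [tupleVal_val_eq_top_iff, sub_eq_zero] at hx'
  exact hx'.symm

end TupleVal

/-! ### Hahn series with algebraically closed coefficients are algebraically closed -/

section HahnAlgClosed

open Polynomial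

variable {k : Type*} [Field k]

theorem coeff_zero_mul_of_nonneg {x y : HahnSeries ℚ k} (hx : 0 ≤ x.orderTop)
    (hy : 0 ≤ y.orderTop) : (x * y).coeff 0 = x.coeff 0 * y.coeff 0 := by
  have key : ∀ z : HahnSeries ℚ k, 0 ≤ z.orderTop →
      0 < (z - HahnSeries.C (z.coeff 0)).orderTop := by
    intro z hz
    have h0 : 0 ≤ (z - HahnSeries.C (z.coeff 0)).orderTop := by
      rw [HahnSeries.le_orderTop_iff_forall]
      intro q hq
      have hq' : q < 0 := by exact_mod_cast hq
      rw [HahnSeries.coeff_sub, HahnSeries.coeff_eq_zero_of_lt_orderTop (hq.trans_le hz),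
        HahnSeries.C_apply, HahnSeries.coeff_single_of_ne hq'.ne, sub_zero]
    refine lt_of_le_of_ne h0 fun h => ?_
    have := HahnSeries.coeff_orderTop_ne (x := z - HahnSeries.C (z.coeff 0)) (g := 0) h.symm
    simp [HahnSeries.C_apply] at this
  have hxy : x * y = (x - HahnSeries.C (x.coeff 0)) * y +
      HahnSeries.C (x.coeff 0) * y := by ring
  rw [hxy, HahnSeries.coeff_add, HahnSeries.C_apply, HahnSeries.coeff_single_zero_mul,
    HahnSeries.coeff_eq_zero_of_lt_orderTop, zero_add]
  rw [HahnSeries.orderTop_mul]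
  exact add_pos_of_pos_of_nonneg (key x hx) hy

variable (k) in
/-- The valuation ring of the field of Hahn series. -/
def hahnIntegers : Subring (HahnSeries ℚ k) where
  carrier := {x | 0 ≤ x.orderTop}
  mul_mem' {x y} hx hy := by
    change 0 ≤ (x * y).orderTop
    rw [HahnSeries.orderTop_mul]
    exact add_nonneg hx hy
  one_mem' := by simp
  add_mem' {x y} hx hy := by
    change 0 ≤ (x + y).orderTop
    exact (le_min hx hy).trans HahnSeries.min_orderTop_le_orderTop_add
  zero_mem' := by simp
  neg_mem' {x} hx := by
    change 0 ≤ (-x).orderTop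
    rw [HahnSeries.orderTop_neg]
    exact hx

variable (k) in
/-- The residue map of the field of Hahn series. -/
def hahnResidue : hahnIntegers k →+* k where
  toFun x := x.1.coeff 0
  map_one' := by simp [HahnSeries.coeff_one]
  map_mul' x y := coeff_zero_mul_of_nonneg x.2 y.2
  map_zero' := rfl
  map_add' x y := rfl

theorem hahnResidue_ne_zero_iff {x : hahnIntegers k} :
    hahnResidue k x ≠ 0 ↔ x.1.orderTop = 0 := by
  constructor
  · intro h
    exact le_antisymm (HahnSeries.orderTop_le_of_coeff_ne_zero h) x.2
  · intro h
    exact HahnSeries.coeff_orderTop_ne h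

/-- The polynomial has integral coefficients and its reduction is not constant. -/
def HasNonconstReduction (f : (HahnSeries ℚ k)[X]) : Prop :=
  (∀ i, 0 ≤ (f.coeff i).orderTop) ∧ ∃ i, 1 ≤ i ∧ (f.coeff i).orderTop = 0

theorem HasNonconstReduction.exists_lift {f : (HahnSeries ℚ k)[X]} (hf : HasNonconstReduction f) :
    ∃ F : (hahnIntegers k)[X], F.map (hahnIntegers k).subtype = f ∧
      (F.map (hahnResidue k)).natDegree ≠ 0 := by
  have hT : (↑f.coeffs : Set (HahnSeries ℚ k)) ⊆ hahnIntegers k := by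
    intro c hc
    obtain ⟨i, -, rfl⟩ := Polynomial.mem_coeffs_iff.mp hc
    exact hf.1 i
  refine ⟨f.toSubring _ hT, f.map_toSubring _ hT, ?_⟩
  obtain ⟨i, hi, hi0⟩ := hf.2
  have : i ≤ ((f.toSubring _ hT).map (hahnResidue k)).natDegree := by
    apply Polynomial.le_natDegree_of_ne_zero
    rw [Polynomial.coeff_map, hahnResidue_ne_zero_iff, Polynomial.coeff_toSubring]
    exact hi0
  omega

theorem coeff_taylor_map_subtype (F : (hahnIntegers k)[X]) (w : hahnIntegers k) (i : ℕ) :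
    ((F.map (hahnIntegers k).subtype).taylor (w : HahnSeries ℚ k)).coeff i =
      ((F.taylor w).coeff i : HahnSeries ℚ k) := by
  have h := F.map_taylor w (hahnIntegers k).subtype
  rw [Subring.subtype_apply] at h
  rw [← h, Polynomial.coeff_map, Subring.subtype_apply]

/-- Translation by an integral element commutes with reduction and preserves the degree of the
reduced polynomial. -/
theorem HasNonconstReduction.taylor {f : (HahnSeries ℚ k)[X]} (hf : HasNonconstReduction f)
    {w : HahnSeries ℚ k} (hw : 0 ≤ w.orderTop) : HasNonconstReduction (f.taylor w) := by
  obtain ⟨F, hFf, hF⟩ := hf.exists_lift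
  obtain ⟨W, rfl⟩ : ∃ W : hahnIntegers k, (W : HahnSeries ℚ k) = w := ⟨⟨w, hw⟩, rfl⟩
  subst hFf
  refine ⟨fun i => ?_, ((F.taylor W).map (hahnResidue k)).natDegree, ?_, ?_⟩
  · rw [coeff_taylor_map_subtype]
    exact ((F.taylor W).coeff i).2
  · rw [Polynomial.map_taylor, Polynomial.natDegree_taylor]
    omega
  · rw [coeff_taylor_map_subtype]
    refine hahnResidue_ne_zero_iff.mp ?_
    rw [← Polynomial.coeff_map, Polynomial.coeff_natDegree, Ne, Polynomial.leadingCoeff_eq_zero]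
    intro h
    rw [Polynomial.map_taylor] at h
    rw [← Polynomial.natDegree_taylor _ (hahnResidue k W), h] at hF
    simp at hF

/-- A root of the reduction, taken as a constant series, makes the constant coefficient reduce to 0.
-/
theorem HasNonconstReduction.exists_pos [IsAlgClosed k] {f : (HahnSeries ℚ k)[X]}
    (hf : HasNonconstReduction f) :
    ∃ w : HahnSeries ℚ k, 0 ≤ w.orderTop ∧ 0 < ((f.taylor w).coeff 0).orderTop := by
  obtain ⟨F, hFf, hF⟩ := hf.exists_lift
  obtain ⟨z, hz⟩ := IsAlgClosed.exists_root (F.map (hahnResidue k)) (fun h => hF (by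
    rw [Polynomial.natDegree_eq_zero_iff_degree_le_zero, h]))
  have hw : 0 ≤ (HahnSeries.C z : HahnSeries ℚ k).orderTop := HahnSeries.orderTop_single_le
  obtain ⟨W, hW⟩ : ∃ W : hahnIntegers k, (W : HahnSeries ℚ k) = HahnSeries.C z := ⟨⟨_, hw⟩, rfl⟩
  refine ⟨HahnSeries.C z, hw, ?_⟩
  rw [← hW, ← hFf, coeff_taylor_map_subtype]
  refine lt_of_le_of_ne ((F.taylor W).coeff 0).2 fun h => ?_
  have h' := hahnResidue_ne_zero_iff.mpr h.symm
  rw [← Polynomial.coeff_map, Polynomial.map_taylor, Polynomial.taylor_coeff_zero] at h'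
  have : hahnResidue k W = z := by
    change (W : HahnSeries ℚ k).coeff 0 = z
    rw [hW, HahnSeries.C_apply, HahnSeries.coeff_single_same]
  rw [this] at h'
  exact h' hz

/-- The polynomial `t ^ (-δ) p (x + t ^ γ w)` in `w`. -/
noncomputable def rescaled (p : (HahnSeries ℚ k)[X]) (x : HahnSeries ℚ k) (γ δ : ℚ) :
    (HahnSeries ℚ k)[X] :=
  C (HahnSeries.single (-δ) 1) * (p.taylor x).comp (C (HahnSeries.single γ 1) * X)

theorem taylor_C_mul_comp {R : Type*} [CommRing R] (q : R[X]) (a s w : R) :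
    (C a * q.comp (C s * X)).taylor w = C a * (q.taylor (s * w)).comp (C s * X) := by
  simp only [Polynomial.taylor_apply, Polynomial.mul_comp, Polynomial.comp_assoc,
    Polynomial.C_comp, Polynomial.add_comp, Polynomial.X_comp, map_mul]
  congr 2
  ring

theorem rescaled_taylor (p : (HahnSeries ℚ k)[X]) (x w : HahnSeries ℚ k) (γ δ : ℚ) :
    (rescaled p x γ δ).taylor w = rescaled p (x + HahnSeries.single γ 1 * w) γ δ := by
  rw [rescaled, rescaled, taylor_C_mul_comp, Polynomial.taylor_taylor, add_comm]

theorem rescaled_coeff_orderTop (p : (HahnSeries ℚ k)[X]) (x : HahnSeries ℚ k) (γ δ : ℚ) (i : ℕ) :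
    ((rescaled p x γ δ).coeff i).orderTop =
      ((p.taylor x).coeff i).orderTop + ((i * γ - δ : ℚ) : WithTop ℚ) := by
  rw [rescaled, Polynomial.coeff_C_mul, Polynomial.comp_C_mul_X_coeff, HahnSeries.single_pow,
    HahnSeries.orderTop_mul, HahnSeries.orderTop_mul, HahnSeries.orderTop_single one_ne_zero,
    one_pow, HahnSeries.orderTop_single one_ne_zero, add_comm, add_assoc, ← WithTop.coe_add]
  congr 2
  simp [sub_eq_add_neg]

/-- This is the steepest slope of the Newton polygon of p at x; heuristically γ is the valuation of
the distance from x to the nearest root. -/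
theorem exists_rescaled (p : (HahnSeries ℚ k)[X]) (hp : p.natDegree ≠ 0) (x : HahnSeries ℚ k)
    (hx : p.eval x ≠ 0) : ∃ γ δ : ℚ, HasNonconstReduction (rescaled p x γ δ) ∧
      ((rescaled p x γ δ).coeff 0).orderTop = 0 := by
  set c := (p.taylor x).coeff with hc
  have hc0 : c 0 ≠ 0 := by rwa [hc, Polynomial.taylor_coeff_zero]
  let S := (p.taylor x).support.erase 0
  have hS : S.Nonempty := by
    refine ⟨p.natDegree, Finset.mem_erase.mpr ⟨hp, ?_⟩⟩
    rw [Polynomial.mem_support_iff, ← Polynomial.natDegree_taylor p x, Polynomial.coeff_natDegree,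
      Ne, Polynomial.leadingCoeff_eq_zero]
    intro h
    rw [← Polynomial.natDegree_taylor p x, h] at hp
    simp at hp
  obtain ⟨j, hj, hmax⟩ := S.exists_max_image (fun i => ((c 0).order - (c i).order) / i) hS
  have hS' : ∀ i ∈ S, 0 < (i : ℚ) ∧ c i ≠ 0 := by
    intro i hi
    have := Finset.mem_erase.mp hi
    exact ⟨by exact_mod_cast Nat.pos_of_ne_zero this.1, Polynomial.mem_support_iff.mp this.2⟩
  -- Here γ is the largest quotient (ord c₀ - ord cᵢ)/i and δ = ord c₀. Maximality makes all
  -- coefficients integral, and the indices 0 and j attain valuation 0.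
  refine ⟨((c 0).order - (c j).order) / j, (c 0).order, ⟨fun i => ?_, j, ?_, ?_⟩, ?_⟩
  · rw [rescaled_coeff_orderTop, ← hc]
    by_cases hci : c i = 0
    · simp [hci]
    rw [← HahnSeries.order_eq_orderTop_of_ne_zero hci, ← WithTop.coe_add]
    have : 0 ≤ (c i).order + (i * (((c 0).order - (c j).order) / j) - (c 0).order) := by
      rcases Nat.eq_zero_or_pos i with rfl | hi
      · simp
      · have hiS : i ∈ S := Finset.mem_erase.mpr ⟨hi.ne', Polynomial.mem_support_iff.mpr hci⟩
        have h1 := hmax i hiS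
        have h2 := (hS' i hiS).1
        rw [div_le_iff₀ h2] at h1
        linarith
    exact_mod_cast this
  · exact Nat.one_le_iff_ne_zero.mpr (Finset.mem_erase.mp hj).1
  · rw [rescaled_coeff_orderTop, ← hc, ← HahnSeries.order_eq_orderTop_of_ne_zero (hS' j hj).2,
      ← WithTop.coe_add]
    have : (c j).order + (j * (((c 0).order - (c j).order) / j) - (c 0).order) = 0 := by
      have := (hS' j hj).1.ne'
      field_simp
      ring
    exact_mod_cast this
  · rw [rescaled_coeff_orderTop, ← hc, ← HahnSeries.order_eq_orderTop_of_ne_zero hc0,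
      ← WithTop.coe_add]
    have : (c 0).order + ((0 : ℕ) * (((c 0).order - (c j).order) / j) - (c 0).order) = 0 := by
      simp
    exact_mod_cast this

/-- With i an index of valuation 0 for (γ, δ), one has ord cᵢ + iγ' ≥ δ' = ord c₀ ≥ δ = ord cᵢ + iγ.
The last inequality is strict when the constant coefficient reduces to 0. -/
theorem radius_le_of_rescaled {p : (HahnSeries ℚ k)[X]} {y : HahnSeries ℚ k} {γ δ γ' δ' : ℚ}
    (h : HasNonconstReduction (rescaled p y γ δ)) (h' : HasNonconstReduction (rescaled p y γ' δ'))
    (h0 : ((rescaled p y γ' δ').coeff 0).orderTop = 0) :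
    γ ≤ γ' ∧ (0 < ((rescaled p y γ δ).coeff 0).orderTop → γ < γ') := by
  simp only [HasNonconstReduction, rescaled_coeff_orderTop] at *
  obtain ⟨h, i, hi, hi0⟩ := h
  set c := (p.taylor y).coeff
  have hc0 : c 0 ≠ 0 := by
    intro hc; simp [hc] at h0
  have hci : c i ≠ 0 := by
    intro hc; simp [hc] at hi0
  have h1 := h 0
  have h2 := h'.1 i
  rw [← HahnSeries.order_eq_orderTop_of_ne_zero hc0, ← WithTop.coe_add] at *
  rw [← HahnSeries.order_eq_orderTop_of_ne_zero hci, ← WithTop.coe_add] at *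
  norm_cast at *
  simp only [zero_mul, zero_sub] at *
  have hipos : 0 < (i : ℚ) := by exact_mod_cast hi
  have h3 : 0 ≤ (i : ℚ) * (γ' - γ) := by linarith
  constructor
  · have := nonneg_of_mul_nonneg_right h3 hipos
    linarith
  · intro hlt
    have h4 : 0 < (i : ℚ) * (γ' - γ) := by linarith
    have := (mul_pos_iff_of_pos_left hipos).mp h4
    linarith

/-- Newton approximation carried out transfinitely: the radius at x is the Newton slope there,
infinite at roots. Moving by a lifted root of the reduction strictly increases it. -/
theorem exists_eval_eq_zero_of_natDegree_ne_zero [IsAlgClosed k] (p : (HahnSeries ℚ k)[X])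
    (hp : p.natDegree ≠ 0) : ∃ x, p.eval x = 0 := by
  classical
  have hex := fun x (hx : p.eval x ≠ 0) => exists_rescaled p hp x hx
  choose γ δ hγ h0 using hex
  let r : HahnSeries ℚ k → WithTop ℚ := fun x => if hx : p.eval x = 0 then ⊤ else (γ x hx : ℚ)
  have hr : ∀ x (hx : p.eval x ≠ 0), r x = (γ x hx : ℚ) := fun x hx => dif_neg hx
  have hmove : ∀ x y : HahnSeries ℚ k, ∀ g : ℚ, (g : WithTop ℚ) ≤ (x - y).orderTop →
      ∃ w : HahnSeries ℚ k, 0 ≤ w.orderTop ∧ y = x + HahnSeries.single g 1 * w := by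
    intro x y g hg
    refine ⟨HahnSeries.single (-g) 1 * (y - x), ?_, ?_⟩
    · rw [HahnSeries.orderTop_mul, HahnSeries.orderTop_single one_ne_zero, ← neg_sub x y,
        HahnSeries.orderTop_neg]
      refine le_trans ?_ (add_le_add_right hg _)
      rw [← WithTop.coe_add]
      simp
    · rw [← mul_assoc, HahnSeries.single_mul_single]
      simp
  obtain ⟨x, -, hx⟩ := exists_radius_eq_top (fun x y : HahnSeries ℚ k => (x - y).orderTop)
    Set.univ ⟨0, trivial⟩ r (fun x => by simp)
    (fun x y z => by
      have := HahnSeries.min_orderTop_le_orderTop_add (x := x - y) (y := y - z)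
      rwa [sub_add_sub_cancel] at this)
    (by
      intro S hS
      obtain ⟨z, hz⟩ := exists_pseudoLimit (fun x : S => x.1) (fun x => r x.1)
        (fun x y => hS x x.2 y y.2)
      exact ⟨z, fun x hx => hz ⟨x, hx⟩⟩)
    (fun x y => by rw [← HahnSeries.orderTop_neg, neg_sub])
    (by
      intro x _ y hxy
      refine ⟨trivial, ?_⟩
      by_cases hy : p.eval y = 0
      · simp [r, hy]
      by_cases hx : p.eval x = 0
      · have : r x = ⊤ := dif_pos hx
        rw [this, top_le_iff, HahnSeries.orderTop_eq_top, sub_eq_zero] at hxy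
        rw [hxy]
      rw [hr x hx] at hxy ⊢
      rw [hr y hy]
      obtain ⟨w, hw, hyw⟩ := hmove x y _ hxy
      have h1 := (hγ x hx).taylor hw
      rw [rescaled_taylor, ← hyw] at h1
      exact_mod_cast (radius_le_of_rescaled h1 (hγ y hy) (h0 y hy)).1)
    (by
      intro x _ hlt
      have hx : p.eval x ≠ 0 := by
        intro h
        simp [r, h] at hlt
      obtain ⟨w, hw, hpos⟩ := (hγ x hx).exists_pos
      refine ⟨x + HahnSeries.single (γ x hx) 1 * w, ?_, ?_⟩
      · rw [hr x hx, sub_add_cancel_left, HahnSeries.orderTop_neg, HahnSeries.orderTop_mul,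
          HahnSeries.orderTop_single one_ne_zero]
        exact le_add_of_nonneg_right hw
      · by_cases hy : p.eval (x + HahnSeries.single (γ x hx) 1 * w) = 0
        · have : r (x + HahnSeries.single (γ x hx) 1 * w) = ⊤ := dif_pos hy
          rwa [this]
        · have h1 := (hγ x hx).taylor hw
          rw [rescaled_taylor] at h1 hpos
          rw [hr x hx, hr _ hy]
          exact_mod_cast (radius_le_of_rescaled h1 (hγ _ hy) (h0 _ hy)).2 hpos)
  refine ⟨x, ?_⟩
  by_contra h
  simp [hr x h] at hx

end HahnAlgClosed

/-! ### The intermediate value property for polynomials -/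

/-- The intermediate value property for polynomials, which characterizes real closed fields. -/
def PolynomialIVT (K : Type*) [Field K] [LinearOrder K] : Prop :=
  ∀ (p : Polynomial K) (a b : K), a < b → p.eval a < 0 → 0 < p.eval b →
    ∃ c, a < c ∧ c < b ∧ p.eval c = 0

open Polynomial in
-- H plays the role of K(i). For a root x + iy with y ≠ 0, the remainder of p modulo (X - x)² + y²
-- has degree at most 1 and vanishes at x + iy, so both its coefficients are 0.
theorem exists_dvd_of_natDegree_ne_zero {K H : Type*} [Field K] [Field H]
    (ι : K →+* H) (I : H) (hI : I * I = -1)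
    (hdec : ∀ z, ∃ a b, z = ι a + I * ι b) (hind : ∀ a b, ι a + I * ι b = 0 → a = 0 ∧ b = 0)
    (hroot : ∀ p : H[X], p.natDegree ≠ 0 → ∃ z, p.eval z = 0)
    (p : K[X]) (hp : p.natDegree ≠ 0) :
    (∃ x, p.eval x = 0) ∨
      ∃ x y : K, y ≠ 0 ∧ ((X - C x) ^ 2 + C (y ^ 2)) ∣ p := by
  obtain ⟨z, hz⟩ := hroot (p.map ι) (by rwa [natDegree_map])
  obtain ⟨x, y, rfl⟩ := hdec z
  by_cases hy : y = 0
  · left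
    refine ⟨x, ι.injective ?_⟩
    rw [hy, map_zero, mul_zero, add_zero, eval_map_apply] at hz
    rw [hz, map_zero]
  right
  refine ⟨x, y, hy, ?_⟩
  have hmonic : ((X - C x) ^ 2 + C (y ^ 2)).Monic :=
    ((monic_X_sub_C x).pow 2).add_of_left (by
      rw [degree_pow, degree_X_sub_C]
      exact degree_C_le.trans_lt (by norm_num))
  have hdeg : ((X - C x) ^ 2 + C (y ^ 2)).natDegree = 2 := by
    rw [natDegree_add_C, natDegree_pow, natDegree_X_sub_C]
  rw [← modByMonic_eq_zero_iff_dvd hmonic]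
  set q := ((X - C x) ^ 2 + C (y ^ 2)) with hq
  set r := p %ₘ q with hr
  have hrdeg : r.natDegree ≤ 1 := by
    have : r.natDegree < q.natDegree := natDegree_modByMonic_lt p hmonic (by
      intro h; rw [h, natDegree_one] at hdeg; omega)
    omega
  obtain ⟨α, β, hαβ⟩ := exists_eq_X_add_C_of_natDegree_le_one hrdeg
  have hsum : r + q * (p /ₘ q) = p := modByMonic_add_div p q
  have hqz : (q.map ι).eval (ι x + I * ι y) = 0 := by
    simp only [hq, Polynomial.map_add, Polynomial.map_pow, Polynomial.map_sub, map_X, map_C,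
      eval_add, eval_pow, eval_sub, eval_X, eval_C, map_pow]
    linear_combination ι y ^ 2 * hI
  have hrz : (r.map ι).eval (ι x + I * ι y) = 0 := by
    rw [← hsum, Polynomial.map_add, Polynomial.map_mul, eval_add, eval_mul, hqz, zero_mul,
      add_zero] at hz
    exact hz
  rw [hαβ] at hrz
  simp only [Polynomial.map_add, Polynomial.map_mul, map_X, map_C, eval_add, eval_mul, eval_X,
    eval_C] at hrz
  have h := hind (α * x + β) (α * y) (by
    simp only [map_add, map_mul]
    linear_combination hrz)
  have hα : α = 0 := (mul_eq_zero.mp h.2).resolve_right hy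
  have hβ : β = 0 := by simpa [hα] using h.1
  rw [hαβ, hα, hβ]
  simp

open Polynomial in
-- A quadratic factor is positive everywhere and a linear factor with root outside the open interval
-- has no sign change on its endpoints. Such factors can be divided out without losing the sign
-- change of p, which permits induction on the degree.
theorem polynomialIVT_of_dvd {K : Type*} [Field K] [LinearOrder K] [IsStrictOrderedRing K]
    (h : ∀ p : K[X], p.natDegree ≠ 0 → (∃ x, p.eval x = 0) ∨
      ∃ x y : K, y ≠ 0 ∧ ((X - C x) ^ 2 + C (y ^ 2)) ∣ p) : PolynomialIVT K := by
  suffices H : ∀ (n : ℕ) (p : K[X]), p.natDegree ≤ n → ∀ a b : K, a < b →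
      p.eval a * p.eval b < 0 → ∃ c, a < c ∧ c < b ∧ p.eval c = 0 by
    intro p a b hab ha hb
    exact H _ p le_rfl a b hab (mul_neg_of_neg_of_pos ha hb)
  intro n
  induction n with
  | zero =>
    intro p hp a b _ hneg
    rw [eq_C_of_natDegree_le_zero hp, eval_C, eval_C] at hneg
    exact absurd hneg (not_lt.mpr (mul_self_nonneg _))
  | succ n ih =>
    intro p hp a b hab hneg
    by_cases hp0 : p.natDegree = 0
    · exact ih p (by omega) a b hab hneg
    rcases h p hp0 with ⟨x, hx⟩ | ⟨x, y, hy, q, rfl⟩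
    · by_cases hax : a < x ∧ x < b
      · exact ⟨x, hax.1, hax.2, hx⟩
      obtain ⟨q, rfl⟩ := dvd_iff_isRoot.mpr hx
      have hq0 : q ≠ 0 := by rintro rfl; simp at hp0
      rw [natDegree_mul (X_sub_C_ne_zero x) hq0, natDegree_X_sub_C] at hp
      simp only [eval_mul, eval_sub, eval_X, eval_C] at hneg ⊢
      have hpos : 0 ≤ (a - x) * (b - x) := by
        by_cases h1 : a < x
        · have h2 : b ≤ x := not_lt.mp fun h2 => hax ⟨h1, h2⟩
          exact mul_nonneg_of_nonpos_of_nonpos (by linarith) (by linarith)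
        · exact mul_nonneg (by linarith [not_lt.mp h1]) (by linarith [not_lt.mp h1])
      obtain ⟨c, h1, h2, h3⟩ := ih q (by omega) a b hab (by
        by_contra hcon
        have := mul_nonneg hpos (not_lt.mp hcon)
        nlinarith)
      exact ⟨c, h1, h2, by rw [h3, mul_zero]⟩
    · have hdeg : ((X - C x) ^ 2 + C (y ^ 2)).natDegree = 2 := by
        rw [natDegree_add_C, natDegree_pow, natDegree_X_sub_C]
      have hq0 : q ≠ 0 := by rintro rfl; simp at hp0
      rw [natDegree_mul (fun h0 => by rw [h0, natDegree_zero] at hdeg; omega) hq0, hdeg] at hp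
      simp only [eval_mul, eval_add, eval_pow, eval_sub, eval_X, eval_C] at hneg ⊢
      have hpos : ∀ u : K, 0 < (u - x) ^ 2 + y ^ 2 := fun u => by positivity
      obtain ⟨c, h1, h2, h3⟩ := ih q (by omega) a b hab (by
        by_contra hcon
        have := mul_nonneg (mul_nonneg (hpos a).le (hpos b).le) (not_lt.mp hcon)
        nlinarith)
      exact ⟨c, h1, h2, by rw [h3, mul_zero]⟩

/-- The embedding of the real Hahn series into the complex ones. -/
noncomputable def complexify : RStar →+* HahnSeries ℚ ℂ where
  toFun x := (ofLex x).map Complex.ofRealHom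
  map_one' := HahnSeries.map_one Complex.ofRealHom.toMonoidWithZeroHom
  map_mul' _ _ := HahnSeries.map_mul Complex.ofRealHom.toNonUnitalRingHom
  map_zero' := HahnSeries.map_zero (Complex.ofRealHom.toMonoidWithZeroHom.toZeroHom)
  map_add' _ _ := HahnSeries.map_add Complex.ofRealHom.toAddMonoidHom

theorem complexify_coeff (x : RStar) (q : ℚ) :
    (complexify x).coeff q = ((ofLex x).coeff q : ℂ) := rfl

/-- Taking real and imaginary parts of coefficients writes ℂ((t^ℚ)) as ℝ* adjoined i, and the former
is algebraically closed. -/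
theorem polynomialIVT_rStar : PolynomialIVT RStar := by
  refine polynomialIVT_of_dvd fun p hp => exists_dvd_of_natDegree_ne_zero complexify
    (HahnSeries.C Complex.I) ?_ ?_ ?_ exists_eval_eq_zero_of_natDegree_ne_zero p hp
  · rw [← map_mul, Complex.I_mul_I, map_neg, map_one]
  · intro z
    refine ⟨toLex (z.map Complex.reAddGroupHom), toLex (z.map Complex.imAddGroupHom), ?_⟩
    ext q
    rw [HahnSeries.coeff_add, HahnSeries.C_apply, HahnSeries.coeff_single_zero_mul,
      complexify_coeff, complexify_coeff]
    simp [mul_comm Complex.I]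
  · intro a b h
    have hq : ∀ q, (ofLex a).coeff q = 0 ∧ (ofLex b).coeff q = 0 := by
      intro q
      have := congrArg (fun z => HahnSeries.coeff z q) h
      simp only [HahnSeries.coeff_add, HahnSeries.C_apply, HahnSeries.coeff_single_zero_mul,
        complexify_coeff, HahnSeries.coeff_zero] at this
      constructor
      · simpa using congrArg Complex.re this
      · simpa using congrArg Complex.im this
    constructor
    · exact HahnSeries.ext (funext fun q => (hq q).1)
    · exact HahnSeries.ext (funext fun q => (hq q).2)

theorem polynomialIVT_real : PolynomialIVT ℝ := by
  intro p a b hab ha hb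
  obtain ⟨c, hc, hc0⟩ := intermediate_value_Ioo hab.le p.continuous.continuousOn ⟨ha, hb⟩
  exact ⟨c, hc.1, hc.2, hc0⟩

/-! ### Polynomials over real closed fields -/

section RealClosed

open Polynomial

variable {K : Type*} [Field K] [LinearOrder K] [IsStrictOrderedRing K]

theorem PolynomialIVT.exists_root (hK : PolynomialIVT K) (p : K[X]) {a b : K} (hab : a < b)
    (h : p.eval a * p.eval b < 0) : ∃ c, a < c ∧ c < b ∧ p.eval c = 0 := by
  rcases mul_neg_iff.mp h with ⟨ha, hb⟩ | ⟨ha, hb⟩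
  · obtain ⟨c, h1, h2, h3⟩ := hK (-p) a b hab (by simpa using ha) (by simpa using hb)
    exact ⟨c, h1, h2, by simpa using h3⟩
  · exact hK p a b hab ha hb

/-- Rolle's theorem without compactness. Between `a` and the next root b', write p = (X - a)^(m+1)
(X - b')^(n+1) s. The cofactor s has the same sign at both ends, which forces opposite signs at the
ends for the remaining factor u of the derivative. -/
theorem PolynomialIVT.exists_derivative_root (hK : PolynomialIVT K) (p : K[X]) {a b : K}
    (hab : a < b) (ha : p.eval a = 0) (hb : p.eval b = 0) :
    ∃ c, a < c ∧ c < b ∧ p.derivative.eval c = 0 := by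
  classical
  by_cases hp : p = 0
  · subst hp
    obtain ⟨c, h1, h2⟩ := exists_between hab
    exact ⟨c, h1, h2, by simp⟩
  let S := p.roots.toFinset.filter (a < ·)
  have hS : ∀ x, x ∈ S ↔ p.eval x = 0 ∧ a < x := by
    intro x; simp [S, hp]
  have hne : S.Nonempty := ⟨b, (hS b).mpr ⟨hb, hab⟩⟩
  set b' := S.min' hne with hb'
  have hb'S := (hS b').mp (S.min'_mem hne)
  have hle : b' ≤ b := S.min'_le b ((hS b).mpr ⟨hb, hab⟩)
  have hnoroot : ∀ c, a < c → c < b' → p.eval c ≠ 0 := fun c h1 h2 h3 =>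
    absurd (S.min'_le c ((hS c).mpr ⟨h3, h1⟩)) (not_le.mpr h2)
  obtain ⟨q, hq, hqa⟩ := exists_eq_pow_rootMultiplicity_mul_and_not_dvd p hp a
  have hq0 : q ≠ 0 := by rintro rfl; simp at hqa
  obtain ⟨s, hs, hsb⟩ := exists_eq_pow_rootMultiplicity_mul_and_not_dvd q hq0 b'
  have hm : rootMultiplicity a p ≠ 0 := ((rootMultiplicity_pos hp).mpr ha).ne'
  have hn : rootMultiplicity b' q ≠ 0 := by
    refine ((rootMultiplicity_pos hq0).mpr ?_).ne'
    have h1 := hb'S.1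
    rw [hq, eval_mul, eval_pow, eval_sub, eval_X, eval_C] at h1
    exact (mul_eq_zero.mp h1).resolve_left (pow_ne_zero _ (sub_ne_zero.mpr hb'S.2.ne'))
  obtain ⟨m, hm⟩ := Nat.exists_eq_succ_of_ne_zero hm
  obtain ⟨n, hn⟩ := Nat.exists_eq_succ_of_ne_zero hn
  rw [hm] at hq
  rw [hn] at hs
  have hsa0 : s.eval a ≠ 0 := by
    intro h
    refine hqa (dvd_iff_isRoot.mpr ?_)
    rw [IsRoot, hs, eval_mul, h, mul_zero]
  have hsb0 : s.eval b' ≠ 0 := fun h => hsb (dvd_iff_isRoot.mpr h)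
  have hsab : 0 < s.eval a * s.eval b' := by
    refine lt_of_le_of_ne (not_lt.mp fun hlt => ?_) (mul_ne_zero hsa0 hsb0).symm
    obtain ⟨c, h1, h2, h3⟩ := hK.exists_root s hb'S.2 hlt
    refine hnoroot c h1 h2 ?_
    rw [hq, hs, eval_mul, eval_mul, h3, mul_zero, mul_zero]
  let u : K[X] := C ((m + 1 : ℕ) : K) * (X - C b') * s + C ((n + 1 : ℕ) : K) * (X - C a) * s +
    (X - C a) * (X - C b') * s.derivative
  have hder : p.derivative = (X - C a) ^ m * (X - C b') ^ n * u := by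
    rw [hq, hs]
    simp only [u, derivative_mul, derivative_X_sub_C_pow, Nat.succ_eq_add_one, Nat.add_sub_cancel]
    ring
  have hua : u.eval a * u.eval b' < 0 := by
    have : u.eval a * u.eval b' =
        -(((m + 1 : ℕ) : K) * ((n + 1 : ℕ) : K) * (b' - a) ^ 2 * (s.eval a * s.eval b')) := by
      simp only [u, eval_add, eval_mul, eval_sub, eval_X, eval_C]
      ring
    rw [this]
    have : 0 < b' - a := sub_pos.mpr hb'S.2
    exact neg_neg_of_pos (by positivity)
  obtain ⟨c, h1, h2, h3⟩ := hK.exists_root u hb'S.2 hua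
  exact ⟨c, h1, h2.trans_le hle, by rw [hder, eval_mul, h3, mul_zero]⟩

theorem PolynomialIVT.strictMono (hK : PolynomialIVT K) (p : K[X]) {a b : K} (hab : a < b)
    (h : ∀ c, a < c → c < b → 0 < p.derivative.eval c) : p.eval a < p.eval b := by
  let m := (p.eval b - p.eval a) / (b - a)
  have hba : 0 < b - a := sub_pos.mpr hab
  obtain ⟨c, h1, h2, h3⟩ := hK.exists_derivative_root (p - C m * (X - C a) - C (p.eval a)) hab
    (by simp) (by simp [m, div_mul_cancel₀ _ hba.ne'])
  have hc : p.derivative.eval c = m := by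
    simpa [sub_eq_zero] using h3
  have hm : 0 < m := hc ▸ h c h1 h2
  have := (div_pos_iff_of_pos_right hba).mp hm
  linarith

theorem exists_le_abs_eval (p : K[X]) (hp : p.natDegree ≠ 0) (B : K) :
    ∃ M, ∀ x, M ≤ x → B ≤ |p.eval x| := by
  induction hn : p.natDegree generalizing p B with
  | zero => exact absurd hn hp
  | succ n ih =>
    have hdiv : ∀ x, p.eval x = p.divX.eval x * x + p.coeff 0 := by
      intro x
      conv_lhs => rw [← divX_mul_X_add p]
      simp
    have habs : ∀ x, |p.divX.eval x| * |x| - |p.coeff 0| ≤ |p.eval x| := by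
      intro x
      rw [hdiv, ← abs_mul]
      have := abs_sub_abs_le_abs_sub (p.divX.eval x * x) (-p.coeff 0)
      rwa [abs_neg, sub_neg_eq_add] at this
    have hdeg : p.divX.natDegree = n := by
      rw [natDegree_divX_eq_natDegree_tsub_one, hn]; rfl
    by_cases hn0 : n = 0
    · obtain ⟨c, hc⟩ : ∃ c, p.divX = C c := ⟨_, eq_C_of_natDegree_eq_zero (hdeg.trans hn0)⟩
      have hc0 : c ≠ 0 := by
        rintro rfl
        have := divX_mul_X_add p
        rw [hc, map_zero, zero_mul, zero_add] at this
        rw [← this] at hp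
        simp at hp
      have hcpos : 0 < |c| := abs_pos.mpr hc0
      refine ⟨(B + |p.coeff 0|) / |c|, fun x hx => ?_⟩
      have h1 := habs x
      rw [hc, eval_C] at h1
      rw [div_le_iff₀ hcpos] at hx
      have := mul_le_mul_of_nonneg_left (le_abs_self x) hcpos.le
      linarith
    · obtain ⟨M, hM⟩ := ih p.divX (by omega) 1 hdeg
      refine ⟨max M (B + |p.coeff 0|), fun x hx => ?_⟩
      have h1 := hM x ((le_max_left _ _).trans hx)
      have h2 := mul_le_mul_of_nonneg_right h1 (abs_nonneg x)
      have := habs x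
      linarith [le_abs_self x, (le_max_right M (B + |p.coeff 0|)).trans hx]

/-- An increasing polynomial that becomes large in absolute value cannot stay nonpositive; this
serves the unbounded cells. -/
theorem PolynomialIVT.exists_pos_gt (hK : PolynomialIVT K) (p : K[X]) (hp : p.natDegree ≠ 0)
    (x : K) (h : ∀ c, x < c → 0 < p.derivative.eval c) : ∃ u, x < u ∧ 0 < p.eval u := by
  obtain ⟨M, hM⟩ := exists_le_abs_eval p hp (|p.eval x| + 1)
  set u := max M (x + 1)
  have hxu : x < u := (lt_add_one x).trans_le (le_max_right _ _)
  have h1 := hM u (le_max_left _ _)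
  have h2 := hK.strictMono p hxu fun c hc _ => h c hc
  refine ⟨u, hxu, ?_⟩
  by_contra hneg
  rw [abs_of_nonpos (not_lt.mp hneg)] at h1
  linarith [neg_abs_le (p.eval x)]

theorem PolynomialIVT.exists_neg_lt (hK : PolynomialIVT K) (p : K[X]) (hp : p.natDegree ≠ 0)
    (x : K) (h : ∀ c, c < x → 0 < p.derivative.eval c) : ∃ u, u < x ∧ p.eval u < 0 := by
  obtain ⟨u, hu, hpos⟩ := hK.exists_pos_gt (-(p.comp (-X))) (by simpa [natDegree_comp] using hp)
    (-x) (fun c hc => by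
      have := h (-c) (neg_lt.mp hc)
      simpa [derivative_comp] using this)
  exact ⟨-u, neg_lt.mp hu, by simpa using hpos⟩

/-! ### Cuts in a finite set -/

/-- The points `x` and `y` lie in the same cell of the decomposition given by `S`. -/
def SameCell (S : Finset K) (x y : K) : Prop := ∀ s ∈ S, (s < x ↔ s < y) ∧ (x < s ↔ y < s)

omit [Field K] [IsStrictOrderedRing K] in
theorem SameCell.convex {S : Finset K} {x a b c : K} (ha : SameCell S x a) (hb : SameCell S x b)
    (hac : a ≤ c) (hcb : c ≤ b) : SameCell S x c := fun s hs =>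
  ⟨⟨fun h => ((ha s hs).1.mp h).trans_le hac, fun h => (hb s hs).1.mpr (h.trans_le hcb)⟩,
    ⟨fun h => hcb.trans_lt ((hb s hs).2.mp h), fun h => (ha s hs).2.mpr (hac.trans_lt h)⟩⟩

variable {S : Finset K} {x : K} {p : K[X]}

theorem SameCell.eval_lt (hK : PolynomialIVT K)
    (hpos : ∀ u, SameCell S x u → 0 < p.derivative.eval u) {u w : K} (hu : SameCell S x u)
    (hw : SameCell S x w) (h : u < w) : p.eval u < p.eval w :=
  hK.strictMono p h fun _ h1 h2 => hpos _ (hu.convex hw h1.le h2.le)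

omit [Field K] [IsStrictOrderedRing K] in
theorem sameCell_of_left (hx : x ∉ S) {c : K} (hc : ∀ t ∈ S, t < x → t < c) (hcx : c ≤ x) :
    SameCell S x c := fun t ht =>
  ⟨⟨hc t ht, fun h => h.trans_le hcx⟩, ⟨fun h => hcx.trans_lt h, fun h =>
    lt_of_not_ge fun hle => absurd (hc t ht (lt_of_le_of_ne hle fun h => hx (h ▸ ht)))
      (not_lt.mpr h.le)⟩⟩

omit [Field K] [IsStrictOrderedRing K] in
theorem sameCell_of_right (hx : x ∉ S) {c : K} (hc : ∀ t ∈ S, x < t → c < t) (hcx : x ≤ c) :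
    SameCell S x c := fun t ht =>
  ⟨⟨fun h => h.trans_le hcx, fun h =>
    lt_of_not_ge fun hle => absurd (hc t ht (lt_of_le_of_ne hle fun h => hx (h ▸ ht)))
      (not_lt.mpr h.le)⟩, ⟨hc t ht, fun h => hcx.trans_lt h⟩⟩

omit [Field K] [IsStrictOrderedRing K] in
theorem SameCell.refl (S : Finset K) (x : K) : SameCell S x x := fun _ _ => ⟨Iff.rfl, Iff.rfl⟩

theorem eval_pos_of_left (hK : PolynomialIVT K) (hx : x ∉ S)
    (hpos : ∀ u, SameCell S x u → 0 < p.derivative.eval u) {s : K} (hsx : s < x)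
    (hmax : ∀ t ∈ S, t < x → t ≤ s) (hs : 0 ≤ p.eval s) : 0 < p.eval x :=
  hs.trans_lt (hK.strictMono p hsx fun _ h1 h2 =>
    hpos _ (sameCell_of_left hx (fun t ht h => (hmax t ht h).trans_lt h1) h2.le))

theorem eval_neg_of_right (hK : PolynomialIVT K) (hx : x ∉ S)
    (hpos : ∀ u, SameCell S x u → 0 < p.derivative.eval u) {s : K} (hsx : x < s)
    (hmin : ∀ t ∈ S, x < t → s ≤ t) (hs : p.eval s ≤ 0) : p.eval x < 0 :=
  (hK.strictMono p hsx fun _ h1 h2 =>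
    hpos _ (sameCell_of_right hx (fun t ht h => h2.trans_le (hmin t ht h)) h1.le)).trans_le hs

/-- On a cell where p increases, the sign of p is governed either by a root in the cell or by the
sign at an adjacent endpoint. The second kind of information can be compared between two fields. -/
theorem exists_root_or_left_or_right (hK : PolynomialIVT K) (hx : x ∉ S) (hp : p.natDegree ≠ 0)
    (hpos : ∀ u, SameCell S x u → 0 < p.derivative.eval u) :
    (∃ r, SameCell S x r ∧ p.eval r = 0) ∨
      (∃ s ∈ S, s < x ∧ (∀ t ∈ S, t < x → t ≤ s) ∧ 0 ≤ p.eval s) ∨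
      (∃ s ∈ S, x < s ∧ (∀ t ∈ S, x < t → s ≤ t) ∧ p.eval s ≤ 0) := by
  classical
  rcases lt_trichotomy (p.eval x) 0 with hneg | h0 | hgt
  · by_cases hne : (S.filter (x < ·)).Nonempty
    · obtain ⟨s, hs, hmin⟩ := (S.filter (x < ·)).exists_min_image id hne
      rw [Finset.mem_filter] at hs
      have hmin' : ∀ t ∈ S, x < t → s ≤ t := fun t ht h =>
        hmin t (Finset.mem_filter.mpr ⟨ht, h⟩)
      by_cases hs0 : p.eval s ≤ 0
      · exact Or.inr (Or.inr ⟨s, hs.1, hs.2, hmin', hs0⟩)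
      obtain ⟨r, h1, h2, h3⟩ := hK p x s hs.2 hneg (not_le.mp hs0)
      exact Or.inl ⟨r, sameCell_of_right hx (fun t ht h => h2.trans_le (hmin' t ht h)) h1.le, h3⟩
    · have hno : ∀ t ∈ S, ¬ x < t := fun t ht h => hne ⟨t, Finset.mem_filter.mpr ⟨ht, h⟩⟩
      have hcell : ∀ c, x ≤ c → SameCell S x c := fun c hc =>
        sameCell_of_right hx (fun t ht h => absurd h (hno t ht)) hc
      obtain ⟨u, hu, hupos⟩ := hK.exists_pos_gt p hp x fun c hc => hpos c (hcell c hc.le)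
      obtain ⟨r, h1, h2, h3⟩ := hK p x u hu hneg hupos
      exact Or.inl ⟨r, hcell r h1.le, h3⟩
  · exact Or.inl ⟨x, SameCell.refl S x, h0⟩
  · by_cases hne : (S.filter (· < x)).Nonempty
    · obtain ⟨s, hs, hmax⟩ := (S.filter (· < x)).exists_max_image id hne
      rw [Finset.mem_filter] at hs
      have hmax' : ∀ t ∈ S, t < x → t ≤ s := fun t ht h =>
        hmax t (Finset.mem_filter.mpr ⟨ht, h⟩)
      by_cases hs0 : 0 ≤ p.eval s
      · exact Or.inr (Or.inl ⟨s, hs.1, hs.2, hmax', hs0⟩)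
      obtain ⟨r, h1, h2, h3⟩ := hK p s x hs.2 (not_le.mp hs0) hgt
      exact Or.inl ⟨r, sameCell_of_left hx (fun t ht h => (hmax' t ht h).trans_lt h1) h2.le, h3⟩
    · have hno : ∀ t ∈ S, ¬ t < x := fun t ht h => hne ⟨t, Finset.mem_filter.mpr ⟨ht, h⟩⟩
      have hcell : ∀ c, c ≤ x → SameCell S x c := fun c hc =>
        sameCell_of_left hx (fun t ht h => absurd h (hno t ht)) hc
      obtain ⟨u, hu, huneg⟩ := hK.exists_neg_lt p hp x fun c hc => hpos c (hcell c hc.le)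
      obtain ⟨r, h1, h2, h3⟩ := hK p u x hu huneg hgt
      exact Or.inl ⟨r, hcell r h2.le, h3⟩

theorem PolynomialIVT.sign_eq_of_no_root (hK : PolynomialIVT K) {a b : K} (hab : a ≤ b)
    (h : ∀ c, a ≤ c → c ≤ b → p.eval c ≠ 0) : SignType.sign (p.eval a) = SignType.sign (p.eval b) := by
  rcases hab.eq_or_lt with rfl | hlt
  · rfl
  have ha := h a le_rfl hab
  have hb := h b hab le_rfl
  have hnn : ¬ p.eval a * p.eval b < 0 := fun hneg => by
    obtain ⟨c, h1, h2, h3⟩ := hK.exists_root p hlt hneg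
    exact h c h1.le h2.le h3
  rcases ha.lt_or_gt with ha | ha <;> rcases hb.lt_or_gt with hb | hb
  · rw [sign_neg ha, sign_neg hb]
  · exact absurd (mul_neg_of_neg_of_pos ha hb) hnn
  · exact absurd (mul_neg_of_pos_of_neg ha hb) hnn
  · rw [sign_pos ha, sign_pos hb]

end RealClosed

/-! ### Diagrams: finite partial order isomorphisms which determine signs -/

section Diagram

open Polynomial

variable {K K' : Type} [Field K] [LinearOrder K] [IsStrictOrderedRing K]
  [Field K'] [LinearOrder K'] [IsStrictOrderedRing K']

/-- The points `x` and `x'` have the same position with respect to the pairs in `E`. -/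
def SameCut (E : Finset (K × K')) (x : K) (x' : K') : Prop :=
  ∀ e ∈ E, (e.1 < x ↔ e.2 < x') ∧ (x < e.1 ↔ x' < e.2)

/-- `E` is a finite partial order isomorphism, and points with the same position with respect to
`E` give the same signs to corresponding polynomials. -/
structure IsDiagram (G : Set (K[X] × K'[X])) (E : Finset (K × K')) : Prop where
  sameCut : ∀ e ∈ E, SameCut E e.1 e.2
  sign_eq : ∀ x x', SameCut E x x' → ∀ P ∈ G,
    SignType.sign (P.1.eval x) = SignType.sign (P.2.eval x')

variable {G : Set (K[X] × K'[X])} {E : Finset (K × K')}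

omit [Field K] [IsStrictOrderedRing K] [Field K'] [IsStrictOrderedRing K'] in
theorem sameCut_swap [DecidableEq K] [DecidableEq K'] {x : K} {x' : K'} :
    SameCut (E.image Prod.swap) x' x ↔ SameCut E x x' := by
  simp only [SameCut, Finset.mem_image, Prod.exists]
  constructor
  · rintro h ⟨a, b⟩ he
    have := h (b, a) ⟨a, b, he, rfl⟩
    exact ⟨this.1.symm, this.2.symm⟩
  · rintro h _ ⟨a, b, he, rfl⟩
    have := h (a, b) he
    exact ⟨this.1.symm, this.2.symm⟩

omit [Field K] [IsStrictOrderedRing K] in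
-- Ordered fields are dense without endpoints, so this is the extension step of Cantor's
-- back-and-forth argument.
theorem exists_sameCut (hE : ∀ e ∈ E, SameCut E e.1 e.2) (x : K) : ∃ x', SameCut E x x' := by
  have key : ∀ (a b : K) (a' b' : K'), cmp a b = cmp a' b' ↔
      ((a < b ↔ a' < b') ∧ (b < a ↔ b' < a')) := by
    intro a b a' b'
    rcases lt_trichotomy a b with h | h | h <;> rcases lt_trichotomy a' b' with h' | h' | h' <;>
      simp [h, h', h.not_gt, h'.not_gt, cmp, cmpUsing]
  obtain ⟨b, hb⟩ := Order.PartialIso.exists_across (α := K) (β := K')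
    ⟨E, fun p hp q hq => (key _ _ _ _).mpr (hE q hq p hp)⟩ x
  exact ⟨b, fun e he => (key _ _ _ _).mp (hb e he)⟩

end Diagram

section Diagram

open Polynomial

variable {K K' : Type} [Field K] [LinearOrder K] [IsStrictOrderedRing K]
  [Field K'] [LinearOrder K'] [IsStrictOrderedRing K']
  {G H : Set (K[X] × K'[X])} {E : Finset (K × K')}

theorem eq_zero_of_forall_sameCell {S : Finset K} {x : K} {p : K[X]} (hx : x ∉ S)
    (h : ∀ u, SameCell S x u → p.eval u = 0) : p = 0 := by
  classical
  obtain ⟨a, hax, ha⟩ : ∃ a < x, ∀ t ∈ S, t < x → t ≤ a := by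
    by_cases hne : (S.filter (· < x)).Nonempty
    · obtain ⟨s, hs, hmax⟩ := (S.filter (· < x)).exists_max_image id hne
      rw [Finset.mem_filter] at hs
      exact ⟨s, hs.2, fun t ht h => hmax t (Finset.mem_filter.mpr ⟨ht, h⟩)⟩
    · exact ⟨x - 1, sub_one_lt x, fun t ht h => absurd ⟨t, Finset.mem_filter.mpr ⟨ht, h⟩⟩ hne⟩
  refine p.eq_zero_of_infinite_isRoot ((Set.Ioc_infinite hax).mono fun c hc => ?_)
  exact h c (sameCell_of_left hx (fun t ht htx => (ha t ht htx).trans_lt hc.1) hc.2)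

section Cells

variable [DecidableEq K] [DecidableEq K'] {x u : K} {x' u' : K'}

omit [Field K] [IsStrictOrderedRing K] [Field K'] [IsStrictOrderedRing K'] [DecidableEq K']

theorem SameCut.of_sameCell (h : SameCut E x x') (hu : SameCell (E.image Prod.fst) x u) :
    SameCut E u x' := fun e he => by
  have h1 := h e he
  have h2 := hu e.1 (Finset.mem_image_of_mem _ he)
  exact ⟨h2.1.symm.trans h1.1, h2.2.symm.trans h1.2⟩

omit [DecidableEq K] in
theorem SameCut.of_sameCell' [DecidableEq K'] (h : SameCut E x x')
    (hu : SameCell (E.image Prod.snd) x' u') : SameCut E x u' := fun e he => by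
  have h1 := h e he
  have h2 := hu e.2 (Finset.mem_image_of_mem _ he)
  exact ⟨h1.1.trans h2.1, h1.2.trans h2.2⟩

omit [DecidableEq K] in
theorem SameCut.sameCell' [DecidableEq K'] (h : SameCut E x x') (hu : SameCut E x u') :
    SameCell (E.image Prod.snd) x' u' := fun s hs => by
  obtain ⟨e, he, rfl⟩ := Finset.mem_image.mp hs
  exact ⟨(h e he).1.symm.trans (hu e he).1, (h e he).2.symm.trans (hu e he).2⟩

omit [DecidableEq K] in
theorem SameCut.eq_iff (h : SameCut E x x') {e : K × K'} (he : e ∈ E) : e.1 = x ↔ e.2 = x' := by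
  have := h e he
  constructor
  · rintro rfl
    exact le_antisymm (not_lt.mp fun hlt => lt_irrefl _ (this.2.mpr hlt))
      (not_lt.mp fun hlt => lt_irrefl _ (this.1.mpr hlt))
  · rintro rfl
    exact le_antisymm (not_lt.mp fun hlt => lt_irrefl _ (this.2.mp hlt))
      (not_lt.mp fun hlt => lt_irrefl _ (this.1.mp hlt))

theorem SameCut.notMem_iff [DecidableEq K'] (h : SameCut E x x') :
    x ∉ E.image Prod.fst ↔ x' ∉ E.image Prod.snd := by
  simp only [Finset.mem_image, not_exists, not_and]
  exact forall₂_congr fun e he => not_congr (h.eq_iff he)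

end Cells

omit [IsStrictOrderedRing K] [IsStrictOrderedRing K'] in
theorem IsDiagram.swap [DecidableEq K] [DecidableEq K'] (h : IsDiagram G E) :
    IsDiagram (Prod.swap ⁻¹' G) (E.image Prod.swap) := by
  constructor
  · intro e he
    obtain ⟨f, hf, rfl⟩ := Finset.mem_image.mp he
    exact sameCut_swap.mpr (h.sameCut f hf)
  · intro x' x hx P hP
    exact (h.sign_eq x x' (sameCut_swap.mp hx) _ hP).symm

theorem IsDiagram.snd_eq_zero [DecidableEq K] [DecidableEq K'] (h : IsDiagram G E)
    {P : K[X] × K'[X]} (hP : P ∈ G) (h0 : P.1 = 0) : P.2 = 0 := by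
  refine P.2.eq_zero_of_infinite_isRoot (Set.infinite_univ.mono fun x' _ => ?_)
  obtain ⟨x, hx⟩ := exists_sameCut h.swap.sameCut x'
  have := h.sign_eq x x' (sameCut_swap.mp hx) P hP
  rw [h0, eval_zero, sign_zero] at this
  exact sign_eq_zero_iff.mp this.symm

/-- Only roots of nonzero members of H matter: every root of a second component is matched by such a
point, and between its roots a polynomial keeps its sign. After pruning, each point is a root of
some member of H, so that other polynomials may be reduced modulo that member there. -/
theorem IsDiagram.prune (hK' : PolynomialIVT K') (h : IsDiagram G E) (hHG : H ⊆ G) :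
    ∃ E₀ ⊆ E, IsDiagram H E₀ ∧ ∀ e ∈ E₀, ∃ P ∈ H, P.1 ≠ 0 ∧ P.1.eval e.1 = 0 := by
  classical
  refine ⟨E.filter fun e => ∃ P ∈ H, P.1 ≠ 0 ∧ P.1.eval e.1 = 0, Finset.filter_subset _ _,
    ⟨fun e he f hf => h.sameCut e (Finset.filter_subset _ _ he) f (Finset.filter_subset _ _ hf),
    fun x x' hx P hP => ?_⟩, fun e he => (Finset.mem_filter.mp he).2⟩
  by_cases h0 : P.1 = 0
  · rw [h0, h.snd_eq_zero (hHG hP) h0, eval_zero, eval_zero, sign_zero, sign_zero]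
  obtain ⟨y, hy⟩ := exists_sameCut h.sameCut x
  rw [h.sign_eq x y hy P (hHG hP)]
  have hroot : ∀ c, P.2.eval c = 0 → ((c < y ↔ c < x') ∧ (y < c ↔ x' < c)) := by
    intro c hc
    obtain ⟨z, hz⟩ := exists_sameCut h.swap.sameCut c
    rw [sameCut_swap] at hz
    have hz0 : P.1.eval z = 0 := by
      have := h.sign_eq z c hz P (hHG hP)
      rwa [hc, sign_zero, sign_eq_zero_iff] at this
    have hzE : z ∈ E.image Prod.fst := by
      by_contra hne
      refine h0 (eq_zero_of_forall_sameCell hne fun u hu => ?_)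
      have := h.sign_eq u c (hz.of_sameCell hu) P (hHG hP)
      rwa [hc, sign_zero, sign_eq_zero_iff] at this
    obtain ⟨e, he, rfl⟩ := Finset.mem_image.mp hzE
    have hec : e.2 = c := (hz.eq_iff he).mp rfl
    have h1 := hy e he
    have h2 := hx e (Finset.mem_filter.mpr ⟨he, P, hP, h0, hz0⟩)
    rw [hec] at h1 h2
    exact ⟨h1.1.symm.trans h2.1, h1.2.symm.trans h2.2⟩
  have key : ∀ a b, a < b → (∀ c, P.2.eval c = 0 → ((c < a ↔ c < b) ∧ (a < c ↔ b < c))) →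
      SignType.sign (P.2.eval a) = SignType.sign (P.2.eval b) := by
    intro a b hab hc
    refine hK'.sign_eq_of_no_root hab.le fun c hac hcb hc0 => ?_
    have := hc c hc0
    rcases hac.eq_or_lt with rfl | hlt
    · exact lt_irrefl _ (this.1.mpr hab)
    · exact absurd (this.2.mp hlt) (not_lt.mpr hcb)
  rcases lt_trichotomy y x' with hlt | rfl | hlt
  · exact key y x' hlt hroot
  · rfl
  · exact (key x' y hlt fun c hc => ⟨(hroot c hc).1.symm, (hroot c hc).2.symm⟩).symm

section Extend

variable [DecidableEq K] [DecidableEq K'] {p : K[X]} {p' : K'[X]}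

omit [IsStrictOrderedRing K'] in
-- The sign is constant on the cell and common to both fields; it is not 0, as a derivative
-- vanishing on an infinite cell would make p constant.
theorem IsDiagram.derivative_sign (h : IsDiagram G E) (hder : (derivative p, derivative p') ∈ G)
    (hp : p.natDegree ≠ 0) {x : K} {x' : K'} (hx : SameCut E x x')
    (hxE : x ∉ E.image Prod.fst) :
    ((∀ u, SameCell (E.image Prod.fst) x u → 0 < p.derivative.eval u) ∧
      ∀ u, SameCell (E.image Prod.snd) x' u → 0 < p'.derivative.eval u) ∨
    ((∀ u, SameCell (E.image Prod.fst) x u → p.derivative.eval u < 0) ∧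
      ∀ u, SameCell (E.image Prod.snd) x' u → p'.derivative.eval u < 0) := by
  have h1 : ∀ u, SameCell (E.image Prod.fst) x u →
      SignType.sign (p.derivative.eval u) = SignType.sign (p'.derivative.eval x') :=
    fun u hu => h.sign_eq u x' (hx.of_sameCell hu) _ hder
  have h2 : ∀ u, SameCell (E.image Prod.snd) x' u →
      SignType.sign (p'.derivative.eval u) = SignType.sign (p'.derivative.eval x') := fun u hu =>
    (h.sign_eq x u (hx.of_sameCell' hu) _ hder).symm.trans (h.sign_eq x x' hx _ hder)
  rcases lt_trichotomy (p'.derivative.eval x') 0 with hs | hs | hs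
  · rw [sign_neg hs] at h1 h2
    exact Or.inr ⟨fun u hu => sign_eq_neg_one_iff.mp (h1 u hu),
      fun u hu => sign_eq_neg_one_iff.mp (h2 u hu)⟩
  · rw [hs, sign_zero] at h1
    have : p.derivative = 0 :=
      eq_zero_of_forall_sameCell hxE fun u hu => sign_eq_zero_iff.mp (h1 u hu)
    exact absurd (derivative_eq_zero.mp this) hp
  · rw [sign_pos hs] at h1 h2
    exact Or.inl ⟨fun u hu => sign_eq_one_iff.mp (h1 u hu),
      fun u hu => sign_eq_one_iff.mp (h2 u hu)⟩

omit [IsStrictOrderedRing K'] in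
theorem IsDiagram.root_unique (hK : PolynomialIVT K) (h : IsDiagram G E)
    (hder : (derivative p, derivative p') ∈ G) (hp : p.natDegree ≠ 0) {x : K} {x' : K'}
    (hx : SameCut E x x') {u : K} (hu : SameCell (E.image Prod.fst) x u)
    (hx0 : p.eval x = 0) (hu0 : p.eval u = 0) : x = u := by
  by_cases hxE : x ∈ E.image Prod.fst
  · have := hu x hxE
    exact le_antisymm (not_lt.mp fun hlt => lt_irrefl _ (this.2.mpr hlt))
      (not_lt.mp fun hlt => lt_irrefl _ (this.1.mpr hlt))
  have key : ∀ q : K[X], q.eval x = 0 → q.eval u = 0 →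
      (∀ u, SameCell (E.image Prod.fst) x u → 0 < q.derivative.eval u) → x = u := by
    intro q hq hqu hpos
    rcases lt_trichotomy x u with hlt | heq | hlt
    · have := SameCell.eval_lt hK hpos (SameCell.refl _ x) hu hlt
      exact absurd (hq.trans hqu.symm) this.ne
    · exact heq
    · have := SameCell.eval_lt hK hpos hu (SameCell.refl _ x) hlt
      exact absurd (hqu.trans hq.symm) this.ne
  rcases h.derivative_sign hder hp hx hxE with ⟨hpos, -⟩ | ⟨hneg, -⟩
  · exact key p hx0 hu0 hpos
  · exact key (-p) (by simpa using hx0) (by simpa using hu0) fun u hu => by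
      simpa using hneg u hu

/-- If both polynomials have a root in the cell, `hroots` places the points alike relative to these
roots and monotonicity gives the sign. If one has no root there, its sign at an endpoint belonging
to E decides, and that sign is shared by both fields. -/
theorem sign_eval_eq_of_derivative_pos (hK : PolynomialIVT K) (hK' : PolynomialIVT K')
    (hp : p.natDegree ≠ 0) (hp' : p'.natDegree ≠ 0) (hE : ∀ e ∈ E, SameCut E e.1 e.2)
    (hsgn : ∀ e ∈ E, SignType.sign (p.eval e.1) = SignType.sign (p'.eval e.2)) {x : K} {x' : K'}
    (hx : SameCut E x x') (hxE : x ∉ E.image Prod.fst)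
    (hpos : ∀ u, SameCell (E.image Prod.fst) x u → 0 < p.derivative.eval u)
    (hpos' : ∀ u, SameCell (E.image Prod.snd) x' u → 0 < p'.derivative.eval u)
    (hroots : ∀ r r', SameCell (E.image Prod.fst) x r → SameCell (E.image Prod.snd) x' r' →
      p.eval r = 0 → p'.eval r' = 0 → ((r < x ↔ r' < x') ∧ (x < r ↔ x' < r'))) :
    SignType.sign (p.eval x) = SignType.sign (p'.eval x') := by
  have hxE' := hx.notMem_iff.mp hxE
  have hnonneg : ∀ e ∈ E, 0 ≤ p.eval e.1 ↔ 0 ≤ p'.eval e.2 := fun e he => by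
    rw [← sign_nonneg_iff, hsgn e he, sign_nonneg_iff]
  have hnonpos : ∀ e ∈ E, p.eval e.1 ≤ 0 ↔ p'.eval e.2 ≤ 0 := fun e he => by
    rw [← sign_nonpos_iff, hsgn e he, sign_nonpos_iff]
  have hmono : ∀ e ∈ E, ∀ t ∈ E, t.1 ≤ e.1 ↔ t.2 ≤ e.2 := fun e he t ht => by
    rw [← not_lt, ← not_lt, ((hE e he) t ht).2]
  have hleft : ∀ e ∈ E, e.1 < x → (∀ t ∈ E, t.1 < x → t.1 ≤ e.1) →
      0 ≤ p.eval e.1 → SignType.sign (p.eval x) = SignType.sign (p'.eval x') := by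
    intro e he hlt hmax h0
    rw [sign_pos (eval_pos_of_left hK hxE hpos hlt (by simpa using fun s s' h => hmax (s, s') h) h0),
      sign_pos (eval_pos_of_left hK' hxE' hpos' ((hx e he).1.mp hlt)
        (by simpa using fun s' s h hs => (hmono e he _ h).mp (hmax (s, s') h ((hx _ h).1.mpr hs)))
        ((hnonneg e he).mp h0))]
  have hright : ∀ e ∈ E, x < e.1 → (∀ t ∈ E, x < t.1 → e.1 ≤ t.1) →
      p.eval e.1 ≤ 0 → SignType.sign (p.eval x) = SignType.sign (p'.eval x') := by
    intro e he hlt hmin h0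
    rw [sign_neg (eval_neg_of_right hK hxE hpos hlt (by simpa using fun s s' h => hmin (s, s') h) h0),
      sign_neg (eval_neg_of_right hK' hxE' hpos' ((hx e he).2.mp hlt)
        (by simpa using fun s' s h hs => (hmono _ h e he).mp (hmin (s, s') h ((hx _ h).2.mpr hs)))
        ((hnonpos e he).mp h0))]
  rcases exists_root_or_left_or_right hK hxE hp hpos with
    ⟨r, hr, hr0⟩ | ⟨s, hs, hlt, hmax, h0⟩ | ⟨s, hs, hlt, hmin, h0⟩
  · rcases exists_root_or_left_or_right hK' hxE' hp' hpos' with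
      ⟨r', hr', hr0'⟩ | ⟨s, hs, hlt, hmax, h0⟩ | ⟨s, hs, hlt, hmin, h0⟩
    · have h1 := hroots r r' hr hr' hr0 hr0'
      rcases lt_trichotomy r x with hlt | rfl | hlt
      · have h2 := SameCell.eval_lt hK hpos hr (SameCell.refl _ x) hlt
        have h3 := SameCell.eval_lt hK' hpos' hr' (SameCell.refl _ x') (h1.1.mp hlt)
        rw [hr0] at h2
        rw [hr0'] at h3
        rw [sign_pos h2, sign_pos h3]
      · have : r' = x' := le_antisymm (not_lt.mp fun h => lt_irrefl _ (h1.2.mpr h))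
          (not_lt.mp fun h => lt_irrefl _ (h1.1.mpr h))
        rw [← this, hr0, hr0', sign_zero, sign_zero]
      · have h2 := SameCell.eval_lt hK hpos (SameCell.refl _ x) hr hlt
        have h3 := SameCell.eval_lt hK' hpos' (SameCell.refl _ x') hr' (h1.2.mp hlt)
        rw [hr0] at h2
        rw [hr0'] at h3
        rw [sign_neg h2, sign_neg h3]
    · obtain ⟨e, he, rfl⟩ := Finset.mem_image.mp hs
      exact hleft e he ((hx e he).1.mpr hlt) (fun t ht htx => (hmono e he t ht).mpr
        (hmax t.2 (Finset.mem_image_of_mem _ ht) ((hx t ht).1.mp htx))) ((hnonneg e he).mpr h0)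
    · obtain ⟨e, he, rfl⟩ := Finset.mem_image.mp hs
      exact hright e he ((hx e he).2.mpr hlt) (fun t ht htx => (hmono t ht e he).mpr
        (hmin t.2 (Finset.mem_image_of_mem _ ht) ((hx t ht).2.mp htx))) ((hnonpos e he).mpr h0)
  · obtain ⟨e, he, rfl⟩ := Finset.mem_image.mp hs
    exact hleft e he hlt (fun t ht => hmax t.1 (Finset.mem_image_of_mem _ ht)) h0
  · obtain ⟨e, he, rfl⟩ := Finset.mem_image.mp hs
    exact hright e he hlt (fun t ht => hmin t.1 (Finset.mem_image_of_mem _ ht)) h0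

/-- A diagram for a family which contains the derivative of `p` and which determines the signs of
`p` at its points can be refined to one which also determines the sign of `p`. -/
theorem IsDiagram.extend (hK : PolynomialIVT K) (hK' : PolynomialIVT K') (h : IsDiagram G E)
    (hder : (derivative p, derivative p') ∈ G) (hp : p.natDegree ≠ 0) (hp' : p'.natDegree ≠ 0)
    (hsgn : ∀ e ∈ E, SignType.sign (p.eval e.1) = SignType.sign (p'.eval e.2)) :
    ∃ E', IsDiagram (insert (p, p') G) E' := by
  -- The new points are the pairs of roots of p and p' lying in the same cut of E. Each cell
  -- contains at most one root of each polynomial, so these pairs are again matched in order.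
  let N := (p.roots.toFinset ×ˢ p'.roots.toFinset).filter fun e => ∀ f ∈ E,
    (f.1 < e.1 ↔ f.2 < e.2) ∧ (e.1 < f.1 ↔ e.2 < f.2)
  have hp0 : p ≠ 0 := fun h => hp (by simp [h])
  have hp0' : p' ≠ 0 := fun h => hp' (by simp [h])
  have hN : ∀ e, e ∈ N ↔ (p.eval e.1 = 0 ∧ p'.eval e.2 = 0) ∧ SameCut E e.1 e.2 := fun e => by
    simp [N, SameCut, hp0, hp0']
  have hunique : ∀ {x u : K} {x' u' : K'}, SameCut E x x' →
      SameCell (E.image Prod.fst) x u → p.eval x = 0 → p.eval u = 0 → x = u :=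
    fun hx hu h1 h2 => h.root_unique hK hder hp hx hu h1 h2
  have hunique' : ∀ {x u : K} {x' u' : K'}, SameCut E x x' →
      SameCell (E.image Prod.snd) x' u' → p'.eval x' = 0 → p'.eval u' = 0 → x' = u' := by
    intro x u x' u' hx hu h1 h2
    refine h.swap.root_unique hK' (p := p') (p' := p) hder hp' (sameCut_swap.mpr hx) ?_ h1 h2
    rw [Finset.image_image]
    exact hu
  have hlt : ∀ e ∈ N, ∀ f ∈ N, f.1 < e.1 → f.2 < e.2 := by
    intro e he f hf hlt
    obtain ⟨⟨he0, -⟩, he⟩ := (hN e).mp he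
    obtain ⟨⟨hf0, -⟩, hf⟩ := (hN f).mp hf
    have hns : ¬ SameCell (E.image Prod.fst) f.1 e.1 := fun hs =>
      hlt.ne (hunique (u' := e.2) hf hs hf0 he0)
    simp only [SameCell, not_forall] at hns
    obtain ⟨s, hs, hns⟩ := hns
    obtain ⟨g, hg, rfl⟩ := Finset.mem_image.mp hs
    have h1 := he g hg
    have h2 := hf g hg
    by_contra hcon
    rw [not_lt] at hcon
    refine hns ⟨⟨fun h => h.trans hlt, fun h => h2.1.mpr ((h1.1.mp h).trans_le hcon)⟩,
      ⟨fun h => h1.2.mpr (hcon.trans_lt (h2.2.mp h)), fun h => hlt.trans h⟩⟩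
  have heq : ∀ e ∈ N, ∀ f ∈ N, f.1 = e.1 → f.2 = e.2 := by
    intro e he f hf hef
    obtain ⟨⟨-, he0⟩, he⟩ := (hN e).mp he
    obtain ⟨⟨-, hf0⟩, hf⟩ := (hN f).mp hf
    exact hunique' (u := e.1) hf (hf.sameCell' (hef ▸ he)) hf0 he0
  have hNN : ∀ e ∈ N, ∀ f ∈ N, (f.1 < e.1 ↔ f.2 < e.2) := by
    refine fun e he f hf => ⟨hlt e he f hf, fun h' => ?_⟩
    rcases lt_trichotomy f.1 e.1 with h1 | h1 | h1
    · exact h1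
    · exact absurd (heq e he f hf h1) h'.ne
    · exact absurd (hlt f hf e he h1) h'.not_gt
  refine ⟨E ∪ N, ?_, ?_⟩
  · intro e he f hf
    rcases Finset.mem_union.mp he with he | he <;> rcases Finset.mem_union.mp hf with hf | hf
    · exact h.sameCut e he f hf
    · have := ((hN f).mp hf).2 e he
      exact ⟨this.2, this.1⟩
    · exact ((hN e).mp he).2 f hf
    · exact ⟨hNN e he f hf, hNN f hf e he⟩
  · intro x x' hx P hP
    have hxE : SameCut E x x' := fun e he => hx e (Finset.mem_union_left _ he)
    rcases hP with rfl | hP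
    · by_cases hxm : x ∈ E.image Prod.fst
      · obtain ⟨e, he, rfl⟩ := Finset.mem_image.mp hxm
        rw [← (hxE.eq_iff he).mp rfl]
        exact hsgn e he
      have hroots : ∀ r r', SameCell (E.image Prod.fst) x r → SameCell (E.image Prod.snd) x' r' →
          p.eval r = 0 → p'.eval r' = 0 → ((r < x ↔ r' < x') ∧ (x < r ↔ x' < r')) := by
        intro r r' hr hr' h0 h0'
        exact hx (r, r') (Finset.mem_union_right _ ((hN _).mpr
          ⟨⟨h0, h0'⟩, (hxE.of_sameCell hr).of_sameCell' hr'⟩))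
      rcases h.derivative_sign hder hp hxE hxm with ⟨hpos, hpos'⟩ | ⟨hneg, hneg'⟩
      · exact sign_eval_eq_of_derivative_pos hK hK' hp hp' h.sameCut hsgn hxE hxm hpos hpos' hroots
      · have := sign_eval_eq_of_derivative_pos (p := -p) (p' := -p') hK hK' (by simpa using hp)
          (by simpa using hp') h.sameCut
          (fun e he => by rw [eval_neg, eval_neg, Left.sign_neg, Left.sign_neg, hsgn e he])
          hxE hxm (fun u hu => by simpa using hneg u hu) (fun u hu => by simpa using hneg' u hu)
          (fun r r' hr hr' h0 h0' => hroots r r' hr hr' (by simpa using h0) (by simpa using h0'))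
        rw [eval_neg, eval_neg, Left.sign_neg, Left.sign_neg] at this
        exact neg_injective this
    · exact h.sign_eq x x' hxE P hP

end Extend

end Diagram

/-- A real closed field with a fixed embedding of the real numbers. -/
structure RealClosedExt where
  carrier : Type
  [field : Field carrier]
  [order : LinearOrder carrier]
  [strict : IsStrictOrderedRing carrier]
  const : ℝ →+* carrier
  ivt : PolynomialIVT carrier

attribute [instance] RealClosedExt.field RealClosedExt.order RealClosedExt.strict

/-- The evaluation of polynomials with real coefficients at a tuple of a real closed field. -/
noncomputable abbrev RealClosedExt.eval (F : RealClosedExt) {σ : Type} (x : σ → F.carrier) :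
    MvPolynomial σ ℝ →+* F.carrier :=
  MvPolynomial.eval₂Hom F.const x

/-- The polynomials in `Q` have the same signs at `x` and at `x'`. -/
def SameSigns {F F' : RealClosedExt} {σ : Type} (Q : Finset (MvPolynomial σ ℝ))
    (x : σ → F.carrier) (x' : σ → F'.carrier) : Prop :=
  ∀ q ∈ Q, SignType.sign (F.eval x q) = SignType.sign (F'.eval x' q)

theorem SameSigns.mono {F F' : RealClosedExt} {σ : Type} {Q R : Finset (MvPolynomial σ ℝ)}
    {x : σ → F.carrier} {x' : σ → F'.carrier} (h : SameSigns R x x') (hQ : Q ⊆ R) :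
    SameSigns Q x x' := fun q hq => h q (hQ hq)

theorem SameSigns.symm {F F' : RealClosedExt} {σ : Type} {Q : Finset (MvPolynomial σ ℝ)}
    {x : σ → F.carrier} {x' : σ → F'.carrier} (h : SameSigns Q x x') :
    SameSigns Q x' x := fun q hq => (h q hq).symm

/-! ### Sign diagrams with parameters and quantifier elimination -/

section Elimination

open Polynomial

/-- The sum of the terms of degree at most `d` of a polynomial. -/
noncomputable def truncate {A : Type*} [Semiring A] (d : ℕ) (p : A[X]) : A[X] :=
  ∑ i ∈ Finset.range (d + 1), monomial i (p.coeff i)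

theorem coeff_truncate {A : Type*} [Semiring A] (d : ℕ) (p : A[X]) (i : ℕ) :
    (truncate d p).coeff i = if i ≤ d then p.coeff i else 0 := by
  simp [truncate, coeff_monomial]

theorem natDegree_truncate_le {A : Type*} [Semiring A] (d : ℕ) (p : A[X]) :
    (truncate d p).natDegree ≤ d := by
  rw [natDegree_le_iff_coeff_eq_zero]
  intro i hi
  rw [coeff_truncate, if_neg (by omega)]

theorem exists_pseudoDivision {A : Type*} [CommRing A] (p h : A[X]) (hh : h.natDegree ≠ 0) :
    ∃ (m : ℕ) (q r : A[X]), C (h.leadingCoeff ^ m) * p = q * h + r ∧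
      r.natDegree < h.natDegree := by
  induction hn : p.natDegree using Nat.strong_induction_on generalizing p with
  | _ n ih =>
    by_cases hlt : p.natDegree < h.natDegree
    · exact ⟨0, 0, p, by simp, hlt⟩
    rw [not_lt] at hlt
    let p' := C h.leadingCoeff * p - C p.leadingCoeff * X ^ (p.natDegree - h.natDegree) * h
    have hcoeff : p'.coeff p.natDegree = 0 := by
      simp only [p', coeff_sub, coeff_C_mul, mul_assoc, coeff_X_pow_mul']
      rw [if_pos (by omega), show p.natDegree - (p.natDegree - h.natDegree) = h.natDegree by omega,
        coeff_natDegree, coeff_natDegree]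
      ring
    have hdeg : p'.natDegree ≤ p.natDegree := by
      refine (natDegree_sub_le _ _).trans (max_le (natDegree_C_mul_le _ _) ?_)
      rw [mul_assoc]
      refine (natDegree_C_mul_le _ _).trans (natDegree_mul_le.trans ?_)
      have := natDegree_X_pow_le (R := A) (p.natDegree - h.natDegree)
      omega
    have hlt' : p'.natDegree < n := by
      rw [← hn]
      refine lt_of_le_of_ne hdeg fun heq => ?_
      rw [← heq, coeff_natDegree, leadingCoeff_eq_zero] at hcoeff
      rw [hcoeff, natDegree_zero] at heq
      omega
    obtain ⟨m, q, r, h1, h2⟩ := ih _ hlt' p' rfl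
    refine ⟨m + 1, q + C (h.leadingCoeff ^ m) * (C p.leadingCoeff *
      X ^ (p.natDegree - h.natDegree)), r, ?_, h2⟩
    have h3 : C (h.leadingCoeff ^ m) * p' = q * h + r := h1
    simp only [p'] at h3
    rw [pow_succ, C_mul]
    linear_combination h3

/-- An even power of the leading coefficient becomes a positive factor after evaluation, so p and
its remainder have the same sign at every root of h where the leading coefficient survives. -/
theorem exists_evenPseudoDivision {A : Type*} [CommRing A] (p h : A[X]) (hh : h.natDegree ≠ 0) :
    ∃ (m : ℕ) (q r : A[X]), C ((h.leadingCoeff ^ m) ^ 2) * p = q * h + r ∧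
      r.natDegree < h.natDegree := by
  obtain ⟨m, q, r, h1, h2⟩ := exists_pseudoDivision p h hh
  refine ⟨m, C (h.leadingCoeff ^ m) * q, C (h.leadingCoeff ^ m) * r, ?_,
    (natDegree_C_mul_le _ _).trans_lt h2⟩
  rw [sq, C_mul]
  linear_combination C (h.leadingCoeff ^ m) * h1

open Classical in
/-- The pseudo-remainder of `p` modulo `h`, up to an even power of the leading coefficient. -/
noncomputable def pseudoRem {A : Type*} [CommRing A] (p h : A[X]) : A[X] :=
  if hh : h.natDegree ≠ 0 then (exists_evenPseudoDivision p h hh).choose_spec.choose_spec.choose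
  else 0

theorem pseudoRem_spec {A : Type*} [CommRing A] (p h : A[X]) (hh : h.natDegree ≠ 0) :
    ∃ (m : ℕ) (q : A[X]), C ((h.leadingCoeff ^ m) ^ 2) * p = q * h + pseudoRem p h ∧
      (pseudoRem p h).natDegree < h.natDegree := by
  rw [pseudoRem, dif_pos hh]
  exact ⟨_, _, (exists_evenPseudoDivision p h hh).choose_spec.choose_spec.choose_spec⟩

theorem natDegree_pseudoRem_le {A : Type*} [CommRing A] (p h : A[X]) {d : ℕ}
    (hd : h.natDegree ≤ d + 1) : (pseudoRem p h).natDegree ≤ d := by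
  by_cases hh : h.natDegree ≠ 0
  · obtain ⟨_, _, -, h1⟩ := pseudoRem_spec p h hh
    omega
  · rw [pseudoRem, dif_neg hh, natDegree_zero]
    exact Nat.zero_le _

theorem sign_eval_pseudoRem {A K : Type*} [CommRing A] [Field K] [LinearOrder K]
    [IsStrictOrderedRing K] (f : A →+* K) (p h : A[X]) (hh : h.natDegree ≠ 0)
    (hlc : f h.leadingCoeff ≠ 0) {x : K} (hx : (h.map f).eval x = 0) :
    SignType.sign ((p.map f).eval x) = SignType.sign (((pseudoRem p h).map f).eval x) := by
  obtain ⟨m, q, h1, -⟩ := pseudoRem_spec p h hh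
  have h2 := congrArg (fun r => (r.map f).eval x) h1
  simp only [Polynomial.map_mul, Polynomial.map_add, Polynomial.map_C, eval_mul, eval_add, eval_C,
    hx, mul_zero, zero_add] at h2
  have hpos : 0 < f ((h.leadingCoeff ^ m) ^ 2) := by
    rw [map_pow, map_pow]
    positivity
  rw [← h2, sign_mul, sign_pos hpos, one_mul]

variable {σ : Type}

/-- Specialization may kill leading coefficients. Truncating at the degree after specialization
restores a leading coefficient that does not vanish, as pseudo-division requires. -/
theorem map_truncate_eq {A K : Type*} [CommRing A] [Field K] (f : A →+* K) (g : A[X]) {d : ℕ}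
    (hg : ∀ i, d < i → f (g.coeff i) = 0) : (truncate d g).map f = g.map f := by
  ext i
  rw [coeff_map, coeff_map, coeff_truncate]
  split_ifs with h
  · rfl
  · rw [hg i (not_le.mp h), map_zero]

/-- A polynomial with parametric coefficients, evaluated at two tuples of parameters. -/
noncomputable def evalPair {F F' : RealClosedExt} (x : σ → F.carrier) (x' : σ → F'.carrier)
    (f : (MvPolynomial σ ℝ)[X]) : F.carrier[X] × F'.carrier[X] :=
  (f.map (F.eval x), f.map (F'.eval x'))

/-- Finitely many polynomials in the parameters determine the sign diagram of finitely many
polynomials in one more variable. -/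
theorem exists_isDiagram (T : Finset (MvPolynomial σ ℝ)[X]) :
    ∃ Q : Finset (MvPolynomial σ ℝ), ∀ (F F' : RealClosedExt) (x : σ → F.carrier)
      (x' : σ → F'.carrier), SameSigns Q x x' →
      ∃ E, IsDiagram (evalPair x x' '' (T : Set (MvPolynomial σ ℝ)[X])) E := by
  classical
  suffices H : ∀ d, ∀ T : Finset (MvPolynomial σ ℝ)[X], (∀ f ∈ T, f.natDegree ≤ d) →
      ∃ Q : Finset (MvPolynomial σ ℝ), ∀ (F F' : RealClosedExt) (x : σ → F.carrier)
      (x' : σ → F'.carrier), SameSigns Q x x' →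
      ∃ E, IsDiagram (evalPair x x' '' (T : Set (MvPolynomial σ ℝ)[X])) E from
    H _ T fun f hf => Finset.le_sup (f := natDegree) hf
  intro d
  induction d with
  | zero =>
    intro T hT
    refine ⟨T.image fun f => f.coeff 0, fun F F' x x' hQ => ⟨∅, by simp, ?_⟩⟩
    rintro a b - _ ⟨f, hf, rfl⟩
    have := hQ _ (Finset.mem_image_of_mem _ hf)
    rw [eq_C_of_natDegree_le_zero (hT f hf)]
    simpa [evalPair] using this
  | succ d ihd =>
    -- The polynomials of top degree d + 1 are removed one at a time; those of smaller degree are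
    -- collected in S, which may grow freely.
    suffices H : ∀ T S : Finset (MvPolynomial σ ℝ)[X], (∀ f ∈ T, f.natDegree ≤ d + 1) →
        (∀ f ∈ S, f.natDegree ≤ d) → ∃ Q : Finset (MvPolynomial σ ℝ),
        ∀ (F F' : RealClosedExt) (x : σ → F.carrier) (x' : σ → F'.carrier), SameSigns Q x x' →
        ∃ E, IsDiagram 
          (evalPair x x' '' (↑(T ∪ S) : Set (MvPolynomial σ ℝ)[X])) E by
      intro T hT
      simpa using H T ∅ hT (by simp)
    intro T
    induction T using Finset.induction_on with
    | empty => intro S _ hS; simpa using ihd S hS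
    | insert p T _ ih =>
      intro S hT hS
      have hp := hT p (Finset.mem_insert_self _ _)
      have hT' : ∀ f ∈ T, f.natDegree ≤ d + 1 := fun f hf => hT f (Finset.mem_insert_of_mem hf)
      -- The derivative controls monotonicity of p, and the truncation replaces p when its top
      -- coefficient vanishes.
      set G : Finset (MvPolynomial σ ℝ)[X] := T ∪ (S ∪ {derivative p, truncate d p}) with hG
      have hder : (derivative p).natDegree ≤ d := (natDegree_derivative_le p).trans (by omega)
      have hS' : ∀ f ∈ S ∪ {derivative p, truncate d p}, f.natDegree ≤ d := by
        intro f hf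
        simp only [Finset.mem_union, Finset.mem_insert, Finset.mem_singleton] at hf
        rcases hf with hf | rfl | rfl
        · exact hS f hf
        · exact hder
        · exact natDegree_truncate_le _ _
      have hGdeg : ∀ g ∈ G, g.natDegree ≤ d + 1 := by
        intro g hg
        rcases Finset.mem_union.mp hg with hg | hg
        · exact hT' g hg
        · exact (hS' g hg).trans (Nat.le_succ d)
      -- At a root of a member of G the sign of p is that of a pseudo-remainder. Since the degree of
      -- a specialization is not known in advance, all truncations serve as divisors; the remainders
      -- have degree at most d.
      let R : Finset (MvPolynomial σ ℝ)[X] :=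
        (G ×ˢ Finset.range (d + 2)).image fun g => pseudoRem p (truncate g.2 g.1)
      obtain ⟨Q, hQ⟩ := ih ((S ∪ {derivative p, truncate d p}) ∪ R) hT' (by
        intro f hf
        rcases Finset.mem_union.mp hf with hf | hf
        · exact hS' f hf
        · obtain ⟨g, hg, rfl⟩ := Finset.mem_image.mp hf
          have := Finset.mem_range.mp (Finset.mem_product.mp hg).2
          exact natDegree_pseudoRem_le _ _ ((natDegree_truncate_le _ _).trans (by omega)))
      refine ⟨Q ∪ insert (p.coeff (d + 1)) ((G ×ˢ Finset.range (d + 2)).image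
        fun g => g.1.coeff g.2), fun F F' x x' hs => ?_⟩
      obtain ⟨E, hE⟩ := hQ F F' x x' (hs.mono Finset.subset_union_left)
      have hsc : ∀ g ∈ G, ∀ i ≤ d + 1, SignType.sign (F.eval x (g.coeff i)) =
          SignType.sign (F'.eval x' (g.coeff i)) := fun g hg i hi =>
        hs _ (Finset.mem_union_right _ (Finset.mem_insert_of_mem (Finset.mem_image.mpr
          ⟨(g, i), Finset.mem_product.mpr ⟨hg, Finset.mem_range.mpr (by omega)⟩, rfl⟩)))
      have hsp : SignType.sign (F.eval x (p.coeff (d + 1))) =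
          SignType.sign (F'.eval x' (p.coeff (d + 1))) :=
        hs _ (Finset.mem_union_right _ (Finset.mem_insert_self _ _))
      set Φ : (MvPolynomial σ ℝ)[X] → F.carrier[X] × F'.carrier[X] := evalPair x x'
      -- Points that come only from the remainders are discarded, since the sign of p could not be
      -- computed there.
      obtain ⟨E₀, hE₀E, hE₀, hroot⟩ := hE.prune (H := Φ '' (G : Set _)) F'.ivt (by
        refine Set.image_mono ?_
        rw [hG]
        intro f hf
        simp only [Finset.coe_union, Set.mem_union] at hf ⊢
        tauto)
      have hcover : ∀ f ∈ insert p T ∪ S, Φ f ∈ insert (Φ p) (Φ '' (G : Set _)) := by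
        intro f hf
        rcases Finset.mem_union.mp hf with hf | hf
        · rcases Finset.mem_insert.mp hf with rfl | hf
          · exact Set.mem_insert _ _
          · exact Set.mem_insert_of_mem _ ⟨f, Finset.mem_union_left _ hf, rfl⟩
        · exact Set.mem_insert_of_mem _
            ⟨f, Finset.mem_union_right _ (Finset.mem_union_left _ hf), rfl⟩
      suffices ∃ E', IsDiagram (insert (Φ p) (Φ '' (G : Set _))) E' by
        obtain ⟨E', hE'⟩ := this
        refine ⟨E', hE'.sameCut, ?_⟩
        rintro a b hab _ ⟨f, hf, rfl⟩
        exact hE'.sign_eq a b hab _ (hcover f hf)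
      by_cases hlc : F.eval x (p.coeff (d + 1)) = 0
      · have hlc' : F'.eval x' (p.coeff (d + 1)) = 0 := by
          rwa [hlc, sign_zero, eq_comm, sign_eq_zero_iff] at hsp
        have htr : ∀ {A : Type} [Field A] (f : MvPolynomial σ ℝ →+* A),
            f (p.coeff (d + 1)) = 0 → p.map f = (truncate d p).map f := by
          intro A _ f hf
          refine (map_truncate_eq f p fun i hi => ?_).symm
          rcases (Nat.succ_le_of_lt hi).eq_or_lt with rfl | hi
          · exact hf
          · rw [coeff_eq_zero_of_natDegree_lt (hp.trans_lt hi), map_zero]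
        have hpt : Φ p = Φ (truncate d p) := by
          exact Prod.ext (htr _ hlc) (htr _ hlc')
        refine ⟨E₀, ?_⟩
        rw [hpt, Set.insert_eq_of_mem
          (Set.mem_image_of_mem Φ (show truncate d p ∈ (G : Set _) by simp [hG]))]
        exact hE₀
      have hlc' : F'.eval x' (p.coeff (d + 1)) ≠ 0 := by
        rwa [Ne, ← sign_eq_zero_iff, ← hsp, sign_eq_zero_iff]
      refine hE₀.extend F.ivt F'.ivt ?_ ?_ ?_ ?_
      · rw [derivative_map, derivative_map]
        exact Set.mem_image_of_mem Φ (show derivative p ∈ (G : Set _) by simp [hG])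
      · have : d + 1 ≤ (p.map (F.eval x)).natDegree :=
          le_natDegree_of_ne_zero (by rwa [coeff_map])
        omega
      · have : d + 1 ≤ (p.map (F'.eval x')).natDegree :=
          le_natDegree_of_ne_zero (by rwa [coeff_map])
        omega
      · intro e he
        obtain ⟨_, ⟨g, hg, rfl⟩, hg0, hge⟩ := hroot e he
        change g.map (F.eval x) ≠ 0 at hg0
        change (g.map (F.eval x)).eval e.1 = 0 at hge
        set i := (g.map (F.eval x)).natDegree with hi
        have hid : i ≤ d + 1 := natDegree_map_le.trans (hGdeg g hg)
        have hgc : F.eval x (g.coeff i) ≠ 0 := by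
          rw [← coeff_map, hi, coeff_natDegree, Ne, leadingCoeff_eq_zero]
          exact hg0
        have hgc' : F'.eval x' (g.coeff i) ≠ 0 := by
          rwa [Ne, ← sign_eq_zero_iff, ← hsc g hg i hid, sign_eq_zero_iff]
        have hi0 : i ≠ 0 := by
          intro h0
          rw [eq_C_of_natDegree_eq_zero (h0 ▸ hi.symm : (g.map (F.eval x)).natDegree = 0),
            eval_C, coeff_map] at hge
          exact hgc (h0 ▸ hge)
        have hcz : ∀ j, i < j → F.eval x (g.coeff j) = 0 := fun j hj => by
          rw [← coeff_map, coeff_eq_zero_of_natDegree_lt hj]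
        have hcz' : ∀ j, i < j → F'.eval x' (g.coeff j) = 0 := fun j hj => by
          by_cases hjd : j ≤ d + 1
          · rw [← sign_eq_zero_iff, ← hsc g hg j hjd, hcz j hj, sign_zero]
          · rw [coeff_eq_zero_of_natDegree_lt ((hGdeg g hg).trans_lt (not_le.mp hjd)), map_zero]
        have hge' : (g.map (F'.eval x')).eval e.2 = 0 := by
          have := hE₀.sign_eq e.1 e.2 (hE₀.sameCut e he) _ ⟨g, hg, rfl⟩
          change SignType.sign ((g.map (F.eval x)).eval e.1) =
            SignType.sign ((g.map (F'.eval x')).eval e.2) at this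
          rwa [hge, sign_zero, eq_comm, sign_eq_zero_iff] at this
        have hci : (truncate i g).coeff i = g.coeff i := by rw [coeff_truncate, if_pos le_rfl]
        have hdi : (truncate i g).natDegree = i := by
          refine le_antisymm (natDegree_truncate_le _ _) (le_natDegree_of_ne_zero ?_)
          rw [hci]
          intro h0
          rw [h0, map_zero] at hgc
          exact hgc rfl
        have hli : (truncate i g).leadingCoeff = g.coeff i := by rw [leadingCoeff, hdi, hci]
        -- The diagram E before pruning still knows the signs of the remainders, and it contains all
        -- points of E₀.
        have hR : pseudoRem p (truncate i g) ∈ R := Finset.mem_image.mpr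
          ⟨(g, i), Finset.mem_product.mpr ⟨hg, Finset.mem_range.mpr (by omega)⟩, rfl⟩
        have h1 := sign_eval_pseudoRem (F.eval x) p (truncate i g) (by rwa [hdi]) (by rwa [hli])
          (x := e.1) (by rw [map_truncate_eq _ _ hcz]; exact hge)
        have h2 := sign_eval_pseudoRem (F'.eval x') p (truncate i g) (by rwa [hdi]) (by rwa [hli])
          (x := e.2) (by rw [map_truncate_eq _ _ hcz']; exact hge')
        rw [h1, h2]
        exact hE.sign_eq e.1 e.2 (hE.sameCut e (hE₀E he)) _
          ⟨_, Finset.mem_union_right _ (Finset.mem_union_right _ hR), rfl⟩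

end Elimination

/-! ### Semialgebraic predicates -/

/-- A function given by the same polynomial over all real closed fields. -/
def IsPolynomialFn {σ : Type} (f : ∀ F : RealClosedExt, (σ → F.carrier) → F.carrier) : Prop :=
  ∃ p : MvPolynomial σ ℝ, ∀ F x, f F x = F.eval x p

/-- A predicate on tuples of elements of real closed fields whose truth only depends on the signs
of finitely many polynomials. -/
def IsSemialgebraic {σ : Type} (A : ∀ F : RealClosedExt, (σ → F.carrier) → Prop) : Prop :=
  ∃ Q : Finset (MvPolynomial σ ℝ), ∀ (F F' : RealClosedExt) (x : σ → F.carrier)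
    (x' : σ → F'.carrier), SameSigns Q x x' → (A F x ↔ A F' x')

namespace IsPolynomialFn

variable {σ : Type} {f g : ∀ F : RealClosedExt, (σ → F.carrier) → F.carrier}

theorem var (i : σ) : IsPolynomialFn fun _ x => x i :=
  ⟨MvPolynomial.X i, fun F x => by simp⟩

theorem const (r : ℝ) : IsPolynomialFn (σ := σ) fun F _ => F.const r :=
  ⟨MvPolynomial.C r, fun F x => by simp⟩

theorem zero : IsPolynomialFn (σ := σ) fun _ _ => 0 := ⟨0, fun F x => by simp⟩

theorem one : IsPolynomialFn (σ := σ) fun _ _ => 1 := ⟨1, fun F x => by simp⟩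

theorem add (hf : IsPolynomialFn f) (hg : IsPolynomialFn g) :
    IsPolynomialFn fun F x => f F x + g F x := by
  obtain ⟨p, hp⟩ := hf
  obtain ⟨q, hq⟩ := hg
  exact ⟨p + q, fun F x => by simp only [hp, hq, map_add]⟩

theorem mul (hf : IsPolynomialFn f) (hg : IsPolynomialFn g) :
    IsPolynomialFn fun F x => f F x * g F x := by
  obtain ⟨p, hp⟩ := hf
  obtain ⟨q, hq⟩ := hg
  exact ⟨p * q, fun F x => by simp only [hp, hq, map_mul]⟩

theorem neg (hf : IsPolynomialFn f) : IsPolynomialFn fun F x => -f F x := by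
  obtain ⟨p, hp⟩ := hf
  exact ⟨-p, fun F x => by simp only [hp, map_neg]⟩

theorem sub (hf : IsPolynomialFn f) (hg : IsPolynomialFn g) :
    IsPolynomialFn fun F x => f F x - g F x := by
  obtain ⟨p, hp⟩ := hf
  obtain ⟨q, hq⟩ := hg
  exact ⟨p - q, fun F x => by simp only [hp, hq, map_sub]⟩

theorem sum {ι : Type*} (s : Finset ι)
    {f : ι → ∀ F : RealClosedExt, (σ → F.carrier) → F.carrier}
    (hf : ∀ i, IsPolynomialFn (f i)) : IsPolynomialFn fun F x => ∑ i ∈ s, f i F x := by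
  choose p hp using hf
  exact ⟨∑ i ∈ s, p i, fun F x => by rw [map_sum]; exact Finset.sum_congr rfl fun i _ => hp i F x⟩

end IsPolynomialFn

namespace IsSemialgebraic

variable {σ τ : Type} {A B : ∀ F : RealClosedExt, (σ → F.carrier) → Prop}

theorem congr (h : IsSemialgebraic A) (hAB : ∀ F x, B F x ↔ A F x) : IsSemialgebraic B := by
  obtain ⟨Q, hQ⟩ := h
  exact ⟨Q, fun F F' x x' hx => by rw [hAB, hAB, hQ F F' x x' hx]⟩

theorem const (P : Prop) : IsSemialgebraic (σ := σ) fun _ _ => P :=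
  ⟨∅, fun _ _ _ _ _ => Iff.rfl⟩

theorem not (hA : IsSemialgebraic A) : IsSemialgebraic fun F x => ¬ A F x := by
  obtain ⟨Q, hQ⟩ := hA
  exact ⟨Q, fun F F' x x' hx => not_congr (hQ F F' x x' hx)⟩

theorem and (hA : IsSemialgebraic A) (hB : IsSemialgebraic B) :
    IsSemialgebraic fun F x => A F x ∧ B F x := by
  classical
  obtain ⟨Q, hQ⟩ := hA
  obtain ⟨R, hR⟩ := hB
  exact ⟨Q ∪ R, fun F F' x x' hx => and_congr (hQ F F' x x' (hx.mono Finset.subset_union_left))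
    (hR F F' x x' (hx.mono Finset.subset_union_right))⟩

theorem imp (hA : IsSemialgebraic A) (hB : IsSemialgebraic B) :
    IsSemialgebraic fun F x => A F x → B F x := by
  classical
  obtain ⟨Q, hQ⟩ := hA
  obtain ⟨R, hR⟩ := hB
  exact ⟨Q ∪ R, fun F F' x x' hx => imp_congr (hQ F F' x x' (hx.mono Finset.subset_union_left))
    (hR F F' x x' (hx.mono Finset.subset_union_right))⟩

theorem forall_fin {m : ℕ} {A : Fin m → ∀ F : RealClosedExt, (σ → F.carrier) → Prop}
    (hA : ∀ i, IsSemialgebraic (A i)) : IsSemialgebraic fun F x => ∀ i, A i F x := by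
  classical
  choose Q hQ using hA
  exact ⟨Finset.univ.biUnion Q, fun F F' x x' hx => forall_congr' fun i => hQ i F F' x x'
    (hx.mono (Finset.subset_biUnion_of_mem Q (Finset.mem_univ i)))⟩

theorem pos {f : ∀ F : RealClosedExt, (σ → F.carrier) → F.carrier} (hf : IsPolynomialFn f) :
    IsSemialgebraic fun F x => 0 < f F x := by
  obtain ⟨p, hp⟩ := hf
  refine ⟨{p}, fun F F' x x' hx => ?_⟩
  have := hx p (Finset.mem_singleton_self p)
  simp only [hp]
  rw [← sign_eq_one_iff, this, sign_eq_one_iff]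

theorem eq_zero {f : ∀ F : RealClosedExt, (σ → F.carrier) → F.carrier} (hf : IsPolynomialFn f) :
    IsSemialgebraic fun F x => f F x = 0 := by
  obtain ⟨p, hp⟩ := hf
  refine ⟨{p}, fun F F' x x' hx => ?_⟩
  have := hx p (Finset.mem_singleton_self p)
  simp only [hp]
  rw [← sign_eq_zero_iff, this, sign_eq_zero_iff]

theorem lt {f g : ∀ F : RealClosedExt, (σ → F.carrier) → F.carrier} (hf : IsPolynomialFn f)
    (hg : IsPolynomialFn g) : IsSemialgebraic fun F x => f F x < g F x :=
  (pos (hg.sub hf)).congr fun _ _ => sub_pos.symm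

theorem le {f g : ∀ F : RealClosedExt, (σ → F.carrier) → F.carrier} (hf : IsPolynomialFn f)
    (hg : IsPolynomialFn g) : IsSemialgebraic fun F x => f F x ≤ g F x :=
  (lt hg hf).not.congr fun _ _ => not_lt.symm

theorem eq {f g : ∀ F : RealClosedExt, (σ → F.carrier) → F.carrier} (hf : IsPolynomialFn f)
    (hg : IsPolynomialFn g) : IsSemialgebraic fun F x => f F x = g F x :=
  (eq_zero (hf.sub hg)).congr fun _ _ => sub_eq_zero.symm

theorem tuple_eq {m : ℕ} {f g : ∀ F : RealClosedExt, (σ → F.carrier) → Fin m → F.carrier}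
    (hf : ∀ i, IsPolynomialFn fun F x => f F x i) (hg : ∀ i, IsPolynomialFn fun F x => g F x i) :
    IsSemialgebraic fun F x => f F x = g F x :=
  (forall_fin fun i => eq (hf i) (hg i)).congr fun _ _ => funext_iff

theorem comp {A : ∀ F : RealClosedExt, (τ → F.carrier) → Prop} (hA : IsSemialgebraic A)
    {f : ∀ F : RealClosedExt, (σ → F.carrier) → τ → F.carrier}
    (hf : ∀ i, IsPolynomialFn fun F x => f F x i) : IsSemialgebraic fun F x => A F (f F x) := by
  classical
  obtain ⟨Q, hQ⟩ := hA
  choose p hp using hf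
  have hev : ∀ (F : RealClosedExt) (x : σ → F.carrier) (q : MvPolynomial τ ℝ),
      F.eval x (MvPolynomial.bind₁ p q) = F.eval (f F x) q := by
    intro F x q
    rw [MvPolynomial.eval₂Hom_bind₁]
    congr 2
    funext i
    exact (hp i F x).symm
  refine ⟨Q.image (MvPolynomial.bind₁ p), fun F F' x x' hx => hQ F F' _ _ fun q hq => ?_⟩
  rw [← hev, ← hev]
  exact hx _ (Finset.mem_image_of_mem _ hq)

/-- A witness over one field is transported to any element in the corresponding cut of the other;
the diagram guarantees equal signs for all polynomials involved. -/
theorem exists_one {A : ∀ F : RealClosedExt, (σ → F.carrier) → F.carrier → Prop}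
    (hA : IsSemialgebraic (σ := Option σ) fun F z => A F (fun i => z (some i)) (z none)) :
    IsSemialgebraic fun F x => ∃ y, A F x y := by
  classical
  obtain ⟨Q, hQ⟩ := hA
  obtain ⟨R, hR⟩ := exists_isDiagram (Q.image (MvPolynomial.optionEquivLeft ℝ σ))
  have hev : ∀ (F : RealClosedExt) (x : σ → F.carrier) (y : F.carrier)
      (q : MvPolynomial (Option σ) ℝ), F.eval (fun i => i.elim y x) q =
        ((MvPolynomial.optionEquivLeft ℝ σ q).map (F.eval x)).eval y := by
    intro F x y q
    induction q using MvPolynomial.induction_on with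
    | C a => simp
    | add p q hp hq => rw [map_add, hp, hq, map_add, Polynomial.map_add, Polynomial.eval_add]
    | mul_X p i hp =>
      rw [map_mul, hp, map_mul, Polynomial.map_mul, Polynomial.eval_mul]
      cases i <;> simp
  have key : ∀ (F F' : RealClosedExt) (x : σ → F.carrier) (x' : σ → F'.carrier),
      SameSigns R x x' → (∃ y, A F x y) → ∃ y, A F' x' y := by
    rintro F F' x x' hx ⟨y, hy⟩
    obtain ⟨E, hE⟩ := hR F F' x x' hx
    obtain ⟨y', hy'⟩ := exists_sameCut hE.sameCut y
    refine ⟨y', (hQ F F' (fun i => i.elim y x) (fun i => i.elim y' x') fun q hq => ?_).mp hy⟩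
    rw [hev, hev]
    exact hE.sign_eq y y' hy' _ ⟨_, Finset.mem_image_of_mem _ hq, rfl⟩
  exact ⟨R, fun F F' x x' hx => ⟨key F F' x x' hx, key F' F x' x hx.symm⟩⟩

theorem exists_tuple {m : ℕ} {A : ∀ F : RealClosedExt, (σ → F.carrier) → (Fin m → F.carrier) → Prop}
    (hA : IsSemialgebraic (σ := σ ⊕ Fin m) fun F z =>
      A F (fun i => z (Sum.inl i)) (fun i => z (Sum.inr i))) :
    IsSemialgebraic fun F x => ∃ y, A F x y := by
  induction m generalizing σ with
  | zero =>
    have h0 : IsSemialgebraic (σ := σ) fun F x => A F x Fin.elim0 := by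
      have := hA.comp (σ := σ) (f := fun F x => Sum.elim x Fin.elim0) (by
        rintro (i | i)
        · exact IsPolynomialFn.var i
        · exact i.elim0)
      refine this.congr fun F x => ?_
      rw [iff_iff_eq]
      congr
    refine h0.congr fun F x => ⟨?_, fun h => ⟨_, h⟩⟩
    rintro ⟨y, hy⟩
    rwa [Subsingleton.elim Fin.elim0 y]
  | succ m ih =>
    have h1 : IsSemialgebraic (σ := Option σ) fun F z => ∃ y : Fin m → F.carrier,
        A F (fun i => z (some i)) (Fin.cons (z none) y) := by
      refine ih (A := fun F z y => A F (fun i => z (some i)) (Fin.cons (z none) y)) ?_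
      refine (hA.comp (σ := Option σ ⊕ Fin m) (f := fun F z => Sum.elim
        (fun i => z (Sum.inl (some i))) (Fin.cons (z (Sum.inl none)) fun i => z (Sum.inr i)))
        ?_).congr fun F z => Iff.rfl
      rintro (i | i)
      · exact IsPolynomialFn.var _
      · refine Fin.cases ?_ (fun j => ?_) i
        · exact IsPolynomialFn.var _
        · exact IsPolynomialFn.var _
    refine (exists_one (A := fun F x y₀ => ∃ y, A F x (Fin.cons y₀ y)) h1).congr fun F x => ?_
    constructor
    · rintro ⟨y, hy⟩
      exact ⟨y 0, Fin.tail y, by rwa [Fin.cons_self_tail]⟩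
    · rintro ⟨y0, y, hy⟩
      exact ⟨_, hy⟩

theorem forall_tuple {m : ℕ} {A : ∀ F : RealClosedExt, (σ → F.carrier) → (Fin m → F.carrier) → Prop}
    (hA : IsSemialgebraic (σ := σ ⊕ Fin m) fun F z =>
      A F (fun i => z (Sum.inl i)) (fun i => z (Sum.inr i))) :
    IsSemialgebraic fun F x => ∀ y, A F x y :=
  (exists_tuple (A := fun F x y => ¬ A F x y) hA.not).not.congr fun F x => by
    push Not; exact Iff.rfl

end IsSemialgebraic

/-! ### Definable sets are semialgebraic -/

/-- The interpretation of the language in a real closed field over the real numbers. -/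
noncomputable abbrev RealClosedExt.structure (F : RealClosedExt) : L.Structure F.carrier :=
  lStructure F.carrier F.const

theorem isPolynomialFn_realize {σ : Type} (t : L.Term σ) :
    IsPolynomialFn fun F x => letI := F.structure; t.realize x := by
  induction t with
  | var i => exact IsPolynomialFn.var i
  | func f ts ih =>
    rcases f with f | f
    · cases f with
      | add => exact (ih 0).add (ih 1)
      | mul => exact (ih 0).mul (ih 1)
      | neg => exact (ih 0).neg
      | zero => exact IsPolynomialFn.zero
      | one => exact IsPolynomialFn.one
    · rename_i l
      cases l with
      | zero => exact IsPolynomialFn.const f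
      | succ l => exact f.elim

theorem isSemialgebraic_realize {σ : Type} {k : ℕ} (φ : L.BoundedFormula σ k) :
    IsSemialgebraic (σ := σ ⊕ Fin k) fun F z =>
      letI := F.structure; φ.Realize (fun i => z (Sum.inl i)) (fun i => z (Sum.inr i)) := by
  have helim : ∀ {k : ℕ} (F : RealClosedExt) (z : σ ⊕ Fin k → F.carrier),
      Sum.elim (fun i => z (Sum.inl i)) (fun i => z (Sum.inr i)) = z := by
    intro k F z
    funext i
    cases i <;> rfl
  induction φ with
  | falsum => exact IsSemialgebraic.const False
  | equal t₁ t₂ =>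
    refine (IsSemialgebraic.eq (isPolynomialFn_realize t₁) (isPolynomialFn_realize t₂)).congr
      fun F z => ?_
    simp only [Language.BoundedFormula.Realize, helim]
  | rel R ts =>
    rcases R with R | R
    · cases R with
      | lt =>
        refine (IsSemialgebraic.lt (isPolynomialFn_realize (ts 0))
          (isPolynomialFn_realize (ts 1))).congr fun F z => ?_
        simp only [Language.BoundedFormula.Realize, helim]
        exact Iff.rfl
    · exact R.elim
  | imp φ ψ hφ hψ => exact hφ.imp hψ
  | @all k φ hφ =>
    refine (IsSemialgebraic.forall_tuple (m := 1) (A := fun F z y =>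
      letI := F.structure; φ.Realize (fun i => z (Sum.inl i))
        (Fin.snoc (fun i => z (Sum.inr i)) (y 0))) ?_).congr fun F z => ?_
    · refine (hφ.comp (σ := (σ ⊕ Fin k) ⊕ Fin 1) (f := fun F z => Sum.elim
        (fun i => z (Sum.inl (Sum.inl i)))
        (Fin.snoc (α := fun _ => F.carrier) (fun i => z (Sum.inl (Sum.inr i))) (z (Sum.inr 0))))
        ?_).congr fun F z => Iff.rfl
      rintro (i | i)
      · exact IsPolynomialFn.var _
      · refine Fin.lastCases ?_ (fun j => ?_) i
        · simpa using IsPolynomialFn.var _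
        · simpa using IsPolynomialFn.var _
    · exact ⟨fun h y => h (y 0), fun h y => h fun _ => y⟩

/-- The formula enters only here; the rest of the argument concerns predicates decided by finitely
many signs. -/
theorem isSemialgebraic_definedSet {n : ℕ} (φ : L.Formula (Fin n)) :
    IsSemialgebraic fun F x => x ∈ definedSet F.carrier F.const φ := by
  refine ((isSemialgebraic_realize φ).comp (σ := Fin n)
    (f := fun F x => Sum.elim x Fin.elim0) ?_).congr fun F x => ?_
  · rintro (i | i)
    · exact IsPolynomialFn.var i
    · exact i.elim0
  · let := F.structure
    change Language.BoundedFormula.Realize φ x default ↔ _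
    rw [iff_iff_eq]
    congr

/-! ### Transfer between the real numbers and Hahn series -/

/-- The real numbers as a real closed field over themselves. -/
noncomputable abbrev realField : RealClosedExt where
  carrier := ℝ
  const := RingHom.id ℝ
  ivt := polynomialIVT_real

/-- The embedding of the real numbers into the field of Hahn series, as a ring homomorphism. -/
noncomputable def toStarHom : ℝ →+* RStar where
  toFun := toStar
  map_one' := rfl
  map_mul' x y := map_mul HahnSeries.C x y
  map_zero' := map_zero HahnSeries.C
  map_add' x y := map_add HahnSeries.C x y

/-- The field of Hahn series as a real closed field over the real numbers. -/
noncomputable abbrev starField : RealClosedExt where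
  carrier := RStar
  const := toStarHom
  ivt := polynomialIVT_rStar

theorem toStar_pos_iff {r : ℝ} : 0 < toStar r ↔ 0 < r := by
  rw [← HahnSeries.leadingCoeff_pos_iff]
  simp [toStar, HahnSeries.C_apply, HahnSeries.leadingCoeff_of_single]

theorem sign_toStarHom (r : ℝ) : SignType.sign (toStarHom r) = SignType.sign r := by
  rcases lt_trichotomy r 0 with h | rfl | h
  · have : 0 < toStarHom (-r) := toStar_pos_iff.mpr (neg_pos.mpr h)
    rw [map_neg, neg_pos] at this
    rw [sign_neg h, sign_neg this]
  · simp
  · rw [sign_pos h]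
    exact sign_pos (toStar_pos_iff.mpr h)

/-- The embedding of ℝ preserves signs of real polynomials at real points, so no further hypothesis
is needed. -/
theorem IsSemialgebraic.transfer {σ : Type} {A : ∀ F : RealClosedExt, (σ → F.carrier) → Prop}
    (hA : IsSemialgebraic A) (x : σ → ℝ) :
    A realField x ↔ A starField fun i => toStar (x i) := by
  obtain ⟨Q, hQ⟩ := hA
  refine hQ realField starField x _ fun q _ => ?_
  have h1 : starField.eval (fun i => toStar (x i)) q = toStarHom (realField.eval x q) := by
    have := MvPolynomial.eval₂_comp_left toStarHom (RingHom.id ℝ) x q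
    rw [RingHom.comp_id] at this
    exact this.symm
  rw [h1, sign_toStarHom]

/-! ### Submanifolds and their approximate tangent spaces -/

section Analysis

open Filter Topology Asymptotics

variable {E : Type*} [NormedAddCommGroup E] [NormedSpace ℝ E]

/-- Near `a`, secants of `X` are asymptotically fixed by `P`. -/
def IsFlatAt (X : Set E) (a : E) (P : E →L[ℝ] E) : Prop :=
  (fun p : E × E => (p.1 - p.2) - P (p.1 - p.2)) =o[𝓝[X ×ˢ X] (a, a)] fun p => p.1 - p.2

/-- Near `a`, the map `P` takes on `X` all the values it takes on the whole space, with linear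
control. -/
def IsFullAt (X : Set E) (a : E) (P : E →L[ℝ] E) : Prop :=
  ∃ C : ℝ, ∀ᶠ y in 𝓝 a, ∃ x ∈ X, P x = P y ∧ ‖x - a‖ ≤ C * ‖P (y - a)‖

theorem IsFlatAt.exists_ball {X : Set E} {a : E} {P : E →L[ℝ] E} (h : IsFlatAt X a P) {ε : ℝ}
    (hε : 0 < ε) : ∃ ρ > 0, ∀ x ∈ X, ∀ x' ∈ X, ‖x - a‖ < ρ → ‖x' - a‖ < ρ →
      ‖(x - x') - P (x - x')‖ ≤ ε * ‖x - x'‖ := by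
  have h1 := h.def hε
  rw [eventually_nhdsWithin_iff, Metric.eventually_nhds_iff] at h1
  obtain ⟨ρ, hρ, h2⟩ := h1
  refine ⟨ρ, hρ, fun x hx x' hx' hxa hxa' => h2 (y := (x, x')) ?_ ⟨hx, hx'⟩⟩
  rw [Prod.dist_eq, dist_eq_norm, dist_eq_norm]
  exact max_lt hxa hxa'

theorem IsFlatAt.of_forall {X : Set E} {a : E} {P : E →L[ℝ] E}
    (h : ∀ ε > 0, ∃ ρ > 0, ∀ x ∈ X, ∀ x' ∈ X, ‖x - a‖ < ρ → ‖x' - a‖ < ρ →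
      ‖(x - x') - P (x - x')‖ ≤ ε * ‖x - x'‖) : IsFlatAt X a P := by
  refine IsLittleO.of_bound fun ε hε => ?_
  rw [eventually_nhdsWithin_iff, Metric.eventually_nhds_iff]
  obtain ⟨ρ, hρ, h2⟩ := h ε hε
  refine ⟨ρ, hρ, fun y hy hyX => h2 _ hyX.1 _ hyX.2 ?_ ?_⟩
  · rw [← dist_eq_norm]
    exact (le_max_left _ _).trans_lt hy
  · rw [← dist_eq_norm]
    exact (le_max_right _ _).trans_lt hy

variable [FiniteDimensional ℝ E]

theorem exists_projection (T : Submodule ℝ E) :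
    ∃ P : E →L[ℝ] E, (∀ x, P (P x) = P x) ∧ LinearMap.range (P : E →ₗ[ℝ] E) = T := by
  obtain ⟨S, hS⟩ := T.exists_isCompl
  refine ⟨LinearMap.toContinuousLinearMap (T.subtype ∘ₗ T.projectionOnto S hS), ?_, ?_⟩
  · intro x
    simp
  · ext x
    constructor
    · rintro ⟨y, rfl⟩
      simp
    · intro hx
      exact ⟨x, by
        have := T.projectionOnto_apply_left hS ⟨x, hx⟩
        change ((T.projectionOnto S hS x : T) : E) = x
        rw [this]⟩

/-- For u in the range of Q, fullness yields points x of X with Q(x - a) = su and x - a = O(s).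
Flatness gives x - a = P(x - a) + o(s), so u is a limit of values of QP, whose range is closed. -/
theorem range_le_range_comp_of_isFullAt {X : Set E} {a : E} (ha : a ∈ X) {P Q : E →L[ℝ] E}
    (hP : IsFlatAt X a P) (hQ : ∀ x, Q (Q x) = Q x) (hQX : IsFullAt X a Q) :
    LinearMap.range (Q : E →ₗ[ℝ] E) ≤ LinearMap.range ((Q ∘L P : E →L[ℝ] E) : E →ₗ[ℝ] E) := by
  rintro u ⟨u₀, rfl⟩
  set u := Q u₀ with hu
  change u ∈ _
  have hQu : Q u = u := hQ u₀
  have hcl : IsClosed (LinearMap.range ((Q ∘L P : E →L[ℝ] E) : E →ₗ[ℝ] E) : Set E) :=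
    Submodule.closed_of_finiteDimensional _
  rw [← SetLike.mem_coe, ← hcl.closure_eq, Metric.mem_closure_iff]
  intro ε hε
  obtain ⟨C, hC⟩ := hQX
  -- The constant is chosen so that the final error, after division by s, is ε/2.
  set η : ℝ := ε / (2 * ((‖Q‖ + 1) * ((|C| + 1) * (‖u‖ + 1)))) with hη
  have hηpos : 0 < η := by positivity
  obtain ⟨ρ, hρ, hflat⟩ := hP.exists_ball hηpos
  have hlim : Tendsto (fun s : ℝ => a + s • u) (𝓝[>] 0) (𝓝 a) := by
    have : Tendsto (fun s : ℝ => a + s • u) (𝓝 0) (𝓝 (a + (0 : ℝ) • u)) := by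
      apply Continuous.tendsto
      fun_prop
    rw [zero_smul, add_zero] at this
    exact this.mono_left nhdsWithin_le_nhds
  have hsmall : ∀ᶠ s : ℝ in 𝓝[>] 0, (|C| + 1) * (‖u‖ + 1) * s < ρ := by
    have : Tendsto (fun s : ℝ => (|C| + 1) * (‖u‖ + 1) * s) (𝓝 0) (𝓝 ((|C| + 1) * (‖u‖ + 1) * 0)) :=
      Continuous.tendsto (by fun_prop) _
    rw [mul_zero] at this
    exact (this.mono_left nhdsWithin_le_nhds).eventually (gt_mem_nhds hρ)
  obtain ⟨s, ⟨⟨x, hxX, hQx, hxa⟩, hsρ⟩, hs⟩ :=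
    ((hlim.eventually hC).and hsmall |>.and self_mem_nhdsWithin).exists
  have hs : 0 < s := hs
  rw [add_sub_cancel_left, map_smul, hQu, norm_smul, Real.norm_of_nonneg hs.le] at hxa
  have hxa' : ‖x - a‖ ≤ (|C| + 1) * (‖u‖ + 1) * s := by
    refine hxa.trans ?_
    have h1 : C ≤ |C| + 1 := (le_abs_self C).trans (by linarith)
    have h2 : s * ‖u‖ ≤ (‖u‖ + 1) * s := by nlinarith
    calc C * (s * ‖u‖) ≤ (|C| + 1) * (s * ‖u‖) := mul_le_mul_of_nonneg_right h1 (by positivity)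
      _ ≤ (|C| + 1) * ((‖u‖ + 1) * s) := mul_le_mul_of_nonneg_left h2 (by positivity)
      _ = _ := by ring
  have hN := hflat x hxX a ha (hxa'.trans_lt hsρ) (by simpa using hρ)
  have hQxa : Q (x - a) = s • u := by
    rw [map_sub, hQx, map_add, map_smul, hQu, add_sub_cancel_left]
  refine ⟨s⁻¹ • (Q ∘L P) (x - a), ⟨s⁻¹ • (x - a), by simp⟩, ?_⟩
  have heq : u - s⁻¹ • (Q ∘L P) (x - a) = s⁻¹ • Q ((x - a) - P (x - a)) := by
    rw [Q.map_sub (x - a), hQxa, smul_sub, smul_smul, inv_mul_cancel₀ hs.ne', one_smul]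
    rfl
  rw [dist_eq_norm, heq, norm_smul, norm_inv, Real.norm_of_nonneg hs.le]
  have h3 : ‖Q ((x - a) - P (x - a))‖ ≤ (‖Q‖ + 1) * (η * ((|C| + 1) * (‖u‖ + 1) * s)) :=
    (Q.le_opNorm _).trans (mul_le_mul (by linarith) (hN.trans
      (mul_le_mul_of_nonneg_left hxa' hηpos.le)) (norm_nonneg _) (by positivity))
  have h4 : (‖Q‖ + 1) * (η * ((|C| + 1) * (‖u‖ + 1) * s)) = s * (ε / 2) := by
    rw [hη]
    field_simp
  rw [h4] at h3
  rw [inv_mul_lt_iff₀ hs]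
  have : 0 < s * ε := by positivity
  linarith

theorem finrank_range_le_of_isFullAt {X : Set E} {a : E} (ha : a ∈ X) {P Q : E →L[ℝ] E}
    (hP : IsFlatAt X a P) (hQ : ∀ x, Q (Q x) = Q x) (hQX : IsFullAt X a Q) :
    Module.finrank ℝ (LinearMap.range (Q : E →ₗ[ℝ] E)) ≤
      Module.finrank ℝ (LinearMap.range (P : E →ₗ[ℝ] E)) := by
  refine (Submodule.finrank_mono (range_le_range_comp_of_isFullAt ha hP hQ hQX)).trans ?_
  rw [ContinuousLinearMap.toLinearMap_comp, LinearMap.range_comp]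
  exact Submodule.finrank_map_le _ _

/-- Equality of ranks turns the inclusion of ranges into injectivity of Q on the range of P. -/
theorem injective_domRestrict_of_isFullAt {X : Set E} {a : E} (ha : a ∈ X) {P Q : E →L[ℝ] E}
    (hP : IsFlatAt X a P) (hQ : ∀ x, Q (Q x) = Q x) (hQX : IsFullAt X a Q)
    (hrank : Module.finrank ℝ (LinearMap.range (P : E →ₗ[ℝ] E)) =
      Module.finrank ℝ (LinearMap.range (Q : E →ₗ[ℝ] E))) :
    Function.Injective ((Q : E →ₗ[ℝ] E).domRestrict (LinearMap.range (P : E →ₗ[ℝ] E))) := by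
  have h1 := Submodule.finrank_mono (range_le_range_comp_of_isFullAt ha hP hQ hQX)
  rw [ContinuousLinearMap.toLinearMap_comp, LinearMap.range_comp] at h1
  have h2 := LinearMap.finrank_range_add_finrank_ker
    ((Q : E →ₗ[ℝ] E).domRestrict (LinearMap.range (P : E →ₗ[ℝ] E)))
  rw [LinearMap.range_domRestrict] at h2
  rw [← LinearMap.ker_eq_bot, ← Submodule.finrank_eq_zero (R := ℝ)]
  omega

/-- A secant z from `a` with Qz = 0 satisfies QPz = -Q(z - Pz), which is small. As Q is bounded
below on the range of P, so is Pz; the choice of η then gives ‖z‖ ≤ ‖z‖/2. -/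
theorem eventually_eq_of_isFullAt {X : Set E} {a : E} (ha : a ∈ X) {P Q : E →L[ℝ] E}
    (hP : IsFlatAt X a P) (hQ : ∀ x, Q (Q x) = Q x) (hQX : IsFullAt X a Q)
    (hrank : Module.finrank ℝ (LinearMap.range (P : E →ₗ[ℝ] E)) =
      Module.finrank ℝ (LinearMap.range (Q : E →ₗ[ℝ] E))) :
    ∃ ρ > 0, ∀ x ∈ X, ‖x - a‖ < ρ → Q x = Q a → x = a := by
  have hinj := injective_domRestrict_of_isFullAt ha hP hQ hQX hrank
  obtain ⟨κ, hκ, hanti⟩ := LinearMap.exists_antilipschitzWith _ (LinearMap.ker_eq_bot.mpr hinj)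
  have hbound : ∀ z, ‖P z‖ ≤ κ * ‖Q (P z)‖ := by
    intro z
    have := hanti.le_mul_dist ⟨P z, z, rfl⟩ 0
    simpa [dist_eq_norm] using this
  set η : ℝ := 1 / (2 * (κ * ‖Q‖ + 1)) with hη
  have hηpos : 0 < η := by positivity
  obtain ⟨ρ, hρ, hflat⟩ := hP.exists_ball hηpos
  refine ⟨ρ, hρ, fun x hx hxa hQx => ?_⟩
  have hN := hflat x hx a ha hxa (by simpa using hρ)
  set z := x - a with hz
  have hQz : Q z = 0 := by rw [hz, map_sub, hQx, sub_self]
  have h1 : Q (P z) = -Q (z - P z) := by rw [Q.map_sub z, hQz, zero_sub, neg_neg]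
  have h2 : ‖P z‖ ≤ κ * (‖Q‖ * ‖z - P z‖) := (hbound z).trans (by
    rw [h1, norm_neg]
    exact mul_le_mul_of_nonneg_left (Q.le_opNorm _) κ.2)
  have h3 : ‖z‖ ≤ ‖P z‖ + ‖z - P z‖ := by
    have := norm_add_le (P z) (z - P z)
    rwa [add_sub_cancel] at this
  have h4 : ‖z‖ ≤ (κ * ‖Q‖ + 1) * (η * ‖z‖) := by
    have : (κ * ‖Q‖ + 1) * ‖z - P z‖ ≤ (κ * ‖Q‖ + 1) * (η * ‖z‖) :=
      mul_le_mul_of_nonneg_left hN (by positivity)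
    linarith
  have h5 : (κ * ‖Q‖ + 1) * (η * ‖z‖) = ‖z‖ / 2 := by
    rw [hη]
    field_simp
  rw [h5] at h4
  have : ‖z‖ = 0 := le_antisymm (by linarith) (norm_nonneg _)
  rw [norm_eq_zero] at this
  exact sub_eq_zero.mp this

end Analysis

/-! ### Flat and full projections obtained from charts -/

section Charts

open Filter Topology Asymptotics

/-- Around the point `a` there is a `C^1`-chart which maps `X` to a `d`-dimensional linear
subspace. -/
def HasC1ChartAt {n : ℕ} (d : ℕ) (X : Set (Fin n → ℝ)) (a : Fin n → ℝ) : Prop :=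
  ∃ (Φ : OpenPartialHomeomorph (Fin n → ℝ) (Fin n → ℝ)) (W : Submodule ℝ (Fin n → ℝ)),
    a ∈ Φ.source ∧ ContDiffOn ℝ 1 Φ Φ.source ∧ ContDiffOn ℝ 1 Φ.symm Φ.target ∧
    Module.finrank ℝ W = d ∧ ∀ x ∈ Φ.source, (x ∈ X ↔ Φ x ∈ W)

variable {n : ℕ} {d : ℕ} {X : Set (Fin n → ℝ)} {a : Fin n → ℝ}

/-- P projects to the tangent space D'(W). Chart differences of points of X lie in W, which the map
N D' kills, so strict differentiability of the chart gives flatness. -/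
theorem HasC1ChartAt.exists_isFlatAt_isFullAt (h : HasC1ChartAt d X a) (ha : a ∈ X) :
    ∃ P : (Fin n → ℝ) →L[ℝ] Fin n → ℝ, (∀ x, P (P x) = P x) ∧
      Module.finrank ℝ (LinearMap.range (P : (Fin n → ℝ) →ₗ[ℝ] Fin n → ℝ)) = d ∧
      IsFlatAt X a P ∧ IsFullAt X a P := by
  obtain ⟨Φ, W, haΦ, hΦ, hΦ', hW, hX⟩ := h
  have hnhds : Φ.source ∈ 𝓝 a := Φ.open_source.mem_nhds haΦ
  have hcd : ContDiffAt ℝ 1 Φ a := hΦ.contDiffAt hnhds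
  have hcd' : ContDiffAt ℝ 1 Φ.symm (Φ a) :=
    hΦ'.contDiffAt (Φ.open_target.mem_nhds (Φ.map_source haΦ))
  obtain ⟨D, hD⟩ : ∃ D, HasStrictFDerivAt Φ D a := ⟨_, hcd.hasStrictFDerivAt one_ne_zero⟩
  obtain ⟨D', hD'⟩ : ∃ D', HasStrictFDerivAt Φ.symm D' (Φ a) :=
    ⟨_, hcd'.hasStrictFDerivAt one_ne_zero⟩
  have hD'D : D' ∘L D = ContinuousLinearMap.id ℝ _ := by
    have h1 : HasFDerivAt (Φ.symm ∘ Φ) (D' ∘L D) a :=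
      hD'.hasFDerivAt.comp a hD.hasFDerivAt
    refine h1.unique ((hasFDerivAt_id a).congr_of_eventuallyEq ?_)
    filter_upwards [hnhds] with x hx using Φ.left_inv hx
  have hDD' : D ∘L D' = ContinuousLinearMap.id ℝ _ := by
    have h1 : HasFDerivAt (Φ ∘ Φ.symm) (D ∘L D') (Φ a) := by
      refine HasFDerivAt.comp (Φ a) ?_ hD'.hasFDerivAt
      rw [Φ.left_inv haΦ]
      exact hD.hasFDerivAt
    refine h1.unique ((hasFDerivAt_id (Φ a)).congr_of_eventuallyEq ?_)
    filter_upwards [Φ.open_target.mem_nhds (Φ.map_source haΦ)] with x hx using Φ.right_inv hx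
  have hD'D₁ : ∀ x, D' (D x) = x := fun x => congrArg (fun f => f x) hD'D
  have hDD'₁ : ∀ x, D (D' x) = x := fun x => congrArg (fun f => f x) hDD'
  have hinj : Function.Injective (D' : (Fin n → ℝ) →ₗ[ℝ] Fin n → ℝ) :=
    Function.LeftInverse.injective hDD'₁
  obtain ⟨P, hPP, hPT⟩ := exists_projection (W.map (D' : (Fin n → ℝ) →ₗ[ℝ] Fin n → ℝ))
  have hPW : ∀ w, P (D' w) = D' w ↔ w ∈ W := by
    intro w
    constructor
    · intro hw
      have : D' w ∈ LinearMap.range (P : (Fin n → ℝ) →ₗ[ℝ] Fin n → ℝ) := ⟨_, hw⟩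
      rw [hPT] at this
      obtain ⟨w', hw', heq⟩ := this
      rwa [← hinj heq]
    · intro hw
      have : D' w ∈ LinearMap.range (P : (Fin n → ℝ) →ₗ[ℝ] Fin n → ℝ) := by
        rw [hPT]; exact ⟨w, hw, rfl⟩
      obtain ⟨z, hz⟩ := this
      rw [← hz]
      exact hPP z
  set N : (Fin n → ℝ) →L[ℝ] Fin n → ℝ := ContinuousLinearMap.id ℝ _ - P with hN
  have hNx : ∀ x, N x = x - P x := fun x => rfl
  have hNW : ∀ w, N (D' w) = 0 ↔ w ∈ W := fun w => by
    rw [hNx, sub_eq_zero, eq_comm, hPW]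
  have haW : Φ a ∈ W := (hX a haΦ).mp ha
  refine ⟨P, hPP, ?_, ?_, ?_⟩
  · rw [hPT, ← hW]
    exact (Submodule.equivMapOfInjective _ hinj W).finrank_eq.symm
  · have h1 := hD.isLittleO
    have h2 : (fun p : (Fin n → ℝ) × (Fin n → ℝ) => (N ∘L D') (Φ p.1 - Φ p.2 - D (p.1 - p.2)))
        =o[𝓝 (a, a)] fun p => p.1 - p.2 :=
      ((N ∘L D').isBigO_comp _ _).trans_isLittleO h1
    refine ((h2.mono nhdsWithin_le_nhds).neg_left).congr' ?_ EventuallyEq.rfl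
    have hev : ∀ᶠ p : (Fin n → ℝ) × (Fin n → ℝ) in 𝓝[X ×ˢ X] (a, a),
        p.1 ∈ Φ.source ∧ p.2 ∈ Φ.source :=
      nhdsWithin_le_nhds ((continuous_fst.tendsto (a, a)).eventually hnhds |>.and
        ((continuous_snd.tendsto (a, a)).eventually hnhds))
    filter_upwards [hev, self_mem_nhdsWithin] with p hp hpX
    have hW1 : Φ p.1 - Φ p.2 ∈ W :=
      W.sub_mem ((hX _ hp.1).mp hpX.1) ((hX _ hp.2).mp hpX.2)
    rw [ContinuousLinearMap.comp_apply, map_sub D', map_sub N, (hNW _).mpr hW1, hD'D₁, zero_sub,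
      neg_neg, hNx]
  -- This map combines the tangential coordinate P with the normal chart coordinate and has
  -- derivative the identity at `a`. Its local inverse, applied where the normal coordinate keeps
  -- its value at `a`, produces the points of X needed for fullness.
  · set Θ : (Fin n → ℝ) → Fin n → ℝ := fun x => P x + (N ∘L D') (Φ x) with hΘ
    have hΘd : HasStrictFDerivAt Θ
        ((ContinuousLinearEquiv.refl ℝ (Fin n → ℝ) : (Fin n → ℝ) →L[ℝ] Fin n → ℝ)) a := by
      have h1 : HasStrictFDerivAt Θ (P + (N ∘L D') ∘L D) a :=
        P.hasStrictFDerivAt.add ((N ∘L D').hasStrictFDerivAt.comp a hD)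
      have h2 : P + (N ∘L D') ∘L D = (ContinuousLinearEquiv.refl ℝ (Fin n → ℝ) :
          (Fin n → ℝ) →L[ℝ] Fin n → ℝ) := by
        ext1 x
        simp [hNx, hD'D₁]
      rwa [h2] at h1
    set g := hΘd.localInverse with hg
    have hga : g (Θ a) = a := hΘd.localInverse_apply_image
    have hgd : HasFDerivAt g _ (Θ a) := hΘd.to_localInverse.hasFDerivAt
    obtain ⟨C, hC⟩ := hgd.isBigO_sub.bound
    have hinv := hΘd.eventually_right_inverse
    have hsrc : ∀ᶠ z in 𝓝 (Θ a), g z ∈ Φ.source := by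
      have := hgd.continuousAt.tendsto
      rw [hga] at this
      exact this.eventually hnhds
    have hz : Tendsto (fun y => Θ a + P (y - a)) (𝓝 a) (𝓝 (Θ a)) := by
      have : Tendsto (fun y => Θ a + P (y - a)) (𝓝 a) (𝓝 (Θ a + P (a - a))) :=
        Continuous.tendsto (by fun_prop) _
      simpa using this
    refine ⟨C, ?_⟩
    filter_upwards [hz.eventually hC, hz.eventually hinv, hz.eventually hsrc] with y h1 h2 h3
    change Θ (g (Θ a + P (y - a))) = _ at h2
    set x := g (Θ a + P (y - a)) with hx
    rw [hga, add_sub_cancel_left] at h1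
    have h4 : P (x - a) + N (D' (Φ x - Φ a)) = P (y - a) := by
      have : Θ x - Θ a = P (y - a) := by rw [h2, add_sub_cancel_left]
      rw [← this]
      simp only [hΘ, ContinuousLinearMap.comp_apply, map_sub]
      abel
    have hPN : ∀ z, P (N z) = 0 := fun z => by rw [hNx, map_sub, hPP, sub_self]
    have h5 : P (x - a) = P (y - a) := by
      have := congrArg P h4
      rwa [map_add, hPN, add_zero, hPP, hPP] at this
    have h6 : N (D' (Φ x - Φ a)) = 0 := by
      rw [h5] at h4
      simpa using h4
    have h7 : Φ x ∈ W := by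
      have := W.add_mem ((hNW _).mp h6) haW
      rwa [sub_add_cancel] at this
    refine ⟨x, (hX x h3).mpr h7, ?_, h1⟩
    rw [map_sub, map_sub] at h5
    exact sub_left_injective h5

end Charts

/-! ### Charts obtained from flat and full projections -/

section FlatFull

open Filter Topology Asymptotics

/-- Strict differentiability at x makes f - f'(x) Lipschitz with small constant near x, which bounds
the difference of the derivatives and gives their continuity. -/
theorem contDiffOn_one_of_hasStrictFDerivAt {E F : Type*} [NormedAddCommGroup E] [NormedSpace ℝ E]
    [NormedAddCommGroup F] [NormedSpace ℝ F] {f : E → F} {U : Set E} (hU : IsOpen U)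
    (h : ∀ x ∈ U, ∃ f' : E →L[ℝ] F, HasStrictFDerivAt f f' x) : ContDiffOn ℝ 1 f U := by
  have hdiff : ∀ x ∈ U, HasFDerivAt f (fderiv ℝ f x) x := fun x hx => by
    obtain ⟨f', hf'⟩ := h x hx
    exact hf'.hasFDerivAt.differentiableAt.hasFDerivAt
  rw [← zero_add (1 : WithTop ℕ∞), contDiffOn_succ_iff_fderiv_of_isOpen hU]
  refine ⟨fun x hx => (hdiff x hx).differentiableAt.differentiableWithinAt, by simp, ?_⟩
  rw [contDiffOn_zero]
  intro x hx
  obtain ⟨f', hf'⟩ := h x hx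
  refine ContinuousAt.continuousWithinAt ?_
  rw [ContinuousAt, hf'.hasFDerivAt.fderiv, Metric.tendsto_nhds]
  intro ε hε
  obtain ⟨S, hS, hlin⟩ := hf'.approximates_deriv_on_nhds (c := Real.toNNReal (ε / 2))
    (Or.inr (Real.toNNReal_pos.mpr (half_pos hε)))
  filter_upwards [eventually_mem_nhds_iff.mpr hS, hU.mem_nhds hx] with y hyS hyU
  have h1 : HasFDerivAt (fun z => f z - f' z) (fderiv ℝ f y - f') y :=
    (hdiff y hyU).sub f'.hasFDerivAt
  have h2 : ‖fderiv ℝ f y - f'‖ ≤ ε / 2 := by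
    refine h1.le_of_lip' (by positivity) ?_
    filter_upwards [hyS] with z hz
    have := hlin z hz y (mem_of_mem_nhds hyS)
    rw [map_sub, Real.coe_toNNReal _ (half_pos hε).le] at this
    convert this using 2
    abel
  rw [dist_eq_norm]
  linarith

variable {n : ℕ} {d : ℕ} {X : Set (Fin n → ℝ)}

/-- Let g be a left inverse of P on the range of Q. Increments of the section s are nearly in that
range, so they equal g applied to their image under P up to a small error, and Ps = P identifies the
derivative as gP. -/
theorem hasStrictFDerivAt_of_isFlatAt {s : (Fin n → ℝ) → Fin n → ℝ} {U : Set (Fin n → ℝ)}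
    (hU : IsOpen U) {P : (Fin n → ℝ) →L[ℝ] Fin n → ℝ} (hs : ∀ y ∈ U, s y ∈ X)
    (hPs : ∀ y ∈ U, P (s y) = P y) (hlip : ∀ y ∈ U, ∀ y' ∈ U, ‖s y - s y'‖ ≤ 2 * ‖P (y - y')‖)
    {y₀ : Fin n → ℝ} (hy₀ : y₀ ∈ U) {Q : (Fin n → ℝ) →L[ℝ] Fin n → ℝ}
    (hQ : IsFlatAt X (s y₀) Q)
    (hinj : Function.Injective (((P : (Fin n → ℝ) →ₗ[ℝ] Fin n → ℝ)).domRestrict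
      (LinearMap.range (Q : (Fin n → ℝ) →ₗ[ℝ] Fin n → ℝ)))) :
    ∃ s' : (Fin n → ℝ) →L[ℝ] Fin n → ℝ, HasStrictFDerivAt s s' y₀ := by
  obtain ⟨g₀, hg₀⟩ := LinearMap.exists_leftInverse_of_injective _ (LinearMap.ker_eq_bot.mpr hinj)
  set g : (Fin n → ℝ) →L[ℝ] Fin n → ℝ :=
    LinearMap.toContinuousLinearMap ((Submodule.subtype _) ∘ₗ g₀) with hg
  have hgP : ∀ z, g (P (Q z)) = Q z := fun z => by
    have := congrArg (fun f => f ⟨Q z, z, rfl⟩) hg₀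
    exact congrArg Subtype.val this
  refine ⟨g ∘L P, .of_isLittleO ?_⟩
  have hUU : ∀ᶠ p : (Fin n → ℝ) × (Fin n → ℝ) in 𝓝 (y₀, y₀), p.1 ∈ U ∧ p.2 ∈ U :=
    (continuous_fst.tendsto (y₀, y₀)).eventually (hU.mem_nhds hy₀) |>.and
      ((continuous_snd.tendsto (y₀, y₀)).eventually (hU.mem_nhds hy₀))
  have hbig : (fun p : (Fin n → ℝ) × (Fin n → ℝ) => s p.1 - s p.2) =O[𝓝 (y₀, y₀)]
      fun p => p.1 - p.2 := by
    refine IsBigO.of_bound (2 * ‖P‖) ?_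
    filter_upwards [hUU] with p hp
    rw [mul_assoc]
    exact (hlip _ hp.1 _ hp.2).trans (mul_le_mul_of_nonneg_left (P.le_opNorm _) zero_le_two)
  have hcont : Tendsto s (𝓝 y₀) (𝓝 (s y₀)) := by
    rw [tendsto_iff_norm_sub_tendsto_zero]
    have h0 : Tendsto (fun y => 2 * ‖P (y - y₀)‖) (𝓝 y₀) (𝓝 (2 * ‖P (y₀ - y₀)‖)) :=
      Continuous.tendsto (by fun_prop) _
    rw [sub_self, map_zero, norm_zero, mul_zero] at h0
    refine squeeze_zero' (Eventually.of_forall fun _ => norm_nonneg _) ?_ h0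
    filter_upwards [hU.mem_nhds hy₀] with y hy using hlip y hy y₀ hy₀
  have hss : Tendsto (fun p : (Fin n → ℝ) × (Fin n → ℝ) => (s p.1, s p.2)) (𝓝 (y₀, y₀))
      (𝓝[X ×ˢ X] (s y₀, s y₀)) := by
    refine tendsto_nhdsWithin_iff.mpr ⟨?_, ?_⟩
    · rw [nhds_prod_eq, nhds_prod_eq]
      exact hcont.prodMap hcont
    · filter_upwards [hUU] with p hp using ⟨hs _ hp.1, hs _ hp.2⟩
  have hlit := (hQ.comp_tendsto hss).trans_isBigO hbig
  have h2 := ((ContinuousLinearMap.id ℝ (Fin n → ℝ) - g ∘L P).isBigO_comp _ _).trans_isLittleO hlit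
  refine h2.congr' ?_ EventuallyEq.rfl
  filter_upwards [hUU] with p hp
  have h3 : P (p.1 - p.2) = P (s p.1 - s p.2) := by
    rw [map_sub, map_sub, hPs _ hp.1, hPs _ hp.2]
  simp only [Function.comp_apply, sub_apply, ContinuousLinearMap.coe_id', id_eq,
    ContinuousLinearMap.comp_apply, h3]
  rw [map_sub P, map_sub g, hgP]
  abel

/-- Near `a`, X is the image of a Lipschitz section s of P. Flatness at each of its points, with
varying tangent spaces, makes s continuously differentiable. -/
theorem isC1Submanifold_of_isFlatAt_isFullAt
    (h : ∀ a ∈ X, ∃ P : (Fin n → ℝ) →L[ℝ] Fin n → ℝ, (∀ x, P (P x) = P x) ∧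
      Module.finrank ℝ (LinearMap.range (P : (Fin n → ℝ) →ₗ[ℝ] Fin n → ℝ)) = d ∧
      IsFlatAt X a P ∧ IsFullAt X a P) : IsC1Submanifold d X := by
  intro a ha
  obtain ⟨P, hPP, hPd, hflat, C, hC⟩ := h a ha
  -- With factor 1/2, secants of X satisfy ‖z‖ ≤ 2‖Pz‖, so P is injective on X near `a`.
  obtain ⟨ρ, hρ, hN⟩ := hflat.exists_ball (ε := 1 / 2) (by norm_num)
  rw [Metric.eventually_nhds_iff] at hC
  obtain ⟨δ, hδ, hC⟩ := hC
  set η : ℝ := min δ (ρ / (|C| + 1)) with hη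
  have hηpos : 0 < η := by positivity
  set U : Set (Fin n → ℝ) := {y | ‖P (y - a)‖ < η} with hUdef
  have hU : IsOpen U := isOpen_lt (by fun_prop) continuous_const
  have hUP : ∀ y y', P y = P y' → y ∈ U → y' ∈ U := fun y y' hyy' hy => by
    change ‖P (y' - a)‖ < η
    rw [map_sub, ← hyy', ← map_sub]
    exact hy
  have hlip' : ∀ x ∈ X, ∀ x' ∈ X, ‖x - a‖ < ρ → ‖x' - a‖ < ρ → ‖x - x'‖ ≤ 2 * ‖P (x - x')‖ := by
    intro x hx x' hx' hxa hxa'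
    have h1 := hN x hx x' hx' hxa hxa'
    have h2 := norm_add_le (P (x - x')) ((x - x') - P (x - x'))
    rw [add_sub_cancel] at h2
    linarith
  have hex : ∀ y, y ∈ U → ∃ x, x ∈ X ∧ ‖x - a‖ < ρ ∧ P x = P y := by
    intro y hy
    have hy : ‖P (y - a)‖ < η := hy
    obtain ⟨x, hx, hPx, hxa⟩ := hC (y := a + P (y - a)) (by
      rw [dist_eq_norm, add_sub_cancel_left]
      exact hy.trans_le (min_le_left _ _))
    rw [add_sub_cancel_left, hPP] at hxa
    refine ⟨x, hx, ?_, ?_⟩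
    · have h1 : C * ‖P (y - a)‖ ≤ (|C| + 1) * ‖P (y - a)‖ :=
        mul_le_mul_of_nonneg_right ((le_abs_self C).trans (by linarith)) (norm_nonneg _)
      have h2 : (|C| + 1) * ‖P (y - a)‖ < (|C| + 1) * (ρ / (|C| + 1)) :=
        mul_lt_mul_of_pos_left (hy.trans_le (min_le_right _ _)) (by positivity)
      rw [mul_div_cancel₀ _ (by positivity)] at h2
      linarith
    · rw [hPx, map_add, hPP, ← map_add, add_sub_cancel]
  choose! s hsX hsρ hPs using hex
  have huniq : ∀ x ∈ X, ∀ x' ∈ X, ‖x - a‖ < ρ → ‖x' - a‖ < ρ → P x = P x' → x = x' := by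
    intro x hx x' hx' hxa hxa' hP
    have := hlip' x hx x' hx' hxa hxa'
    rw [map_sub, hP, sub_self, norm_zero, mul_zero] at this
    exact sub_eq_zero.mp (norm_le_zero_iff.mp this)
  have hsP : ∀ y ∈ U, ∀ y' ∈ U, P y = P y' → s y = s y' := fun y hy y' hy' hyy' =>
    huniq _ (hsX y hy) _ (hsX y' hy') (hsρ y hy) (hsρ y' hy') (by rw [hPs y hy, hPs y' hy', hyy'])
  have hlip : ∀ y ∈ U, ∀ y' ∈ U, ‖s y - s y'‖ ≤ 2 * ‖P (y - y')‖ := by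
    intro y hy y' hy'
    have := hlip' _ (hsX y hy) _ (hsX y' hy') (hsρ y hy) (hsρ y' hy')
    rwa [map_sub, hPs y hy, hPs y' hy', ← map_sub] at this
  have hstrict : ∀ y ∈ U, ∃ s' : (Fin n → ℝ) →L[ℝ] Fin n → ℝ, HasStrictFDerivAt s s' y := by
    intro y₀ hy₀
    -- The projection Q at s(y₀) may differ from P. The section shows that P is full there with
    -- constant 2, and equal ranks make P injective on the range of Q.
    obtain ⟨Q, hQQ, hQd, hQflat, -⟩ := h (s y₀) (hsX _ hy₀)
    have hc : s y₀ ∈ U := hUP _ _ (hPs y₀ hy₀).symm hy₀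
    refine hasStrictFDerivAt_of_isFlatAt hU hsX hPs hlip hy₀ hQflat
      (injective_domRestrict_of_isFullAt (hsX _ hy₀) hQflat hPP ⟨2, ?_⟩ (hQd.trans hPd.symm))
    filter_upwards [hU.mem_nhds hc] with y hy
    refine ⟨s y, hsX y hy, hPs y hy, ?_⟩
    have := hlip y hy _ hc
    rwa [hsP _ hc _ hy₀ (hPs _ hy₀)] at this
  have hs1 : ContDiffOn ℝ 1 s U := contDiffOn_one_of_hasStrictFDerivAt hU hstrict
  set N : (Fin n → ℝ) →L[ℝ] Fin n → ℝ := ContinuousLinearMap.id ℝ _ - P with hNdef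
  have hNx : ∀ x, N x = x - P x := fun x => rfl
  have hPN : ∀ x, P (N x) = 0 := fun x => by rw [hNx, map_sub, hPP, sub_self]
  have hNs1 : ContDiffOn ℝ 1 (fun y => N (s y)) U := N.contDiff.comp_contDiffOn hs1
  have hΦ1 : ContDiffOn ℝ 1 (fun y => y - N (s y)) U := contDiffOn_id.sub hNs1
  have hΨ1 : ContDiffOn ℝ 1 (fun y => y + N (s y)) U := contDiffOn_id.add hNs1
  have hPΦ : ∀ y, P (y - N (s y)) = P y := fun y => by rw [map_sub, hPN, sub_zero]
  have hPΨ : ∀ y, P (y + N (s y)) = P y := fun y => by rw [map_add, hPN, add_zero]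
  have hΦU : ∀ y ∈ U, y - N (s y) ∈ U := fun y hy => hUP _ _ (hPΦ y).symm hy
  have hΨU : ∀ y ∈ U, y + N (s y) ∈ U := fun y hy => hUP _ _ (hPΨ y).symm hy
  -- A shear along the kernel of P which flattens the graph. Since s(y) depends only on P(y), which
  -- the shear preserves, the inverse only changes a sign.
  let Φ : OpenPartialHomeomorph (Fin n → ℝ) (Fin n → ℝ) :=
    { toFun := fun y => y - N (s y)
      invFun := fun y => y + N (s y)
      source := U
      target := U
      map_source' := hΦU
      map_target' := hΨU
      left_inv' := fun y hy => by
        rw [hsP _ (hΦU y hy) _ hy (hPΦ y), sub_add_cancel]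
      right_inv' := fun y hy => by
        rw [hsP _ (hΨU y hy) _ hy (hPΨ y), add_sub_cancel_right]
      open_source := hU
      open_target := hU
      continuousOn_toFun := hΦ1.continuousOn
      continuousOn_invFun := hΨ1.continuousOn }
  have haU : a ∈ U := by
    change ‖P (a - a)‖ < η
    simpa using hηpos
  refine ⟨Φ.restrOpen (Metric.ball a ρ) Metric.isOpen_ball,
    LinearMap.range (P : (Fin n → ℝ) →ₗ[ℝ] Fin n → ℝ), ⟨haU, Metric.mem_ball_self hρ⟩,
    hΦ1.mono fun x hx => hx.1, hΨ1.mono fun x hx => hx.1, hPd, ?_⟩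
  rintro x ⟨hxU, hxρ⟩
  have hxU : x ∈ U := hxU
  have hxρ : ‖x - a‖ < ρ := by rwa [Metric.mem_ball, dist_eq_norm] at hxρ
  have hmem : x - N (s x) ∈ LinearMap.range (P : (Fin n → ℝ) →ₗ[ℝ] Fin n → ℝ) ↔ x = s x := by
    have h1 : N x - N (s x) = x - s x := by rw [hNx, hNx, hPs x hxU]; abel
    have h2 : x - N (s x) = P x + (x - s x) := by rw [← h1, hNx x]; abel
    rw [h2]
    constructor
    · rintro ⟨z, hz⟩
      change P z = _ at hz
      have h3 : P z = P x := by
        have := congrArg P hz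
        rwa [hPP, map_add, hPP, map_sub, hPs x hxU, sub_self, add_zero] at this
      rw [h3] at hz
      exact sub_eq_zero.mp (left_eq_add.mp hz)
    · intro hx
      rw [← hx, sub_self, add_zero]
      exact ⟨x, rfl⟩
  refine Iff.trans ?_ hmem.symm
  constructor
  · intro hx
    exact huniq x hx _ (hsX x hxU) hxρ (hsρ x hxU) (hPs x hxU).symm
  · intro hx
    rw [hx]
    exact hsX x hxU

end FlatFull

/-! ### Density of points with a chart in sets given by sign conditions -/

section RegularPoints

open Filter Topology MvPolynomial

variable {n : ℕ}

theorem hasFDerivAt_eval (p : MvPolynomial (Fin n) ℝ) (x : Fin n → ℝ) :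
    HasFDerivAt (fun x => eval x p)
      (∑ i, eval x (pderiv i p) • (ContinuousLinearMap.proj i : (Fin n → ℝ) →L[ℝ] ℝ)) x := by
  induction p using MvPolynomial.induction_on with
  | C r => simpa using hasFDerivAt_const r x
  | add p q hp hq =>
    simp only [map_add, add_smul, Finset.sum_add_distrib]
    exact hp.add hq
  | mul_X p j hp =>
    have h1 := hp.mul (ContinuousLinearMap.proj (R := ℝ) (φ := fun _ : Fin n => ℝ) j).hasFDerivAt
      (x := x)
    simp only [map_mul, eval_X]
    refine h1.congr_fderiv ?_
    ext1 v
    simp only [ContinuousLinearMap.proj_apply, add_apply, smul_apply, sum_apply, smul_eq_mul,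
      Derivation.leibniz, pderiv_X, map_add, map_mul, eval_X, Finset.mul_sum]
    simp only [Pi.single_apply, apply_ite (eval x), map_one, map_zero, mul_ite, mul_one, mul_zero,
      add_mul, ite_mul, zero_mul, Finset.sum_add_distrib, mul_assoc]
    simp

theorem contDiff_eval (p : MvPolynomial (Fin n) ℝ) : ContDiff ℝ 1 fun x => eval x p := by
  induction p using MvPolynomial.induction_on with
  | C r => simpa using contDiff_const
  | add p q hp hq =>
    simp only [map_add]
    exact hp.add hq
  | mul_X p j hp =>
    simp only [map_mul, eval_X]
    exact hp.mul (contDiff_apply ℝ ℝ j)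

theorem mem_vanishingIdeal_iff_eval {S : Set (Fin n → ℝ)} {p : MvPolynomial (Fin n) ℝ} :
    p ∈ vanishingIdeal ℝ S ↔ ∀ x ∈ S, eval x p = 0 := by
  simp [mem_vanishingIdeal_iff]

/-- Shrinking the open set enlarges the vanishing ideal; by noetherianity one can start from a
maximal one. -/
theorem exists_isOpen_vanishingIdeal_eq (X : Set (Fin n → ℝ)) {U : Set (Fin n → ℝ)}
    (hU : IsOpen U) (hne : (X ∩ U).Nonempty) :
    ∃ V ⊆ U, IsOpen V ∧ (X ∩ V).Nonempty ∧ ∀ V' ⊆ V, IsOpen V' → (X ∩ V').Nonempty →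
      vanishingIdeal ℝ (X ∩ V') = vanishingIdeal ℝ (X ∩ V) := by
  obtain ⟨I, ⟨V, hVU, hV, hVne, rfl⟩, hmax⟩ := set_has_maximal_iff_noetherian.mpr
    (inferInstance : IsNoetherian (MvPolynomial (Fin n) ℝ) (MvPolynomial (Fin n) ℝ))
    {I | ∃ V ⊆ U, IsOpen V ∧ (X ∩ V).Nonempty ∧ vanishingIdeal ℝ (X ∩ V) = I}
    ⟨_, U, subset_rfl, hU, hne, rfl⟩
  refine ⟨V, hVU, hV, hVne, fun V' hV'V hV' hne' => ?_⟩
  have hle := vanishingIdeal_anti_mono (k := ℝ) (Set.inter_subset_inter_right X hV'V)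
  by_contra hcon
  exact hmax _ ⟨V', hV'V.trans hVU, hV', hne', rfl⟩ (lt_of_le_of_ne hle (Ne.symm hcon))

/-- By maximality, a polynomial outside the ideal is nonzero somewhere on X in every smaller open
set that meets X, hence nonzero on a smaller neighbourhood. -/
theorem exists_isOpen_forall_ne_zero {X V : Set (Fin n → ℝ)} (hV : IsOpen V)
    (hne : (X ∩ V).Nonempty) (hmax : ∀ V' ⊆ V, IsOpen V' → (X ∩ V').Nonempty →
      vanishingIdeal ℝ (X ∩ V') = vanishingIdeal ℝ (X ∩ V)) (Q : Finset (MvPolynomial (Fin n) ℝ)) :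
    ∃ V' ⊆ V, IsOpen V' ∧ (X ∩ V').Nonempty ∧
      ∀ q ∈ Q, q ∉ vanishingIdeal ℝ (X ∩ V) → ∀ x ∈ V', eval x q ≠ 0 := by
  classical
  induction Q using Finset.induction_on with
  | empty => exact ⟨V, subset_rfl, hV, hne, by simp⟩
  | insert q Q _ ih =>
    obtain ⟨V', hV'V, hV', hne', hQ⟩ := ih
    by_cases hq : q ∈ vanishingIdeal ℝ (X ∩ V)
    · refine ⟨V', hV'V, hV', hne', fun q' hq' hq'I => ?_⟩
      rcases Finset.mem_insert.mp hq' with rfl | h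
      · exact absurd hq hq'I
      · exact hQ q' h hq'I
    · have hq2 := hq
      rw [← hmax V' hV'V hV' hne', mem_vanishingIdeal_iff_eval] at hq2
      push Not at hq2
      obtain ⟨x, hx, hxq⟩ := hq2
      refine ⟨V' ∩ {x | eval x q ≠ 0}, Set.inter_subset_left.trans hV'V,
        hV'.inter (isOpen_ne_fun (contDiff_eval q).continuous continuous_const),
        ⟨x, hx.1, hx.2, hxq⟩, fun q' hq' hq'I y hy => ?_⟩
      rcases Finset.mem_insert.mp hq' with rfl | h
      · exact hy.2
      · exact hQ q' h hq'I y hy.1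

/-- Along the path, generators of I satisfy a homogeneous linear differential system with bounded
coefficients, so zero initial values stay zero by Grönwall's inequality. -/
theorem eval_eq_zero_of_path {I : Ideal (MvPolynomial (Fin n) ℝ)} {γ γ' : ℝ → Fin n → ℝ}
    {δ : ℝ → ℝ} (hγ : ∀ t ∈ Set.Icc (0 : ℝ) 1, HasDerivAt γ (γ' t) t)
    (hδ : ContinuousOn δ (Set.Icc 0 1))
    (hI : ∀ g ∈ I, ∃ h ∈ I, ∀ t ∈ Set.Icc (0 : ℝ) 1,
      ∑ i, eval (γ t) (pderiv i g) * γ' t i = δ t * eval (γ t) h)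
    (h0 : ∀ g ∈ I, eval (γ 0) g = 0) : ∀ g ∈ I, eval (γ 1) g = 0 := by
  obtain ⟨s, hs⟩ := (isNoetherian_def.mp
    (inferInstance : IsNoetherian (MvPolynomial (Fin n) ℝ) (MvPolynomial (Fin n) ℝ))) I
  have hsI : ∀ g ∈ s, g ∈ I := fun g hg => hs ▸ Submodule.subset_span hg
  have hcoef : ∀ g : s, ∃ p : s → MvPolynomial (Fin n) ℝ, ∀ t ∈ Set.Icc (0 : ℝ) 1,
      ∑ i, eval (γ t) (pderiv i (g : MvPolynomial (Fin n) ℝ)) * γ' t i =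
        ∑ g' : s, δ t * eval (γ t) (p g') * eval (γ t) (g' : MvPolynomial (Fin n) ℝ) := by
    intro g
    obtain ⟨h, hh, hder⟩ := hI g (hsI g g.2)
    rw [← hs] at hh
    obtain ⟨p, hp⟩ := Submodule.mem_span_finset'.mp hh
    refine ⟨p, fun t ht => ?_⟩
    rw [hder t ht, ← hp, map_sum, Finset.mul_sum]
    exact Finset.sum_congr rfl fun g' _ => by rw [smul_eq_mul, map_mul, mul_assoc]
  choose p hp using hcoef
  have hγc : ContinuousOn γ (Set.Icc 0 1) := fun t ht => (hγ t ht).continuousAt.continuousWithinAt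
  have hcont : ∀ q : MvPolynomial (Fin n) ℝ, ContinuousOn (fun t => eval (γ t) q) (Set.Icc 0 1) :=
    fun q => (contDiff_eval q).continuous.comp_continuousOn hγc
  have hbd : ∀ g g' : s, ∃ K : ℝ, ∀ t ∈ Set.Icc (0 : ℝ) 1, ‖δ t * eval (γ t) (p g g')‖ ≤ K :=
    fun g g' => isCompact_Icc.exists_bound_of_continuousOn (hδ.mul (hcont _))
  choose K hK using hbd
  set G : ℝ → s → ℝ := fun t g => eval (γ t) (g : MvPolynomial (Fin n) ℝ) with hG
  have hGd : ∀ t ∈ Set.Icc (0 : ℝ) 1, HasDerivAt G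
      (fun g => ∑ g' : s, δ t * eval (γ t) (p g g') * G t g') t := by
    intro t ht
    refine hasDerivAt_pi.mpr fun g => ?_
    have h1 := (hasFDerivAt_eval (g : MvPolynomial (Fin n) ℝ) (γ t)).comp_hasDerivAt t (hγ t ht)
    rw [← hp g t ht]
    refine h1.congr_deriv ?_
    simp [sum_apply]
  have hzero := eq_zero_of_abs_deriv_le_mul_abs_self_of_eq_zero_right
    (K := ∑ g, ∑ g', |K g g'|)
    (f := G) (a := 0) (b := 1) (fun t ht => (hGd t ht).continuousAt.continuousWithinAt)
    (fun t ht => (hGd t (Set.Ico_subset_Icc_self ht)).hasDerivWithinAt)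
    (funext fun g => h0 g (hsI g g.2)) (fun t ht => by
      refine (pi_norm_le_iff_of_nonneg (by positivity)).mpr fun g => ?_
      refine (norm_sum_le _ _).trans ?_
      have h1 : ∑ g', |K g g'| ≤ ∑ g, ∑ g', |K g g'| :=
        Finset.single_le_sum (f := fun g => ∑ g', |K g g'|) (fun g _ => by positivity)
          (Finset.mem_univ g)
      refine le_trans ?_ (mul_le_mul_of_nonneg_right h1 (norm_nonneg _))
      rw [Finset.sum_mul]
      refine Finset.sum_le_sum fun g' _ => ?_
      rw [norm_mul]
      exact mul_le_mul ((hK g g' t (Set.Ico_subset_Icc_self ht)).trans (le_abs_self _))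
        (norm_le_pi_norm (G t) g') (norm_nonneg _) (abs_nonneg _))
  intro g hg
  rw [← hs] at hg
  obtain ⟨q, hq⟩ := Submodule.mem_span_finset'.mp hg
  rw [← hq, map_sum]
  refine Finset.sum_eq_zero fun g' _ => ?_
  rw [smul_eq_mul, map_mul]
  have : G 1 g' = 0 := congrFun (hzero 1 (by simp)) g'
  rw [show eval (γ 1) (g' : MvPolynomial (Fin n) ℝ) = G 1 g' from rfl, this, mul_zero]

/-- The Jacobian matrix of a tuple of polynomials. -/
noncomputable def jacobian (r : Fin n → MvPolynomial (Fin n) ℝ) :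
    Matrix (Fin n) (Fin n) (MvPolynomial (Fin n) ℝ) :=
  Matrix.of fun i m => pderiv m (r i)

/-- Cramer's rule. It expresses derivatives of g in the coordinates r through the Jacobians with one
row replaced by the gradient of g. -/
theorem sum_pderiv_mul_adjugate (r : Fin n → MvPolynomial (Fin n) ℝ) (g : MvPolynomial (Fin n) ℝ)
    (w : Fin n → MvPolynomial (Fin n) ℝ) :
    ∑ i, pderiv i g * ((jacobian r).adjugate.mulVec w) i =
      ∑ j, (jacobian (Function.update r j g)).det * w j := by
  have h1 : ∀ j, (jacobian (Function.update r j g)).det =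
      Matrix.vecMul (fun i => pderiv i g) (jacobian r).adjugate j := by
    intro j
    have h2 : jacobian (Function.update r j g) =
        (jacobian r).updateRow j fun i => pderiv i g := by
      ext a b
      by_cases h : a = j
      · subst h
        simp [jacobian]
      · simp [jacobian, h]
    rw [h2, ← Matrix.cramer_transpose_apply, Matrix.cramer_eq_adjugate_mulVec,
      ← Matrix.adjugate_transpose, Matrix.mulVec_transpose]
  change dotProduct _ _ = _
  rw [Matrix.dotProduct_mulVec]
  simp only [h1]
  rfl

end RegularPoints

section RegularPoints

open Filter Topology MvPolynomial

variable {n : ℕ}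

/-- Take as many members of I as possible among local coordinates r. If replacing a coordinate
outside S by g ∈ I still gave coordinates at some point of S₀, then S could be enlarged. The
coordinate functions with S empty start the search. -/
theorem exists_maximal_jacobian {S₀ : Set (Fin n → ℝ)} (hne : S₀.Nonempty)
    (I : Ideal (MvPolynomial (Fin n) ℝ)) :
    ∃ c ∈ S₀, ∃ (r : Fin n → MvPolynomial (Fin n) ℝ) (S : Finset (Fin n)), (∀ i ∈ S, r i ∈ I) ∧
      eval c (jacobian r).det ≠ 0 ∧ ∀ g ∈ I, ∀ j ∉ S, ∀ x ∈ S₀,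
        eval x (jacobian (Function.update r j g)).det = 0 := by
  set T : Set ℕ := {k | ∃ c ∈ S₀, ∃ (r : Fin n → MvPolynomial (Fin n) ℝ) (S : Finset (Fin n)),
    (∀ i ∈ S, r i ∈ I) ∧ eval c (jacobian r).det ≠ 0 ∧ S.card = k} with hT
  have hbdd : BddAbove T := by
    refine ⟨n, ?_⟩
    rintro k ⟨c, hc, r, S, -, -, rfl⟩
    simpa using S.card_le_univ
  have hTne : T.Nonempty := by
    obtain ⟨c, hc⟩ := hne
    refine ⟨0, c, hc, X, ∅, by simp, ?_, rfl⟩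
    have : jacobian (n := n) X = 1 := by
      ext1 i m
      simp [jacobian, pderiv_X, Matrix.one_apply, Pi.single_apply]
    rw [this]
    simp
  obtain ⟨c, hc, r, S, hS, hdet, hcard⟩ := Nat.sSup_mem hTne hbdd
  refine ⟨c, hc, r, S, hS, hdet, fun g hg j hj x hx => ?_⟩
  by_contra hcon
  have : (insert j S).card ≤ sSup T := by
    refine le_csSup hbdd ⟨x, hx, _, insert j S, fun i hi => ?_, hcon, rfl⟩
    by_cases hij : i = j
    · subst hij
      simpa using hg
    · rw [Function.update_of_ne hij]
      exact hS i (Finset.mem_of_mem_insert_of_ne hi hij)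
  rw [Finset.card_insert_of_notMem hj] at this
  omega

/-- The linear map given by the Jacobian matrix at a point. -/
noncomputable def jacobianAt (r : Fin n → MvPolynomial (Fin n) ℝ) (x : Fin n → ℝ) :
    (Fin n → ℝ) →L[ℝ] Fin n → ℝ :=
  LinearMap.toContinuousLinearMap (Matrix.toLin' ((jacobian r).map (eval x)))

theorem hasFDerivAt_eval_pi (r : Fin n → MvPolynomial (Fin n) ℝ) (x : Fin n → ℝ) :
    HasFDerivAt (fun x i => eval x (r i)) (jacobianAt r x) x := by
  refine hasFDerivAt_pi'.mpr fun i => (hasFDerivAt_eval (r i) x).congr_fderiv ?_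
  ext1 v
  simp [jacobianAt, jacobian, Matrix.mulVec, dotProduct, sum_apply]

theorem sum_eval_pderiv_mul_eq {r : Fin n → MvPolynomial (Fin n) ℝ} {x v w : Fin n → ℝ}
    (hv : jacobianAt r x v = w) (hdet : eval x (jacobian r).det ≠ 0)
    (g : MvPolynomial (Fin n) ℝ) :
    ∑ i, eval x (pderiv i g) * v i = (eval x (jacobian r).det)⁻¹ *
      eval x (∑ j, (jacobian (Function.update r j g)).det * C (w j)) := by
  set M := (jacobian r).map (eval x) with hM
  have hMv : M.mulVec v = w := hv
  have hMd : M.det = eval x (jacobian r).det := ((eval x).map_det (jacobian r)).symm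
  have h1 : M.adjugate.mulVec w = eval x (jacobian r).det • v := by
    rw [← hMv, Matrix.mulVec_mulVec, Matrix.adjugate_mul, Matrix.smul_mulVec, Matrix.one_mulVec,
      hMd]
  rw [← sum_pderiv_mul_adjugate r g (fun j => C (w j)), map_sum, Finset.mul_sum]
  refine Finset.sum_congr rfl fun i _ => ?_
  have h2 : eval x (((jacobian r).adjugate.mulVec fun j => C (w j)) i) =
      eval x (jacobian r).det * v i := by
    rw [RingHom.map_mulVec]
    have h3 := congrFun h1 i
    rw [hM, ← RingHom.mapMatrix_apply, ← RingHom.map_adjugate] at h3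
    rw [← smul_eq_mul, ← Pi.smul_apply, ← h3]
    have h4 : (⇑(eval x) ∘ fun j => C (w j)) = w := _root_.funext fun j => by simp
    rw [h4]
    rfl
  rw [map_mul, h2]
  field_simp

/-- In the coordinates r, points of X near c lie in the subspace W where the coordinates in S
vanish. Conversely, a nearby point over W is joined to c by the lift of a segment. By
`eval_eq_zero_of_path` members of I remain 0 along it, while members of Q outside I keep their sign
near c. The point therefore has the same signs as c and lies in X. -/
theorem exists_hasC1ChartAt {X : Set (Fin n → ℝ)} (Q : Finset (MvPolynomial (Fin n) ℝ))
    (hX : ∀ x x', (∀ q ∈ Q, SignType.sign (eval x q) = SignType.sign (eval x' q)) →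
      (x ∈ X ↔ x' ∈ X)) {U : Set (Fin n → ℝ)} (hU : IsOpen U) (hne : (X ∩ U).Nonempty) :
    ∃ c ∈ X ∩ U, ∃ e, HasC1ChartAt e X c := by
  obtain ⟨V, hVU, hV, hVne, hmax⟩ := exists_isOpen_vanishingIdeal_eq X hU hne
  obtain ⟨V', hV'V, hV', hV'ne, hQ⟩ := exists_isOpen_forall_ne_zero hV hVne hmax Q
  set I := vanishingIdeal ℝ (X ∩ V) with hI
  obtain ⟨c, hc, r, S, hrS, hdet, hsat⟩ := exists_maximal_jacobian hV'ne I
  have hcI : ∀ g ∈ I, eval c g = 0 := fun g hg =>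
    mem_vanishingIdeal_iff_eval.mp hg c ⟨hc.1, hV'V hc.2⟩
  have hsat' : ∀ g ∈ I, ∀ j ∉ S, (jacobian (Function.update r j g)).det ∈ I := by
    intro g hg j hj
    rw [← hmax V' hV'V hV' hV'ne, mem_vanishingIdeal_iff_eval]
    exact hsat g hg j hj
  set f : (Fin n → ℝ) → Fin n → ℝ := fun x i => eval x (r i) with hf
  have hfc : ContDiff ℝ 1 f := contDiff_pi.mpr fun i => contDiff_eval (r i)
  have hdet' : (jacobianAt r c).det ≠ 0 := by
    change LinearMap.det (Matrix.toLin' ((jacobian r).map (eval c))) ≠ 0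
    rw [LinearMap.det_toLin', ← RingHom.mapMatrix_apply, ← RingHom.map_det]
    exact hdet
  have hfd : HasFDerivAt f ((jacobianAt r c).toContinuousLinearEquivOfDetNeZero hdet' :
      (Fin n → ℝ) →L[ℝ] Fin n → ℝ) c := by
    rw [ContinuousLinearMap.coe_toContinuousLinearEquivOfDetNeZero]
    exact hasFDerivAt_eval_pi r c
  set e := hfc.contDiffAt.toOpenPartialHomeomorph f hfd one_ne_zero with he
  have hec : c ∈ e.source := ContDiffAt.mem_toOpenPartialHomeomorph_source _ hfd one_ne_zero
  have hsymm : ContDiffAt ℝ 1 e.symm (f c) := hfc.contDiffAt.to_localInverse hfd one_ne_zero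
  have hsymmc : e.symm (f c) = c := e.left_inv hec
  have htend : Tendsto e.symm (𝓝 (f c)) (𝓝 c) := by
    have := hsymm.continuousAt.tendsto
    rwa [hsymmc] at this
  have hsign : ∀ᶠ x in 𝓝 c, ∀ q ∈ Q, q ∉ I →
      SignType.sign (eval x q) = SignType.sign (eval c q) := by
    refine (Finset.eventually_all Q).mpr fun q hq => ?_
    by_cases hqI : q ∈ I
    · exact Eventually.of_forall fun x h => absurd hqI h
    have h1 : ContinuousAt (fun x => SignType.sign (eval x q)) c :=
      ContinuousAt.comp (continuousAt_sign_of_ne_zero (hQ q hq hqI c hc.2))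
        (contDiff_eval q).continuous.continuousAt
    filter_upwards [h1.tendsto.eventually ((isOpen_discrete
      {SignType.sign (eval c q)}).mem_nhds rfl)] with x hx _ using hx
  have hD : ∀ᶠ x in 𝓝 c, eval x (jacobian r).det ≠ 0 :=
    (contDiff_eval _).continuous.continuousAt.eventually_ne hdet
  have hall := ((e.open_target.eventually_mem (e.map_source hec)).and
    ((hsymm.eventually (by simp)).and (htend.eventually
      ((hV'.eventually_mem hc.2).and (hsign.and hD)))))
  obtain ⟨ε, hε, hball⟩ := Metric.eventually_nhds_iff_ball.mp hall
  let W : Submodule ℝ (Fin n → ℝ) :=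
    { carrier := {w | ∀ i ∈ S, w i = 0}
      add_mem' := fun {a b} ha hb i hi => by simp [ha i hi, hb i hi]
      zero_mem' := fun i _ => rfl
      smul_mem' := fun t a ha i hi => by simp [ha i hi] }
  have hWmem : ∀ w, w ∈ W ↔ ∀ i ∈ S, w i = 0 := fun w => Iff.rfl
  refine ⟨c, ⟨hc.1, hVU (hV'V hc.2)⟩, Module.finrank ℝ W,
    (e.symm.restrOpen (Metric.ball (f c) ε) Metric.isOpen_ball).symm, W, ?_, ?_, ?_, rfl, ?_⟩
  · have h := (e.symm.restrOpen (Metric.ball (f c) ε) Metric.isOpen_ball).map_source (x := f c)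
      ⟨e.map_source hec, Metric.mem_ball_self hε⟩
    change e.symm (f c) ∈ _ at h
    rwa [hsymmc] at h
  · exact hfc.contDiffOn
  · rintro z ⟨-, hz⟩
    exact (hball z hz).2.1.contDiffWithinAt
  · intro x hx
    have hx1 : f x ∈ e.target ∧ f x ∈ Metric.ball (f c) ε :=
      (e.symm.restrOpen (Metric.ball (f c) ε) Metric.isOpen_ball).map_target hx
    have hxs : e.symm (f x) = x :=
      (e.symm.restrOpen (Metric.ball (f c) ε) Metric.isOpen_ball).right_inv hx
    change x ∈ X ↔ f x ∈ W
    have hxb := hball (f x) hx1.2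
    rw [hxs] at hxb
    obtain ⟨-, -, hxV', hxsign, -⟩ := hxb
    constructor
    · intro hxX i hi
      exact mem_vanishingIdeal_iff_eval.mp (hrS i hi) x ⟨hxX, hV'V hxV'⟩
    · intro hxW
      set w := f x - f c with hw
      have hwW : w ∈ W := W.sub_mem hxW fun i hi => hcI _ (hrS i hi)
      have hzball : ∀ t ∈ Set.Icc (0 : ℝ) 1, f c + t • w ∈ Metric.ball (f c) ε := by
        intro t ht
        have hxb := hx1.2
        rw [Metric.mem_ball, dist_eq_norm, ← hw] at hxb
        rw [Metric.mem_ball, dist_eq_norm, add_sub_cancel_left, norm_smul,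
          Real.norm_of_nonneg ht.1]
        exact (mul_le_of_le_one_left (norm_nonneg _) ht.2).trans_lt hxb
      have hzd : ∀ t : ℝ, HasDerivAt (fun t : ℝ => f c + t • w) w t := fun t => by
        simpa using ((hasDerivAt_id t).smul_const w).const_add (f c)
      set γ : ℝ → Fin n → ℝ := fun t => e.symm (f c + t • w) with hγ
      set γ' : ℝ → Fin n → ℝ := fun t => fderiv ℝ e.symm (f c + t • w) w with hγ'
      have hγd : ∀ t ∈ Set.Icc (0 : ℝ) 1, HasDerivAt γ (γ' t) t := fun t ht =>
        ((hball _ (hzball t ht)).2.1.differentiableAt one_ne_zero).hasFDerivAt.comp_hasDerivAt t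
          (hzd t)
      have hJ : ∀ t ∈ Set.Icc (0 : ℝ) 1, jacobianAt r (γ t) (γ' t) = w := by
        intro t ht
        have h1 := (hasFDerivAt_eval_pi r (γ t)).comp_hasDerivAt t (hγd t ht)
        refine h1.unique ((hzd t).congr_of_eventuallyEq ?_)
        have h2 := (hzd t).continuousAt.tendsto.eventually
          (Metric.isOpen_ball.mem_nhds (hzball t ht))
        filter_upwards [h2] with t' ht'
        exact e.right_inv (hball _ ht').1
      have hdet0 : ∀ t ∈ Set.Icc (0 : ℝ) 1, eval (γ t) (jacobian r).det ≠ 0 := fun t ht =>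
        (hball _ (hzball t ht)).2.2.2.2
      have hγ0 : γ 0 = c := by simp only [hγ, zero_smul, add_zero, hsymmc]
      have hγ1 : γ 1 = x := by simp only [hγ, one_smul, hw, add_sub_cancel, hxs]
      have hvan := eval_eq_zero_of_path (I := I) (δ := fun t => (eval (γ t) (jacobian r).det)⁻¹)
        hγd (ContinuousOn.inv₀ ((contDiff_eval _).continuous.comp_continuousOn fun t ht =>
          (hγd t ht).continuousAt.continuousWithinAt) hdet0)
        -- For j in S the factor w j is 0; for j outside S the modified Jacobian vanishes on X and
        -- thus belongs to I. This provides the linear system for I.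
        (fun g hg => ⟨∑ j, (jacobian (Function.update r j g)).det * C (w j), by
          refine I.sum_mem fun j _ => ?_
          by_cases hj : j ∈ S
          · rw [(hWmem w).mp hwW j hj, C_0, mul_zero]
            exact I.zero_mem
          · exact I.mul_mem_right _ (hsat' g hg j hj), fun t ht =>
            sum_eval_pderiv_mul_eq (hJ t ht) (hdet0 t ht) g⟩)
        (by rw [hγ0]; exact hcI)
      rw [hγ1] at hvan
      refine (hX x c fun q hq => ?_).mpr hc.1
      by_cases hqI : q ∈ I
      · rw [hvan q hqI, hcI q hqI]
      · exact hxsign q hq hqI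

end RegularPoints

/-! ### Comparison of the order and the valuation -/

/-- The sum of the squares of the coordinates. -/
def sqNorm {K : Type} [Semiring K] {n : ℕ} (z : Fin n → K) : K := ∑ i, z i * z i

theorem sqNorm_zero {K : Type} [Semiring K] {n : ℕ} : sqNorm (0 : Fin n → K) = 0 := by
  simp [sqNorm]

section SqNorm

variable {K : Type} [Field K] [LinearOrder K] [IsStrictOrderedRing K] {n : ℕ}

theorem sqNorm_nonneg (z : Fin n → K) : 0 ≤ sqNorm z :=
  Finset.sum_nonneg fun i _ => mul_self_nonneg (z i)

theorem mul_self_le_sqNorm (z : Fin n → K) (i : Fin n) : z i * z i ≤ sqNorm z :=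
  Finset.single_le_sum (f := fun i => z i * z i) (fun i _ => mul_self_nonneg (z i))
    (Finset.mem_univ i)

theorem eq_zero_of_sqNorm_le_zero {z : Fin n → K} (h : sqNorm z ≤ 0) : z = 0 := by
  funext i
  exact mul_self_eq_zero.mp (le_antisymm ((mul_self_le_sqNorm z i).trans h) (mul_self_nonneg _))

theorem sqNorm_add_le (z w : Fin n → K) : sqNorm (z + w) ≤ 2 * sqNorm z + 2 * sqNorm w := by
  simp only [sqNorm, Finset.mul_sum, ← Finset.sum_add_distrib]
  refine Finset.sum_le_sum fun i _ => ?_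
  have := mul_self_nonneg (z i - w i)
  simp only [Pi.add_apply]
  linarith

end SqNorm

theorem toStarHom_pos_iff {r : ℝ} : 0 < toStarHom r ↔ 0 < r := toStar_pos_iff

theorem val_toStarHom {r : ℝ} (hr : r ≠ 0) : val (toStarHom r) = 0 :=
  HahnSeries.orderTop_single hr

theorem le_toStarHom_of_val_pos {q : RStar} (hq : 0 < val q) {ε : ℝ} (hε : 0 < ε) :
    q < toStarHom ε := by
  rw [← val_toStarHom hε.ne'] at hq
  have : |q| < |toStarHom ε| := HahnSeries.abs_lt_abs_of_orderTop_ofLex hq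
  rw [abs_of_pos (toStarHom_pos_iff.mpr hε)] at this
  exact (le_abs_self q).trans_lt this

theorem exists_val_sub_toStarHom_pos {q : RStar} (hq : 0 ≤ val q) :
    ∃ r : ℝ, 0 < val (q - toStarHom r) := by
  refine ⟨(ofLex q).coeff 0, ?_⟩
  by_contra hcon
  obtain ⟨g, hg⟩ : ∃ g : ℚ, val (q - toStarHom ((ofLex q).coeff 0)) = g := by
    refine WithTop.ne_top_iff_exists.mp ?_ |>.imp fun g hg => hg.symm
    exact ne_top_of_le_ne_top (by simp) (not_lt.mp hcon)
  have h1 := HahnSeries.coeff_orderTop_ne hg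
  rw [hg, not_lt] at hcon
  have hg0 : g ≤ 0 := by exact_mod_cast hcon
  apply h1
  have h2 : (ofLex (q - toStarHom ((ofLex q).coeff 0))).coeff g =
    (ofLex q).coeff g - (HahnSeries.single (0 : ℚ) ((ofLex q).coeff 0)).coeff g := rfl
  change (ofLex (q - toStarHom ((ofLex q).coeff 0))).coeff g = 0
  rw [h2]
  rcases hg0.eq_or_lt with rfl | hlt
  · simp
  · rw [HahnSeries.coeff_single_of_ne hlt.ne, sub_zero]
    exact HahnSeries.coeff_eq_zero_of_lt_orderTop ((WithTop.coe_lt_coe.mpr hlt).trans_le hq)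

theorem exists_le_toStarHom {q : RStar} (hq : 0 ≤ val q) : ∃ C > 0, q ≤ toStarHom C := by
  obtain ⟨r, hr⟩ := exists_val_sub_toStarHom_pos hq
  refine ⟨|r| + 1, by positivity, ?_⟩
  have h1 := le_toStarHom_of_val_pos hr one_pos
  have h2 : toStarHom r ≤ toStarHom |r| := by
    rw [← sub_nonneg, ← map_sub]
    rcases (sub_nonneg.mpr (le_abs_self r)).eq_or_lt with h | h
    · rw [← h, map_zero]
    · exact (toStarHom_pos_iff.mpr h).le
  rw [map_add]
  linarith [sub_lt_iff_lt_add.mp h1]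

/-- Positive valuation is rewritten through the order and a polynomial norm, so that it can interact
with first-order transfer. For the converse, a coordinate of nonpositive valuation has inverse
square bounded by a real C, which bounds the norm below by 1/C. -/
theorem val_pos_iff_forall_lt {n : ℕ} {z : Fin n → RStar} :
    0 < tupleVal val z ↔ ∀ ε > 0, sqNorm z < toStarHom ε := by
  constructor
  · intro h ε hε
    refine le_toStarHom_of_val_pos (val.map_lt_sum' (WithTop.coe_lt_top 0) fun i _ => ?_) hε
    rw [val.map_mul]
    have := h.trans_le (tupleVal_le val z i)
    exact this.trans_le (le_add_of_nonneg_left this.le)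
  · intro h
    rw [tupleVal, Finset.lt_inf_iff (WithTop.coe_lt_top 0)]
    intro i _
    by_contra hcon
    have hcon := not_lt.mp hcon
    have hz : z i ≠ 0 := by
      intro h0
      rw [h0, val.map_zero] at hcon
      exact absurd hcon (by simp)
    have hq : 0 ≤ val ((z i)⁻¹ * (z i)⁻¹) := by
      have h1 : val (z i)⁻¹ + val (z i) = 0 := by
        rw [← val.map_mul, inv_mul_cancel₀ hz, val.map_one]
      have h2 : 0 ≤ val (z i)⁻¹ := by
        by_contra hneg
        refine absurd h1 (lt_of_le_of_lt (add_le_add_right hcon _) ?_).ne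
        rw [add_zero]
        exact not_le.mp hneg
      rw [val.map_mul]
      exact add_nonneg h2 h2
    obtain ⟨C, hC, hle⟩ := exists_le_toStarHom hq
    have h1 := h C⁻¹ (inv_pos.mpr hC)
    have h2 : (z i)⁻¹ * (z i)⁻¹ * (z i * z i) ≤ toStarHom C * sqNorm z :=
      mul_le_mul hle (mul_self_le_sqNorm z i) (mul_self_nonneg _) (toStarHom_pos_iff.mpr hC).le
    have h3 : toStarHom C * sqNorm z < toStarHom C * toStarHom C⁻¹ :=
      mul_lt_mul_of_pos_left h1 (toStarHom_pos_iff.mpr hC)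
    rw [← map_mul, mul_inv_cancel₀ hC.ne', map_one] at h3
    have h4 : (z i)⁻¹ * (z i)⁻¹ * (z i * z i) = 1 := by field_simp
    rw [h4] at h2
    exact absurd (h2.trans_lt h3) (lt_irrefl _)

theorem exists_val_eq_tupleVal {n : ℕ} {w : Fin n → RStar} (hw : w ≠ 0) :
    ∃ b : RStar, b ≠ 0 ∧ val b = tupleVal val w ∧ b * b ≤ sqNorm w := by
  obtain ⟨i₀, -⟩ := Function.ne_iff.mp hw
  obtain ⟨j, -, hj⟩ := Finset.exists_mem_eq_inf Finset.univ ⟨i₀, Finset.mem_univ i₀⟩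
    fun i => val (w i)
  refine ⟨w j, ?_, hj.symm, mul_self_le_sqNorm w j⟩
  intro h0
  rw [h0, val.map_zero] at hj
  exact hw (tupleVal_val_eq_top_iff.mp hj)

theorem sqNorm_eq_mul_sqNorm_inv_mul {n : ℕ} {b : RStar} (hb : b ≠ 0) (z : Fin n → RStar) :
    sqNorm z = b * b * sqNorm fun i => b⁻¹ * z i := by
  simp only [sqNorm, Finset.mul_sum]
  refine Finset.sum_congr rfl fun i _ => ?_
  field_simp

theorem le_tupleVal_mul {n : ℕ} (b : RStar) (z : Fin n → RStar) :
    val b + tupleVal val z ≤ tupleVal val fun i => b * z i :=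
  le_tupleVal_iff.mpr fun i => by
    rw [val.map_mul]
    exact add_le_add_right (tupleVal_le val z i) _

/-- Divide z by a coordinate b of w of least valuation; the result is infinitesimal, and b² is at
most the square norm of w. -/
theorem sqNorm_lt_of_tupleVal_lt {n : ℕ} {z w : Fin n → RStar}
    (h : tupleVal val w < tupleVal val z) {ε : ℝ} (hε : 0 < ε) :
    sqNorm z < toStarHom ε * sqNorm w := by
  have hw : w ≠ 0 := fun h0 => by
    rw [h0, tupleVal_zero] at h
    exact not_top_lt h
  obtain ⟨b, hb, hbv, hbw⟩ := exists_val_eq_tupleVal hw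
  have h1 : 0 < tupleVal val fun i => b⁻¹ * z i := by
    by_contra hcon
    have h2 := (le_tupleVal_mul b⁻¹ z).trans (not_lt.mp hcon)
    have h3 := add_le_add_right h2 (val b)
    rw [← add_assoc, ← val.map_mul, mul_inv_cancel₀ hb, val.map_one, zero_add, add_zero, hbv] at h3
    exact absurd h (not_lt.mpr h3)
  have h2 := val_pos_iff_forall_lt.mp h1 ε hε
  have hbb : 0 < b * b := mul_self_pos.mpr hb
  calc sqNorm z = b * b * sqNorm (fun i => b⁻¹ * z i) := sqNorm_eq_mul_sqNorm_inv_mul hb z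
    _ < b * b * toStarHom ε := mul_lt_mul_of_pos_left h2 hbb
    _ = toStarHom ε * (b * b) := mul_comm _ _
    _ ≤ _ := mul_le_mul_of_nonneg_left hbw (toStarHom_pos_iff.mpr hε).le

theorem exists_sqNorm_le_of_tupleVal_le {n : ℕ} {z w : Fin n → RStar}
    (h : tupleVal val w ≤ tupleVal val z) : ∃ C > 0, sqNorm z ≤ toStarHom C * sqNorm w := by
  by_cases hw : w = 0
  · rw [hw, tupleVal_zero, top_le_iff, tupleVal_val_eq_top_iff] at h
    exact ⟨1, one_pos, by rw [h, hw, sqNorm_zero, mul_zero]⟩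
  obtain ⟨b, hb, hbv, hbw⟩ := exists_val_eq_tupleVal hw
  have h1 : 0 ≤ tupleVal val fun i => b⁻¹ * z i := by
    have h2 := add_le_add_right h (val b⁻¹)
    rw [← hbv, ← val.map_mul, inv_mul_cancel₀ hb, val.map_one] at h2
    exact h2.trans (le_tupleVal_mul b⁻¹ z)
  have h2 : 0 ≤ val (sqNorm (fun i => b⁻¹ * z i)) := by
    refine val.map_le_sum fun i _ => ?_
    rw [val.map_mul]
    have := h1.trans (tupleVal_le val (fun i => b⁻¹ * z i) i)
    exact add_nonneg this this
  obtain ⟨C, hC, hle⟩ := exists_le_toStarHom h2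
  have hbb : 0 < b * b := mul_self_pos.mpr hb
  refine ⟨C, hC, ?_⟩
  calc sqNorm z = b * b * sqNorm (fun i => b⁻¹ * z i) := sqNorm_eq_mul_sqNorm_inv_mul hb z
    _ ≤ b * b * toStarHom C := mul_le_mul_of_nonneg_left hle hbb.le
    _ = toStarHom C * (b * b) := mul_comm _ _
    _ ≤ _ := mul_le_mul_of_nonneg_left hbw (toStarHom_pos_iff.mpr hC).le

theorem tupleVal_lt_of_forall_sqNorm_le {n : ℕ} {z w : Fin n → RStar} (hw : w ≠ 0)
    (h : ∀ ε > 0, sqNorm z ≤ toStarHom ε * sqNorm w) : tupleVal val w < tupleVal val z := by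
  by_contra hcon
  obtain ⟨C, hC, hle⟩ := exists_sqNorm_le_of_tupleVal_le (not_lt.mp hcon)
  -- This choice bounds the square norm of w by half of itself.
  have h1 := h (1 / (2 * C)) (by positivity)
  have h2 : toStarHom C * sqNorm z ≤ toStarHom C * (toStarHom (1 / (2 * C)) * sqNorm w) :=
    mul_le_mul_of_nonneg_left h1 (toStarHom_pos_iff.mpr hC).le
  have h3 : C * (1 / (2 * C)) = 2⁻¹ := by field_simp
  have h4 : toStarHom (2⁻¹ : ℝ) = (2 : RStar)⁻¹ := by rw [map_inv₀, map_ofNat]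
  rw [← mul_assoc, ← map_mul, h3, h4] at h2
  refine hw (eq_zero_of_sqNorm_le_zero ?_)
  linarith [hle.trans h2]

theorem tupleVal_le_of_sqNorm_le {n : ℕ} {z w : Fin n → RStar} {C : ℝ}
    (h : sqNorm z ≤ toStarHom C * sqNorm w) : tupleVal val w ≤ tupleVal val z := by
  by_contra hcon
  have hcon := not_le.mp hcon
  have hC : C ≤ |C| + 1 := (le_abs_self C).trans (by linarith)
  have h0 : 0 < |C| + 1 := by positivity
  have h1 := sqNorm_lt_of_tupleVal_lt hcon (ε := 1 / (|C| + 1)) (by positivity)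
  have h2 : toStarHom C ≤ toStarHom (|C| + 1) := by
    rw [← sub_nonneg, ← map_sub]
    exact (toStarHom_pos_iff.mpr (by linarith [le_abs_self C] : 0 < |C| + 1 - C)).le
  have h3 : sqNorm z ≤ toStarHom (|C| + 1) * sqNorm w :=
    h.trans (mul_le_mul_of_nonneg_right h2 (sqNorm_nonneg w))
  have h4 := mul_lt_mul_of_pos_left h1 (toStarHom_pos_iff.mpr h0 : 0 < toStarHom (|C| + 1))
  rw [← mul_assoc, ← map_mul, mul_one_div_cancel h0.ne', map_one, one_mul] at h4
  exact absurd (h3.trans_lt h4) (lt_irrefl _)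

/-- A positive infinitesimal. -/
noncomputable def infinitesimal : RStar := toLex (HahnSeries.single 1 1)

theorem infinitesimal_pos : 0 < infinitesimal := by
  rw [← HahnSeries.leadingCoeff_pos_iff]
  simp [infinitesimal]

theorem infinitesimal_lt {ε : ℝ} (hε : 0 < ε) : infinitesimal < toStarHom ε := by
  refine le_toStarHom_of_val_pos ?_ hε
  rw [show val infinitesimal = ((1 : ℚ) : WithTop ℚ) from HahnSeries.orderTop_single one_ne_zero]
  exact_mod_cast one_pos

theorem mem_infNhd_iff {n : ℕ} {a : Fin n → ℝ} {y : Fin n → RStar} :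
    y ∈ infNhd a ↔ 0 < tupleVal val (y - fun i => toStarHom (a i)) := Iff.rfl

theorem mem_infNhd_of_sqNorm_lt {n : ℕ} {a : Fin n → ℝ} {y : Fin n → RStar}
    (h : sqNorm (y - fun i => toStarHom (a i)) < infinitesimal) : y ∈ infNhd a :=
  mem_infNhd_iff.mpr (val_pos_iff_forall_lt.mpr fun _ hε => h.trans (infinitesimal_lt hε))

theorem sqNorm_lt_of_mem_infNhd {n : ℕ} {a : Fin n → ℝ} {y : Fin n → RStar} (h : y ∈ infNhd a)
    {ε : ℝ} (hε : 0 < ε) : sqNorm (y - fun i => toStarHom (a i)) < toStarHom ε :=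
  val_pos_iff_forall_lt.mp (mem_infNhd_iff.mp h) ε hε

/-! ### Extension of scalars -/

section Extend

variable {n : ℕ}

/-- The linear map over `F` given by the matrix of a real linear map. -/
noncomputable def extend (F : RealClosedExt) (P : (Fin n → ℝ) →L[ℝ] Fin n → ℝ) :
    (Fin n → F.carrier) →ₗ[F.carrier] Fin n → F.carrier :=
  Matrix.toLin' ((LinearMap.toMatrix' (P : (Fin n → ℝ) →ₗ[ℝ] Fin n → ℝ)).map F.const)

theorem extend_apply (F : RealClosedExt) (P : (Fin n → ℝ) →L[ℝ] Fin n → ℝ)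
    (x : Fin n → F.carrier) (i : Fin n) :
    extend F P x i = ∑ j, F.const (P (Pi.single j 1) i) * x j := by
  simp [extend, Matrix.mulVec, dotProduct, LinearMap.toMatrix'_apply]

theorem IsPolynomialFn.extend {σ : Type} (P : (Fin n → ℝ) →L[ℝ] Fin n → ℝ)
    {f : ∀ F : RealClosedExt, (σ → F.carrier) → Fin n → F.carrier}
    (hf : ∀ i, IsPolynomialFn fun F x => f F x i) (i : Fin n) :
    IsPolynomialFn fun F x => extend F P (f F x) i := by
  simp only [extend_apply]
  exact .sum _ fun j => (IsPolynomialFn.const _).mul (hf j)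

theorem extend_extend (F : RealClosedExt) {P : (Fin n → ℝ) →L[ℝ] Fin n → ℝ}
    (hP : ∀ x, P (P x) = P x) (x : Fin n → F.carrier) :
    extend F P (extend F P x) = extend F P x := by
  have h1 : (P : (Fin n → ℝ) →ₗ[ℝ] Fin n → ℝ) ∘ₗ (P : (Fin n → ℝ) →ₗ[ℝ] Fin n → ℝ) =
      (P : (Fin n → ℝ) →ₗ[ℝ] Fin n → ℝ) := LinearMap.ext hP
  have h2 := congrArg LinearMap.toMatrix' h1
  rw [LinearMap.toMatrix'_comp] at h2
  have h3 := congrArg (fun M : Matrix (Fin n) (Fin n) ℝ => M.map F.const) h2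
  simp only [Matrix.map_mul] at h3
  rw [extend, Matrix.toLin'_apply, Matrix.toLin'_apply, Matrix.mulVec_mulVec, h3]

theorem extend_const (F : RealClosedExt) (P : (Fin n → ℝ) →L[ℝ] Fin n → ℝ) (x : Fin n → ℝ) :
    extend F P (fun i => F.const (x i)) = fun i => F.const (P x i) := by
  funext i
  rw [extend_apply]
  have h1 : P x = ∑ j, x j • P (Pi.single j 1) := by
    conv_lhs => rw [pi_eq_sum_univ' x, map_sum]
    simp
  simp only [← map_mul, ← map_sum]
  congr 1
  rw [h1]
  simp [mul_comm]

theorem extend_realField (P : (Fin n → ℝ) →L[ℝ] Fin n → ℝ) (x : Fin n → ℝ) :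
    extend realField P x = P x :=
  extend_const realField P x

/-- The rank of a projection is its trace in characteristic 0, and the trace commutes with extension
of scalars. -/
theorem finrank_range_extend (F : RealClosedExt) {P : (Fin n → ℝ) →L[ℝ] Fin n → ℝ}
    (hP : ∀ x, P (P x) = P x) : Module.finrank F.carrier (LinearMap.range (extend F P)) =
      Module.finrank ℝ (LinearMap.range (P : (Fin n → ℝ) →ₗ[ℝ] Fin n → ℝ)) := by
  have h1 := (LinearMap.isProj_range_iff_isIdempotentElem
    (P : (Fin n → ℝ) →ₗ[ℝ] Fin n → ℝ)).mpr (LinearMap.ext hP)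
  have h2 := (LinearMap.isProj_range_iff_isIdempotentElem
    (extend F P)).mpr (LinearMap.ext (extend_extend F hP))
  have h3 := h1.trace
  have h4 := h2.trace
  have h5 : LinearMap.trace _ _ (extend F P) =
      F.const (LinearMap.trace _ _ (P : (Fin n → ℝ) →ₗ[ℝ] Fin n → ℝ)) := by
    rw [extend, Matrix.trace_toLin'_eq, LinearMap.trace_eq_matrix_trace ℝ (Pi.basisFun ℝ (Fin n)),
      Matrix.trace, Matrix.trace, map_sum]
    rfl
  rw [h3, h4, map_natCast] at h5
  exact_mod_cast h5

theorem tupleVal_le_extend (P : (Fin n → ℝ) →L[ℝ] Fin n → ℝ) (x : Fin n → RStar) :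
    tupleVal val x ≤ tupleVal val (extend starField P x) := by
  refine le_tupleVal_iff.mpr fun i => ?_
  rw [extend_apply]
  refine val.map_le_sum fun j _ => ?_
  rw [val.map_mul]
  refine (tupleVal_le val x j).trans (le_add_of_nonneg_left ?_)
  by_cases h : P (Pi.single j 1) i = 0
  · rw [h, map_zero, val.map_zero]
    exact le_top
  · exact (val_toStarHom h).ge

end Extend

/-! ### First-order forms of the conditions on tangent spaces -/

theorem IsPolynomialFn.sqNorm {σ : Type} {m : ℕ}
    {f : ∀ F : RealClosedExt, (σ → F.carrier) → Fin m → F.carrier}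
    (hf : ∀ i, IsPolynomialFn fun F x => f F x i) :
    IsPolynomialFn fun F x => sqNorm (f F x) :=
  .sum _ fun i => (hf i).mul (hf i)

section Transfer

variable {B : ∀ F : RealClosedExt, F.carrier → Prop}

theorem transfer_of_real (hB : IsSemialgebraic (σ := Unit) fun F z => B F (z ())) {r : ℝ}
    (h : B realField r) : B starField (toStarHom r) :=
  (hB.transfer fun _ => r).mp h

theorem exists_pos_transfer (hB : IsSemialgebraic (σ := Unit) fun F z => B F (z ())) :
    (∃ r : ℝ, 0 < r ∧ B realField r) ↔ ∃ r : RStar, 0 < r ∧ B starField r := by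
  have h : IsSemialgebraic (σ := Empty) fun F _ => ∃ r, 0 < r ∧ B F r := by
    refine .exists_one (A := fun F _ r => 0 < r ∧ B F r) (.and (.pos (.var none)) ?_)
    exact hB.comp (f := fun F z _ => z none) fun _ => .var none
  exact h.transfer Empty.elim

/-- The existence of a positive radius is a sentence, so an infinitesimal radius over ℝ* yields a
real radius over ℝ. -/
theorem exists_pos_real_of_infinitesimal
    (hB : IsSemialgebraic (σ := Unit) fun F z => B F (z ())) (h : B starField infinitesimal) :
    ∃ r : ℝ, 0 < r ∧ B realField r :=
  (exists_pos_transfer hB).mpr ⟨_, infinitesimal_pos, h⟩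

theorem star_infinitesimal_of_forall_real
    (hB : IsSemialgebraic (σ := Unit) fun F z => B F (z ()))
    (h : ∀ r : ℝ, 0 < r → B realField r) : B starField infinitesimal := by
  by_contra hcon
  obtain ⟨r, hr, hr'⟩ := exists_pos_real_of_infinitesimal (B := fun F r => ¬ B F r) hB.not hcon
  exact hr' (h r hr)

end Transfer

section Conditions

variable {n : ℕ} (A : ∀ F : RealClosedExt, (Fin n → F.carrier) → Prop)
  (P : (Fin n → ℝ) →L[ℝ] Fin n → ℝ) (a : Fin n → ℝ)

/-- A real point as a point over an extension. -/
def RealClosedExt.point (F : RealClosedExt) (a : Fin n → ℝ) : Fin n → F.carrier :=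
  fun i => F.const (a i)

/-- Over `F`, the secants of `A` near `a` are fixed by `P` up to a factor `ε`. -/
def FlatWithin (F : RealClosedExt) (ε : ℝ) (ρ : F.carrier) : Prop :=
  ∀ x x' : Fin n → F.carrier, A F x → A F x' → sqNorm (x - F.point a) < ρ →
    sqNorm (x' - F.point a) < ρ →
      sqNorm ((x - x') - extend F P (x - x')) ≤ F.const ε * sqNorm (x - x')

/-- Over `F`, the map `P` takes on `A` all the values it takes near `a`. -/
def FullWithin (F : RealClosedExt) (C : ℝ) (ρ : F.carrier) : Prop :=
  ∀ y : Fin n → F.carrier, sqNorm (y - F.point a) < ρ →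
    ∃ x, A F x ∧ extend F P x = extend F P y ∧
      sqNorm (x - F.point a) ≤ F.const C * sqNorm (extend F P (y - F.point a))

/-- Over `F`, the map `P` takes on `A` all the values it takes near `a`, with linear control around
every point of `A` near `a`. -/
def UniformlyFullWithin (F : RealClosedExt) (C : ℝ) (ρ : F.carrier) : Prop :=
  ∀ x y : Fin n → F.carrier, A F x → sqNorm (x - F.point a) < ρ → sqNorm (y - F.point a) < ρ →
    ∃ x', A F x' ∧ extend F P x' = extend F P y ∧
      sqNorm (x' - x) ≤ F.const C * sqNorm (extend F P (y - x))

/-- Over `F`, the point `c` is the only point of `A` near `c` in the fiber of `P` through `c`. -/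
def IsolatedWithin (F : RealClosedExt) (c : Fin n → F.carrier) (ρ : F.carrier) : Prop :=
  ∀ x, A F x → extend F P x = extend F P c → sqNorm (x - c) < ρ → x = c

/-- Over `F`, the point `c` of `A` is isolated in the fiber of `P` through `c`. -/
def IsolatedInFiber (F : RealClosedExt) (c : Fin n → F.carrier) : Prop :=
  A F c ∧ ∃ ρ, 0 < ρ ∧ IsolatedWithin A P F c ρ

variable {A}

theorem isSemialgebraic_flatWithin (hA : IsSemialgebraic fun F x => A F x) (ε : ℝ) :
    IsSemialgebraic (σ := Unit) fun F z => FlatWithin A P a F ε (z ()) := by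
  refine .forall_tuple (.forall_tuple ?_)
  refine .imp (hA.comp fun i => .var _) (.imp (hA.comp fun i => .var _) (.imp ?_ (.imp ?_ ?_)))
  · exact .lt (.sqNorm fun i => .sub (.var _) (.const _)) (.var _)
  · exact .lt (.sqNorm fun i => .sub (.var _) (.const _)) (.var _)
  · exact .le (.sqNorm fun i => .sub (.sub (.var _) (.var _))
      (.extend P (fun i => .sub (.var _) (.var _)) i))
      (.mul (.const _) (.sqNorm fun i => .sub (.var _) (.var _)))

theorem isSemialgebraic_fullWithin (hA : IsSemialgebraic fun F x => A F x) (C : ℝ) :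
    IsSemialgebraic (σ := Unit) fun F z => FullWithin A P a F C (z ()) := by
  refine .forall_tuple (.imp ?_ (.exists_tuple (.and (hA.comp fun i => .var _) (.and ?_ ?_))))
  · exact .lt (.sqNorm fun i => .sub (.var _) (.const _)) (.var _)
  · exact .tuple_eq (.extend P fun i => .var _) (.extend P fun i => .var _)
  · exact .le (.sqNorm fun i => .sub (.var _) (.const _))
      (.mul (.const _) (.sqNorm (.extend P fun i => .sub (.var _) (.const _))))

theorem isSemialgebraic_uniformlyFullWithin (hA : IsSemialgebraic fun F x => A F x) (C : ℝ) :
    IsSemialgebraic (σ := Unit) fun F z => UniformlyFullWithin A P a F C (z ()) := by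
  refine .forall_tuple (.forall_tuple (.imp (hA.comp fun i => .var _) (.imp ?_ (.imp ?_
    (.exists_tuple (.and (hA.comp fun i => .var _) (.and ?_ ?_)))))))
  · exact .lt (.sqNorm fun i => .sub (.var _) (.const _)) (.var _)
  · exact .lt (.sqNorm fun i => .sub (.var _) (.const _)) (.var _)
  · exact .tuple_eq (.extend P fun i => .var _) (.extend P fun i => .var _)
  · exact .le (.sqNorm fun i => .sub (.var _) (.var _))
      (.mul (.const _) (.sqNorm (.extend P fun i => .sub (.var _) (.var _))))

theorem isSemialgebraic_isolatedWithin (hA : IsSemialgebraic fun F x => A F x) :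
    IsSemialgebraic (σ := Unit) fun F z => IsolatedWithin A P F (F.point a) (z ()) := by
  refine .forall_tuple (.imp (hA.comp fun i => .var _) (.imp ?_ (.imp ?_ ?_)))
  · exact .tuple_eq (.extend P fun i => .var _) (.extend P fun i => .const _)
  · exact .lt (.sqNorm fun i => .sub (.var _) (.const _)) (.var _)
  · exact .tuple_eq (fun i => .var _) (fun i => .const _)

theorem isSemialgebraic_isolatedInFiber (hA : IsSemialgebraic fun F x => A F x) :
    IsSemialgebraic fun F x => IsolatedInFiber A P F x := by
  refine .and hA (.exists_one (.and (.pos (.var _)) ?_))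
  refine .forall_tuple (.imp (hA.comp fun i => .var _) (.imp ?_ (.imp ?_ ?_)))
  · exact .tuple_eq (.extend P fun i => .var _) (.extend P fun i => .var _)
  · exact .lt (.sqNorm fun i => .sub (.var _) (.var _)) (.var _)
  · exact .tuple_eq (fun i => .var _) (fun i => .var _)

end Conditions

/-! ### Real forms of the conditions: sum of squares and sup norm -/

section RealConditions

open Filter Topology

variable {n : ℕ}

theorem norm_sq_le_sqNorm (z : Fin n → ℝ) : ‖z‖ ^ 2 ≤ sqNorm z := by
  have h : ‖z‖ ≤ √(sqNorm z) := (pi_norm_le_iff_of_nonneg (Real.sqrt_nonneg _)).mpr fun i => by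
    rw [Real.norm_eq_abs]
    refine Real.abs_le_sqrt ?_
    rw [sq]
    exact mul_self_le_sqNorm z i
  calc ‖z‖ ^ 2 ≤ √(sqNorm z) ^ 2 := pow_le_pow_left₀ (norm_nonneg z) h 2
    _ = sqNorm z := Real.sq_sqrt (sqNorm_nonneg z)

/-- The factor n + 1 instead of n keeps later denominators nonzero when n = 0. -/
theorem sqNorm_le_norm_sq (z : Fin n → ℝ) : sqNorm z ≤ (n + 1) * ‖z‖ ^ 2 := by
  have h : sqNorm z ≤ n * ‖z‖ ^ 2 := by
    refine (Finset.sum_le_card_nsmul Finset.univ (fun i => z i * z i) (‖z‖ ^ 2) fun i _ => ?_).trans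
      (by simp)
    rw [← sq, ← sq_abs, ← Real.norm_eq_abs]
    exact pow_le_pow_left₀ (norm_nonneg _) (norm_le_pi_norm z i) 2
  linarith [sq_nonneg ‖z‖]

theorem norm_lt_of_sqNorm_lt {z : Fin n → ℝ} {ρ : ℝ} (hρ : 0 < ρ) (h : sqNorm z < ρ ^ 2) :
    ‖z‖ < ρ :=
  lt_of_pow_lt_pow_left₀ 2 hρ.le ((norm_sq_le_sqNorm z).trans_lt h)

theorem sqNorm_lt_of_norm_lt {z : Fin n → ℝ} {ρ : ℝ}
    (h : ‖z‖ < √(ρ / (n + 1))) : sqNorm z < ρ := by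
  have h1 : ‖z‖ ^ 2 < ρ / (n + 1) := (Real.lt_sqrt (norm_nonneg z)).mp h
  have h2 : (0 : ℝ) < n + 1 := by positivity
  rw [lt_div_iff₀ h2] at h1
  linarith [sqNorm_le_norm_sq z]

variable {A : ∀ F : RealClosedExt, (Fin n → F.carrier) → Prop}
  {P : (Fin n → ℝ) →L[ℝ] Fin n → ℝ} {a : Fin n → ℝ}

theorem IsFlatAt.exists_flatWithin (h : IsFlatAt {x | A realField x} a P) {ε : ℝ} (hε : 0 < ε) :
    ∃ ρ > 0, FlatWithin A P a realField ε ρ := by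
  obtain ⟨ρ, hρ, hflat⟩ := h.exists_ball (ε := √(ε / (n + 1))) (Real.sqrt_pos.mpr (by positivity))
  refine ⟨ρ ^ 2, by positivity, fun x x' hx hx' hxa hxa' => ?_⟩
  have h1 := hflat x hx x' hx' (norm_lt_of_sqNorm_lt hρ hxa) (norm_lt_of_sqNorm_lt hρ hxa')
  rw [extend_realField]
  have h2 := pow_le_pow_left₀ (norm_nonneg _) h1 2
  rw [mul_pow, Real.sq_sqrt (by positivity)] at h2
  calc sqNorm ((x - x') - P (x - x'))
      ≤ (n + 1) * ‖(x - x') - P (x - x')‖ ^ 2 := sqNorm_le_norm_sq _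
    _ ≤ (n + 1) * (ε / (n + 1) * ‖x - x'‖ ^ 2) := mul_le_mul_of_nonneg_left h2 (by positivity)
    _ = ε * ‖x - x'‖ ^ 2 := by field_simp
    _ ≤ ε * sqNorm (x - x') := mul_le_mul_of_nonneg_left (norm_sq_le_sqNorm _) hε.le

theorem isFlatAt_of_flatWithin (h : ∀ ε > 0, ∃ ρ > 0, FlatWithin A P a realField ε ρ) :
    IsFlatAt {x | A realField x} a P := by
  refine .of_forall fun ε hε => ?_
  obtain ⟨ρ, hρ, hflat⟩ := h (ε ^ 2 / (n + 1)) (by positivity)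
  refine ⟨√(ρ / (n + 1)), Real.sqrt_pos.mpr (by positivity), fun x hx x' hx' hxa hxa' => ?_⟩
  have h1 := hflat x x' hx hx' (sqNorm_lt_of_norm_lt hxa) (sqNorm_lt_of_norm_lt hxa')
  rw [extend_realField] at h1
  have h1 : sqNorm ((x - x') - P (x - x')) ≤ ε ^ 2 / (n + 1) * sqNorm (x - x') := h1
  refine le_of_sq_le_sq ?_ (by positivity)
  calc ‖(x - x') - P (x - x')‖ ^ 2 ≤ sqNorm ((x - x') - P (x - x')) := norm_sq_le_sqNorm _
    _ ≤ ε ^ 2 / (n + 1) * sqNorm (x - x') := h1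
    _ ≤ ε ^ 2 / (n + 1) * ((n + 1) * ‖x - x'‖ ^ 2) :=
      mul_le_mul_of_nonneg_left (sqNorm_le_norm_sq _) (by positivity)
    _ = (ε * ‖x - x'‖) ^ 2 := by field_simp

theorem IsFullAt.exists_fullWithin (h : IsFullAt {x | A realField x} a P) :
    ∃ C : ℝ, ∃ ρ > 0, FullWithin A P a realField C ρ := by
  obtain ⟨C, hC⟩ := h
  obtain ⟨ρ, hρ, hC⟩ := Metric.eventually_nhds_iff.mp hC
  refine ⟨(n + 1) * |C| ^ 2, ρ ^ 2, by positivity, fun y hy => ?_⟩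
  obtain ⟨x, hx, hPx, hxa⟩ := hC (y := y) (by
    rw [dist_eq_norm]
    exact norm_lt_of_sqNorm_lt hρ hy)
  refine ⟨x, hx, by rw [extend_realField, extend_realField, hPx], ?_⟩
  rw [extend_realField]
  have h1 : ‖x - a‖ ≤ |C| * ‖P (y - a)‖ :=
    hxa.trans (mul_le_mul_of_nonneg_right (le_abs_self C) (norm_nonneg _))
  have h2 := pow_le_pow_left₀ (norm_nonneg _) h1 2
  rw [mul_pow] at h2
  calc sqNorm (x - a) ≤ (n + 1) * ‖x - a‖ ^ 2 := sqNorm_le_norm_sq _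
    _ ≤ (n + 1) * (|C| ^ 2 * ‖P (y - a)‖ ^ 2) := mul_le_mul_of_nonneg_left h2 (by positivity)
    _ = (n + 1) * |C| ^ 2 * ‖P (y - a)‖ ^ 2 := by ring
    _ ≤ (n + 1) * |C| ^ 2 * sqNorm (P (y - a)) :=
      mul_le_mul_of_nonneg_left (norm_sq_le_sqNorm _) (by positivity)

theorem exists_isFullAt_of_uniformlyFullWithin {C ρ : ℝ} (hC : 0 ≤ C) (hρ : 0 < ρ)
    (h : UniformlyFullWithin A P a realField C ρ) :
    ∃ r > 0, ∀ c, A realField c → ‖c - a‖ < r → IsFullAt {x | A realField x} c P := by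
  refine ⟨√(ρ / (n + 1)), Real.sqrt_pos.mpr (by positivity), fun c hc hca =>
    ⟨√(C * (n + 1)), ?_⟩⟩
  have hopen : IsOpen {y : Fin n → ℝ | ‖y - a‖ < √(ρ / (n + 1))} :=
    isOpen_lt (by fun_prop) continuous_const
  filter_upwards [hopen.mem_nhds hca] with y hy
  obtain ⟨x, hx, hPx, hxc⟩ := h c y hc (sqNorm_lt_of_norm_lt hca) (sqNorm_lt_of_norm_lt hy)
  rw [extend_realField, extend_realField] at hPx
  rw [extend_realField] at hxc
  have hxc : sqNorm (x - c) ≤ C * sqNorm (P (y - c)) := hxc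
  refine ⟨x, hx, hPx, le_of_sq_le_sq ?_ (by positivity)⟩
  calc ‖x - c‖ ^ 2 ≤ sqNorm (x - c) := norm_sq_le_sqNorm _
    _ ≤ C * sqNorm (P (y - c)) := hxc
    _ ≤ C * ((n + 1) * ‖P (y - c)‖ ^ 2) := mul_le_mul_of_nonneg_left (sqNorm_le_norm_sq _) hC
    _ = (√(C * (n + 1)) * ‖P (y - c)‖) ^ 2 := by
      rw [mul_pow, Real.sq_sqrt (by positivity), mul_assoc]

end RealConditions

/-! ### Ultrametric estimates for tuples -/

section Tuples

variable {K Γ : Type} [Field K] [LinearOrderedAddCommMonoidWithTop Γ] {v : AddValuation K Γ} {n : ℕ}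

theorem lt_tupleVal_add {r : Γ} {x y : Fin n → K} (hx : r < tupleVal v x) (hy : r < tupleVal v y) :
    r < tupleVal v (x + y) :=
  (lt_min hx hy).trans_le (min_tupleVal_le_add v x y)

theorem lt_tupleVal_sub {r : Γ} {x y : Fin n → K} (hx : r < tupleVal v x) (hy : r < tupleVal v y) :
    r < tupleVal v (x - y) :=
  (lt_min hx hy).trans_le (min_tupleVal_le_sub v x y)

theorem tupleVal_eq_of_lt_tupleVal_sub {x y : Fin n → K} (h : tupleVal v y < tupleVal v (x - y)) :
    tupleVal v x = tupleVal v y := by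
  refine le_antisymm (not_lt.mp fun hlt => ?_) ?_
  · have := lt_tupleVal_sub hlt h
    rw [sub_sub_cancel] at this
    exact lt_irrefl _ this
  · have := min_tupleVal_le_add v (x - y) y
    rwa [sub_add_cancel, min_eq_right h.le] at this

theorem AlmostEq.tupleVal_eq {x y : Fin n → K} (h : AlmostEq v x y) :
    tupleVal v x = tupleVal v y := by
  rcases h with h | ⟨rfl, rfl⟩
  · rw [tupleVal_sub_comm] at h
    exact (tupleVal_eq_of_lt_tupleVal_sub h).symm
  · rfl

theorem almostEq_of_lt_tupleVal_sub {x y : Fin n → K} (h : tupleVal v y < tupleVal v (x - y)) :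
    AlmostEq v x y :=
  Or.inl ((tupleVal_eq_of_lt_tupleVal_sub h).trans_lt h)

end Tuples

/-! ### Straightening the star set by a shear -/

section Straightening

variable {n : ℕ} {A : ∀ F : RealClosedExt, (Fin n → F.carrier) → Prop}
  {P : (Fin n → ℝ) →L[ℝ] Fin n → ℝ} {a : Fin n → ℝ}

/-- The infinitesimal neighbourhood lies inside every real radius, so flatness transfers
simultaneously for all real ε, which amounts to a strict inequality of valuations. -/
theorem tupleVal_lt_of_isFlatAt (hA : IsSemialgebraic fun F x => A F x)
    (h : IsFlatAt {x | A realField x} a P) {x x' : Fin n → RStar} (hx : A starField x)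
    (hx' : A starField x') (hxa : x ∈ infNhd a) (hxa' : x' ∈ infNhd a) (hne : x ≠ x') :
    tupleVal val (x - x') < tupleVal val ((x - x') - extend starField P (x - x')) := by
  refine tupleVal_lt_of_forall_sqNorm_le (sub_ne_zero.mpr hne) fun ε hε => ?_
  obtain ⟨ρ, hρ, hflat⟩ := h.exists_flatWithin hε
  exact transfer_of_real (B := fun F r => FlatWithin A P a F ε r)
    (isSemialgebraic_flatWithin P a hA ε) hflat x x' hx hx' (sqNorm_lt_of_mem_infNhd hxa hρ)
    (sqNorm_lt_of_mem_infNhd hxa' hρ)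

theorem exists_extend_eq_of_isFullAt (hA : IsSemialgebraic fun F x => A F x)
    (h : IsFullAt {x | A realField x} a P) {y : Fin n → RStar} (hy : y ∈ infNhd a) :
    ∃ x, A starField x ∧ x ∈ infNhd a ∧ extend starField P x = extend starField P y := by
  obtain ⟨C, ρ, hρ, hfull⟩ := h.exists_fullWithin
  obtain ⟨x, hx, hPx, hxa⟩ := transfer_of_real (B := fun F r => FullWithin A P a F C r)
    (isSemialgebraic_fullWithin P a hA C) hfull y (sqNorm_lt_of_mem_infNhd hy hρ)
  exact ⟨x, hx, (mem_infNhd_iff.mp hy).trans_le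
    ((tupleVal_le_extend P _).trans (tupleVal_le_of_sqNorm_le hxa)), hPx⟩

/-- Flatness and fullness make X* near `a` a graph over the range of R, given by f. Subtracting the
normal component of the graph maps X* onto the part of the image lying in that range. -/
theorem isRisoTrivial_of_isFlatAt_isFullAt (hA : IsSemialgebraic fun F x => A F x)
    (hP : ∀ x, P (P x) = P x) (hflat : IsFlatAt {x | A realField x} a P)
    (hfull : IsFullAt {x | A realField x} a P) :
    IsRisoTrivial val (Module.finrank ℝ (LinearMap.range (P : (Fin n → ℝ) →ₗ[ℝ] Fin n → ℝ)))
      {x | A starField x} (infNhd a) := by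
  set R := extend starField P with hR
  have hRR : ∀ x, R (R x) = R x := extend_extend starField hP
  have hex : ∀ y, y ∈ infNhd a → ∃ x, A starField x ∧ x ∈ infNhd a ∧ R x = R y :=
    fun y hy => exists_extend_eq_of_isFullAt hA hfull hy
  choose! f hfA hfa hRf using hex
  have hlt : ∀ x, A starField x → x ∈ infNhd a → ∀ x', A starField x' → x' ∈ infNhd a → x ≠ x' →
      tupleVal val (x - x') < tupleVal val ((x - x') - R (x - x')) :=
    fun x hx hxa x' hx' hxa' hne => tupleVal_lt_of_isFlatAt hA hflat hx hx' hxa hxa' hne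
  have huniq : ∀ x, A starField x → x ∈ infNhd a → ∀ x', A starField x' → x' ∈ infNhd a →
      R x = R x' → x = x' := by
    intro x hx hxa x' hx' hxa' hxx'
    by_contra hne
    have := hlt x hx hxa x' hx' hxa' hne
    rw [map_sub, hxx', sub_self, sub_zero] at this
    exact lt_irrefl _ this
  set α : (Fin n → RStar) → Fin n → RStar := fun y => y - (f y - R (f y)) with hα
  have hαy : ∀ y, α y = y - (f y - R (f y)) := fun y => rfl
  -- The error of the shear is the normal part of a secant of X*, which flatness makes smaller than
  -- its tangential part; the latter is R(y - y').
  have hris : ∀ y ∈ infNhd a, ∀ y' ∈ infNhd a, y ≠ y' →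
      tupleVal val (y - y') < tupleVal val ((α y - α y') - (y - y')) := by
    intro y hy y' hy' hne
    have h1 : (α y - α y') - (y - y') = -((f y - f y') - R (f y - f y')) := by
      rw [hαy, hαy, map_sub]
      abel
    rw [h1, tupleVal_neg]
    by_cases hf : f y = f y'
    · rw [hf, sub_self, map_zero, sub_zero, tupleVal_zero, lt_top_iff_ne_top]
      exact fun h => hne (sub_eq_zero.mp (tupleVal_val_eq_top_iff.mp h))
    · have h2 := hlt _ (hfA y hy) (hfa y hy) _ (hfA y' hy') (hfa y' hy') hf
      have h3 : tupleVal val (R (f y - f y')) = tupleVal val (f y - f y') := by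
        refine tupleVal_eq_of_lt_tupleVal_sub ?_
        rw [tupleVal_sub_comm val (R _)]
        exact h2
      refine lt_of_le_of_lt ?_ h2
      rw [← h3, map_sub, hRf y hy, hRf y' hy', ← map_sub]
      exact tupleVal_le_extend P _
  refine ⟨LinearMap.range R, finrank_range_extend starField hP, α '' infNhd a, α,
    ⟨⟨fun y hy => ⟨y, hy, rfl⟩, ?_, fun _ h => h⟩, ?_⟩, ?_⟩
  · intro y hy y' hy' hyy'
    by_contra hne
    have := hris y hy y' hy' hne
    rw [hyy', sub_self, zero_sub, tupleVal_neg] at this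
    exact lt_irrefl _ this
  · intro y hy y' hy'
    by_cases hne : y = y'
    · rw [hne, sub_self, sub_self]
      exact Or.inr ⟨rfl, rfl⟩
    · exact almostEq_of_lt_tupleVal_sub (hris y hy y' hy' hne)
  · have hmem : ∀ y ∈ infNhd a, α y ∈ α '' ({x | A starField x} ∩ infNhd a) ↔
        α y - R (α y) = 0 := by
      have hkey : ∀ y ∈ infNhd a, α y - R (α y) = y - f y := by
        intro y hy
        rw [hαy, map_sub, map_sub, hRR, sub_self, sub_zero, hRf y hy]
        abel
      intro y hy
      rw [hkey y hy, sub_eq_zero]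
      constructor
      · rintro ⟨y', ⟨hyA, hy'⟩, heq⟩
        have h1 : y' = f y' := huniq y' hyA hy' _ (hfA y' hy') (hfa y' hy') (hRf y' hy').symm
        rw [← sub_eq_zero, ← hkey y hy, ← heq, hkey y' hy', sub_eq_zero]
        exact h1
      · intro h
        refine ⟨y, ⟨?_, hy⟩, rfl⟩
        rw [h]
        exact hfA y hy
    rintro _ ⟨y₁, hy₁, rfl⟩ _ ⟨y₂, hy₂, rfl⟩ ⟨w, hw⟩
    rw [hmem y₁ hy₁, hmem y₂ hy₂]
    have h1 : α y₁ - R (α y₁) = α y₂ - R (α y₂) := by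
      have h2 : R (α y₁ - α y₂) = α y₁ - α y₂ := by rw [← hw, hRR]
      rw [map_sub] at h2
      rw [sub_eq_sub_iff_sub_eq_sub, h2]
    rw [h1]

end Straightening

/-! ### Reduction of subspaces -/

section Parametrization

open Matrix

variable {K Γ : Type} [Field K] [LinearOrderedAddCommMonoidWithTop Γ] {n k : ℕ}

theorem exists_submatrix_det_ne_zero (A : Matrix (Fin n) (Fin k) K)
    (hA : LinearIndependent K A.col) : ∃ ι : Fin k → Fin n, (A.submatrix ι id).det ≠ 0 := by
  have h1 : A.rank = k := by
    rw [← Matrix.rank_transpose, LinearIndependent.rank_matrix (by simpa using hA), Fintype.card_fin]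
  rw [Matrix.rank_eq_finrank_span_row] at h1
  obtain ⟨f, hf, -, hfi⟩ := Submodule.exists_fun_fin_finrank_span_eq K (Set.range A.row)
  choose ι hι using hf
  refine ⟨fun j => ι (finCongr h1.symm j), ?_⟩
  rw [← isUnit_iff_ne_zero, ← Matrix.isUnit_iff_isUnit_det, ← Matrix.linearIndependent_rows_iff_isUnit]
  have h2 : (A.submatrix (fun j => ι (finCongr h1.symm j)) id).row = f ∘ finCongr h1.symm :=
    funext fun j => hι _
  rw [h2]
  exact hfi.comp _ (finCongr h1.symm).injective

theorem mul_inv_submatrix_apply_mul_det (A : Matrix (Fin n) (Fin k) K) {ι : Fin k → Fin n}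
    (hdet : (A.submatrix ι id).det ≠ 0) (i : Fin n) (j : Fin k) :
    (A * (A.submatrix ι id)⁻¹) i j * (A.submatrix ι id).det =
      (A.submatrix (Function.update ι j i) id).det := by
  have h2 : A.submatrix (Function.update ι j i) id = (A.submatrix ι id).updateRow j (A i) := by
    ext l m
    by_cases h : l = j
    · subst h
      simp
    · simp [h]
  rw [h2, ← Matrix.cramer_transpose_apply, Matrix.cramer_eq_adjugate_mulVec,
    ← Matrix.adjugate_transpose, Matrix.mulVec_transpose, Matrix.inv_def, Matrix.mul_smul,
    Matrix.smul_apply, Ring.inverse_eq_inv', smul_eq_mul, mul_comm, mul_inv_cancel_left₀ hdet]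
  rfl

theorem nonneg_of_le_val_mul {v : AddValuation K Γ} {x y : K} (hy : y ≠ 0) (h : v y ≤ v (x * y)) :
    0 ≤ v x := by
  have h1 := add_le_add_left h (v y⁻¹)
  rwa [← v.map_mul, ← v.map_mul, mul_inv_cancel_right₀ hy, mul_inv_cancel₀ hy, v.map_one] at h1

/-- Normalize at a maximal minor of least valuation. By Cramer's rule the entries become quotients
of minors by this one, hence integral. -/
theorem exists_integral_parametrization (v : AddValuation K Γ) (hv : ∀ x, v x = ⊤ → x = 0)
    (V : Submodule K (Fin n → K)) :
    ∃ (ι : Fin (Module.finrank K V) → Fin n) (C : Matrix (Fin n) (Fin (Module.finrank K V)) K),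
      (∀ i j, 0 ≤ v (C i j)) ∧ C.submatrix ι id = 1 ∧ ∀ z, C *ᵥ z ∈ V := by
  set b := Module.finBasis K V
  set A : Matrix (Fin n) (Fin (Module.finrank K V)) K := Matrix.of fun i j => (b j : Fin n → K) i
  have hA : LinearIndependent K A.col :=
    b.linearIndependent.map' V.subtype V.ker_subtype
  have hAz : ∀ z, A *ᵥ z = ((∑ j, z j • b j : V) : Fin n → K) := by
    intro z
    ext i
    simp [A, Matrix.mulVec, dotProduct, mul_comm]
  obtain ⟨ι₀, hι₀⟩ := exists_submatrix_det_ne_zero A hA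
  have : Nonempty (Fin (Module.finrank K V) → Fin n) := ⟨ι₀⟩
  obtain ⟨ι, hι⟩ := Finite.exists_min fun ι : Fin (Module.finrank K V) → Fin n =>
    v (A.submatrix ι id).det
  have hdet : (A.submatrix ι id).det ≠ 0 := by
    intro h0
    have := hι ι₀
    rw [h0, v.map_zero, top_le_iff] at this
    exact hι₀ (hv _ this)
  have hu : IsUnit (A.submatrix ι id).det := isUnit_iff_ne_zero.mpr hdet
  refine ⟨ι, A * (A.submatrix ι id)⁻¹, fun i j => ?_, ?_, fun z => ?_⟩
  · refine nonneg_of_le_val_mul hdet ?_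
    rw [mul_inv_submatrix_apply_mul_det A hdet]
    exact hι _
  · have h1 : (A * (A.submatrix ι id)⁻¹).submatrix ι id =
        A.submatrix ι id * (A.submatrix ι id)⁻¹ := rfl
    rw [h1, Matrix.mul_nonsing_inv _ hu]
  · rw [← Matrix.mulVec_mulVec, hAz]
    exact Subtype.property _

end Parametrization

section Reduction

open Matrix

variable {n : ℕ} {F : RealClosedExt} {v : AddValuation F.carrier (WithTop ℚ)}

/-- If `ℝ` is the residue field of a valuation, a subspace is, up to infinitesimals, the extension of scalars of the range of
a real projection `P`; the map `Q` is a projection to the subspace along the kernel of `P`. -/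
theorem exists_real_projection (htop : ∀ x, v x = ⊤ → x = 0)
    (hconst : ∀ r, r ≠ 0 → v (F.const r) = 0)
    (hres : ∀ q, 0 ≤ v q → ∃ r, 0 < v (q - F.const r)) (V : Submodule F.carrier (Fin n → F.carrier)) :
    ∃ (P : (Fin n → ℝ) →L[ℝ] Fin n → ℝ) (Q : (Fin n → F.carrier) →ₗ[F.carrier] Fin n → F.carrier),
      (∀ x, P (P x) = P x) ∧
      Module.finrank ℝ (LinearMap.range (P : (Fin n → ℝ) →ₗ[ℝ] Fin n → ℝ)) =
        Module.finrank F.carrier V ∧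
      (∀ x, Q x ∈ V) ∧
      (∀ x, extend F P (Q x) = extend F P x) ∧
      (∀ x, Q (extend F P x) = Q x) ∧
      ∀ x, x ≠ 0 → tupleVal v x < tupleVal v (Q x - extend F P x) := by
  obtain ⟨ι, C, hC0, hC1, hCV⟩ :=
    exists_integral_parametrization v htop V
  choose D hD using fun i j => hres _ (hC0 i j)
  set D : Matrix (Fin n) (Fin (Module.finrank F.carrier V)) ℝ := Matrix.of D with hDdef
  have hD1 : D.submatrix ι id = 1 := by
    ext l j
    have h1 := hD (ι l) j
    have h2 : C (ι l) j = (1 : Matrix _ _ F.carrier) l j := congrFun (congrFun hC1 l) j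
    have h3 : F.const ((1 : Matrix _ _ ℝ) l j) = (1 : Matrix _ _ F.carrier) l j := by
      rw [Matrix.one_apply, Matrix.one_apply]
      split_ifs <;> simp
    rw [h2, ← h3, ← map_sub] at h1
    by_contra hne
    exact h1.ne (hconst _ (sub_ne_zero.mpr (Ne.symm hne))).symm
  set S : Matrix (Fin (Module.finrank F.carrier V)) (Fin n) ℝ := (1 : Matrix _ _ ℝ).submatrix ι id with hS
  have hSD : S * D = 1 := by
    rw [← hD1, hS]
    ext l j
    simp [Matrix.mul_apply, Matrix.one_apply]
  -- With S the selection of the coordinates ι, the projections are P = DS and, over F, Q = CS. They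
  -- differ by the infinitesimal matrix C - D. Since SD = 1, the trace of DS equals the dimension of
  -- V, which gives the rank of P.
  set P : (Fin n → ℝ) →L[ℝ] Fin n → ℝ := LinearMap.toContinuousLinearMap (Matrix.toLin' (D * S))
  have hPP : ∀ x, P (P x) = P x := fun x => by
    change (D * S) *ᵥ ((D * S) *ᵥ x) = (D * S) *ᵥ x
    rw [Matrix.mulVec_mulVec, Matrix.mul_assoc, ← Matrix.mul_assoc S, hSD, Matrix.one_mul]
  have hPx : ∀ x, extend F P x = (D.map F.const) *ᵥ fun j => x (ι j) := by
    intro x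
    have h1 : LinearMap.toMatrix' (P : (Fin n → ℝ) →ₗ[ℝ] Fin n → ℝ) = D * S :=
      LinearMap.toMatrix'_toLin' _
    have h2 : (S.map F.const) *ᵥ x = fun j => x (ι j) := by
      ext j
      simp [hS, Matrix.mulVec, dotProduct, Matrix.one_apply]
    rw [extend, h1, Matrix.map_mul, Matrix.toLin'_apply, ← Matrix.mulVec_mulVec, h2]
  have hDι : ∀ z : Fin (Module.finrank F.carrier V) → F.carrier,
      (fun j => ((D.map F.const) *ᵥ z) (ι j)) = z := by
    intro z
    have h1 : (D.map F.const).submatrix ι id = 1 := by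
      rw [Matrix.submatrix_map, hD1]
      exact Matrix.map_one _ (map_zero _) (map_one _)
    have h2 : (fun j => ((D.map F.const) *ᵥ z) (ι j)) =
      ((D.map F.const).submatrix ι id) *ᵥ z := rfl
    rw [h2, h1, Matrix.one_mulVec]
  have hCι : ∀ z : Fin (Module.finrank F.carrier V) → F.carrier, (fun j => (C *ᵥ z) (ι j)) = z := by
    intro z
    have h2 : (fun j => (C *ᵥ z) (ι j)) = (C.submatrix ι id) *ᵥ z := rfl
    rw [h2, hC1, Matrix.one_mulVec]
  set Q : (Fin n → F.carrier) →ₗ[F.carrier] Fin n → F.carrier :=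
    Matrix.mulVecLin C ∘ₗ LinearMap.funLeft F.carrier F.carrier ι
  have hQx : ∀ x, Q x = C *ᵥ fun j => x (ι j) := fun x => rfl
  refine ⟨P, Q, hPP, ?_, fun x => hCV _, fun x => ?_, fun x => ?_, fun x hx => ?_⟩
  · have h1 := ((LinearMap.isProj_range_iff_isIdempotentElem
      (P : (Fin n → ℝ) →ₗ[ℝ] Fin n → ℝ)).mpr (LinearMap.ext hPP)).trace
    have h2 : LinearMap.trace ℝ _ (P : (Fin n → ℝ) →ₗ[ℝ] Fin n → ℝ) = (D * S).trace :=
      Matrix.trace_toLin'_eq _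
    rw [h2, Matrix.trace_mul_comm, hSD, Matrix.trace_one, Fintype.card_fin] at h1
    exact_mod_cast h1.symm
  · rw [hPx, hPx, hQx, hCι]
  · rw [hQx, hQx, hPx, hDι]
  · have hx' : tupleVal v x ≠ ⊤ := fun h => hx (funext fun i => htop _ (top_le_iff.mp (h ▸ tupleVal_le v x i)))
    rw [hQx, hPx]
    refine (Finset.lt_inf_iff (lt_top_iff_ne_top.mpr hx')).mpr fun i _ => ?_
    have h1 : ((C *ᵥ fun j => x (ι j)) - (D.map F.const) *ᵥ fun j => x (ι j)) i =
        ∑ j, (C i j - F.const (D i j)) * x (ι j) := by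
      simp [Matrix.mulVec, dotProduct, sub_mul]
    rw [h1]
    refine v.map_lt_sum hx' fun j _ => ?_
    rw [v.map_mul]
    calc tupleVal v x = 0 + tupleVal v x := (zero_add _).symm
      _ < v (C i j - F.const (D i j)) + tupleVal v x := WithTop.add_lt_add_right hx' (hD i j)
      _ ≤ _ := add_le_add_right (tupleVal_le v x (ι j)) _

end Reduction

/-! ### Consequences of riso-triviality -/

/-- A risometry on the infinitesimal neighbourhood of `a` witnessing riso-triviality along the
range of `Q`, where `Q` is infinitesimally close to the extension of scalars of `P`. -/
structure Trivialization {n : ℕ} (A : ∀ F : RealClosedExt, (Fin n → F.carrier) → Prop)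
    (a : Fin n → ℝ) (P : (Fin n → ℝ) →L[ℝ] Fin n → ℝ) where
  /-- The risometry. -/
  map : (Fin n → RStar) → Fin n → RStar
  /-- The image of the infinitesimal neighbourhood. -/
  target : Set (Fin n → RStar)
  /-- The projection to the space of translations. -/
  proj : (Fin n → starField.carrier) →ₗ[starField.carrier] Fin n → starField.carrier
  isRisometry : IsRisometry val map (infNhd a) target
  invariant : ∀ b₁ ∈ target, ∀ b₂ ∈ target, proj (b₁ - b₂) = b₁ - b₂ →
    (b₁ ∈ map '' ({x | A starField x} ∩ infNhd a) ↔ b₂ ∈ map '' ({x | A starField x} ∩ infNhd a))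
  idem : ∀ x, P (P x) = P x
  extend_proj : ∀ x, extend starField P (proj x) = extend starField P x
  proj_extend : ∀ x, proj (extend starField P x) = proj x
  close : ∀ x : Fin n → RStar, x ≠ 0 →
    tupleVal val x < tupleVal val (proj x - extend starField P x)

section Trivialization

variable {n : ℕ} {A : ∀ F : RealClosedExt, (Fin n → F.carrier) → Prop} {a : Fin n → ℝ}

theorem exists_trivialization {d : ℕ}
    (h : IsRisoTrivial val d {x | A starField x} (infNhd a)) :
    ∃ P : (Fin n → ℝ) →L[ℝ] Fin n → ℝ,
      Module.finrank ℝ (LinearMap.range (P : (Fin n → ℝ) →ₗ[ℝ] Fin n → ℝ)) = d ∧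
        Nonempty (Trivialization A a P) := by
  obtain ⟨V, hV, B', α, hα, hinv⟩ := h
  obtain ⟨P, Q, hPP, hrank, hQV, hPQ, hQP, hclose⟩ := exists_real_projection (F := starField)
    (v := val) (fun x => val_eq_top_iff.mp) (fun r => val_toStarHom)
    (fun q => exists_val_sub_toStarHom_pos) V
  exact ⟨P, hrank.trans hV, ⟨⟨α, B', Q, hα,
    fun b₁ hb₁ b₂ hb₂ hb => hinv b₁ hb₁ b₂ hb₂ (hb ▸ hQV _), hPP, hPQ, hQP, hclose⟩⟩⟩

namespace Trivialization

variable {P : (Fin n → ℝ) →L[ℝ] Fin n → ℝ} (T : Trivialization A a P)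

/-- The images of two points under the risometry differ by a translation. -/
def Rel (x y : Fin n → RStar) : Prop := T.proj (T.map x - T.map y) = T.map x - T.map y

theorem Rel.symm {T : Trivialization A a P} {x y : Fin n → RStar} (h : T.Rel x y) : T.Rel y x := by
  unfold Rel at h ⊢
  rw [← neg_sub, map_neg, h]

theorem Rel.trans {T : Trivialization A a P} {x y z : Fin n → RStar} (h : T.Rel x y) (h' : T.Rel y z) : T.Rel x z := by
  unfold Rel at h h' ⊢
  rw [← sub_add_sub_cancel (T.map x) (T.map y), map_add, h, h']

theorem lt_map_sub {x y : Fin n → RStar} (hx : x ∈ infNhd a) (hy : y ∈ infNhd a) (hne : x ≠ y) :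
    tupleVal val (x - y) < tupleVal val ((T.map x - T.map y) - (x - y)) := by
  have h := T.isRisometry.2 x hx y hy
  rw [← h.tupleVal_eq]
  rcases h with h | ⟨-, h⟩
  · exact h
  · exact absurd (sub_eq_zero.mp h) hne

theorem tupleVal_map_sub {x y : Fin n → RStar} (hx : x ∈ infNhd a) (hy : y ∈ infNhd a) :
    tupleVal val (T.map x - T.map y) = tupleVal val (x - y) :=
  (T.isRisometry.2 x hx y hy).tupleVal_eq

theorem tupleVal_le_proj (x : Fin n → RStar) : tupleVal val x ≤ tupleVal val (T.proj x) := by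
  by_cases hx : x = 0
  · subst hx
    exact (congrArg (tupleVal val) (map_zero T.proj)).ge
  · have h := min_tupleVal_le_add val (T.proj x - extend starField P x) (extend starField P x)
    rw [sub_add_cancel] at h
    exact (le_min (T.close x hx).le (tupleVal_le_extend P x)).trans h

theorem sub_mem {x y : Fin n → RStar} (hx : x ∈ infNhd a) (hy : y ∈ infNhd a) :
    0 < tupleVal val (x - y) := by
  have := lt_tupleVal_sub (mem_infNhd_iff.mp hx) (mem_infNhd_iff.mp hy)
  rwa [sub_sub_sub_cancel_right] at this

/-- The point x' must solve two linear-looking equations: R(x' - y) = 0, and the image difference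
under the risometry must lie in the space of translations. Both errors are subtracted at once, which
defines a contraction because `proj` is close to R and the risometry is close to the identity.
Invariance then puts x' in the star set. -/
theorem exists_rel {x y : Fin n → RStar} (hxA : A starField x) (hx : x ∈ infNhd a)
    (hy : y ∈ infNhd a) : ∃ x', A starField x' ∧ x' ∈ infNhd a ∧
      extend starField P x' = extend starField P y ∧ T.Rel x' x := by
  set R := extend starField P with hR
  set f : (Fin n → RStar) → Fin n → RStar := fun x' =>
    x' - (R (x' - y) + ((T.map x' - T.map x) - T.proj (T.map x' - T.map x))) with hf
  have hfx : ∀ x', f x' = x' - (R (x' - y) + ((T.map x' - T.map x) - T.proj (T.map x' - T.map x))) :=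
    fun _ => rfl
  obtain ⟨x', hx', hfix⟩ := exists_fixedPoint (fun i => toStar (a i)) f (by
    intro x' hx'
    have hx' : x' ∈ infNhd a := hx'
    have h1 : 0 < tupleVal val (T.map x' - T.map x) := by
      rw [T.tupleVal_map_sub hx' hx]
      exact sub_mem hx' hx
    have h2 : 0 < tupleVal val (R (x' - y)) := (sub_mem hx' hy).trans_le (tupleVal_le_extend P _)
    have h3 := lt_tupleVal_sub (mem_infNhd_iff.mp hx')
      (lt_tupleVal_add h2 (lt_tupleVal_sub h1 (h1.trans_le (T.tupleVal_le_proj _))))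
    change 0 < tupleVal val (f x' - _)
    rw [hfx, sub_right_comm]
    exact h3) (by
    intro z hz z' hz' hne
    have hz : z ∈ infNhd a := hz
    have hz' : z' ∈ infNhd a := hz'
    set e := (T.map z - T.map z') - (z - z') with he
    have h1 : f z - f z' = (T.proj (z - z') - R (z - z')) - (e - T.proj e) := by
      rw [hfx, hfx, he]
      simp only [map_sub]
      abel
    rw [h1]
    have h2 := T.lt_map_sub hz hz' hne
    exact lt_tupleVal_sub (T.close _ (sub_ne_zero.mpr hne))
      (lt_tupleVal_sub h2 (h2.trans_le (T.tupleVal_le_proj _))))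
  have hx' : x' ∈ infNhd a := hx'
  have hzero : R (x' - y) + ((T.map x' - T.map x) - T.proj (T.map x' - T.map x)) = 0 := by
    rw [hfx] at hfix
    exact sub_eq_self.mp hfix
  -- R kills the second error, since R after `proj` equals R; applying R therefore separates the two
  -- equations.
  have hRy : R (x' - y) = 0 := by
    have h1 := congrArg R hzero
    rw [map_add, map_sub R (T.map x' - T.map x), hR, T.extend_proj, sub_self, add_zero, map_zero,
      extend_extend starField T.idem] at h1
    exact h1
  have hrel : T.Rel x' x := by
    rw [hRy, zero_add] at hzero
    exact (sub_eq_zero.mp hzero).symm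
  obtain ⟨z, ⟨hzA, hz⟩, hzx'⟩ := (T.invariant _ (T.isRisometry.1.mapsTo hx') _
    (T.isRisometry.1.mapsTo hx) hrel).mpr ⟨x, ⟨hxA, hx⟩, rfl⟩
  have : z = x' := T.isRisometry.1.injOn hz hx' hzx'
  subst this
  rw [map_sub] at hRy
  exact ⟨z, hzA, hx', sub_eq_zero.mp hRy, hrel⟩

/-- The image difference is fixed by `proj`, hence almost fixed by R, and the risometry changes the
difference only by a smaller error. -/
theorem lt_sub_extend_of_rel {x y : Fin n → RStar} (hx : x ∈ infNhd a) (hy : y ∈ infNhd a)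
    (hrel : T.Rel x y) (hne : x ≠ y) :
    tupleVal val (x - y) < tupleVal val ((x - y) - extend starField P (x - y)) := by
  set R := extend starField P with hR
  have h1 := T.lt_map_sub hx hy hne
  have hmne : T.map x - T.map y ≠ 0 := fun h =>
    hne (T.isRisometry.1.injOn hx hy (sub_eq_zero.mp h))
  have h2 := T.close _ hmne
  rw [hrel, T.tupleVal_map_sub hx hy] at h2
  have h3 : (x - y) - R (x - y) = ((T.map x - T.map y) - R (T.map x - T.map y)) -
      (((T.map x - T.map y) - (x - y)) - R ((T.map x - T.map y) - (x - y))) := by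
    simp only [map_sub]
    abel
  rw [h3]
  exact lt_tupleVal_sub h2 (lt_tupleVal_sub h1 (h1.trans_le (tupleVal_le_extend P _)))

/-- In a fibre, x - c is killed by R and therefore by `proj`. Thus the component of the image
difference transversal to the translations has the full size of x - c. -/
theorem tupleVal_sub_eq_of_fiber {x c : Fin n → RStar} (hx : x ∈ infNhd a) (hc : c ∈ infNhd a)
    (hR : extend starField P x = extend starField P c) :
    tupleVal val ((T.map x - T.map c) - T.proj (T.map x - T.map c)) = tupleVal val (x - c) := by
  by_cases hne : x = c
  · subst hne
    rw [sub_self, map_zero, sub_zero, sub_self]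
  · have h1 := T.lt_map_sub hx hc hne
    have h2 : T.proj (x - c) = 0 := by
      rw [← T.proj_extend, map_sub, hR, sub_self, map_zero]
    refine tupleVal_eq_of_lt_tupleVal_sub ?_
    have h3 : (T.map x - T.map c) - T.proj (T.map x - T.map c) - (x - c) =
        ((T.map x - T.map c) - (x - c)) - T.proj ((T.map x - T.map c) - (x - c)) := by
      rw [map_sub T.proj _ (x - c), h2]
      abel
    rw [h3]
    exact lt_tupleVal_sub h1 (h1.trans_le (T.tupleVal_le_proj _))

/-- Translations do not change the transversal component, so moving two points of one fibre to
another fibre preserves the valuation of their difference. -/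
theorem tupleVal_sub_eq_of_rel {x c x' c' : Fin n → RStar} (hx : x ∈ infNhd a) (hc : c ∈ infNhd a)
    (hx' : x' ∈ infNhd a) (hc' : c' ∈ infNhd a)
    (hR : extend starField P x = extend starField P c)
    (hR' : extend starField P x' = extend starField P c') (hxx' : T.Rel x x') (hcc' : T.Rel c c') :
    tupleVal val (x - c) = tupleVal val (x' - c') := by
  rw [← T.tupleVal_sub_eq_of_fiber hx hc hR, ← T.tupleVal_sub_eq_of_fiber hx' hc' hR']
  congr 1
  have h : ∀ {y y'}, T.Rel y y' → T.map y - T.proj (T.map y) = T.map y' - T.proj (T.map y') := by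
    intro y y' hyy'
    rw [sub_eq_sub_iff_sub_eq_sub, ← map_sub]
    exact Eq.symm hyy'
  rw [map_sub, map_sub, sub_sub_sub_comm, sub_sub_sub_comm (T.map x'), h hxx', h hcc']

end Trivialization

end Trivialization

/-! ### Finiteness of countable semialgebraic sets -/

section Finiteness

open Filter Topology

/-- Away from the roots of the finitely many nonzero polynomials, all signs are locally constant, so
a point of the set would have a whole neighbourhood in it, against countability. -/
theorem IsSemialgebraic.finite_of_countable
    {A : ∀ F : RealClosedExt, (Unit → F.carrier) → Prop} (hA : IsSemialgebraic A)
    (hc : {t : ℝ | A realField fun _ => t}.Countable) : {t : ℝ | A realField fun _ => t}.Finite := by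
  obtain ⟨Q, hQ⟩ := hA
  set p : MvPolynomial Unit ℝ → Polynomial ℝ := fun q =>
    MvPolynomial.aeval (fun _ => Polynomial.X) q with hp
  have heval : ∀ q t, (p q).eval t = MvPolynomial.eval (fun _ => t) q := by
    intro q t
    simp only [hp]
    induction q using MvPolynomial.induction_on with
    | C r => simp
    | add q r hq hr => rw [map_add, Polynomial.eval_add, hq, hr, map_add]
    | mul_X q i hq => simp [hq]
  have hfin : (⋃ q ∈ {q | q ∈ Q ∧ p q ≠ 0}, {t : ℝ | (p q).IsRoot t}).Finite := by
    refine Set.Finite.biUnion (Q.finite_toSet.subset fun q hq => hq.1) fun q hq => ?_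
    exact Polynomial.finite_setOfPred_isRoot hq.2
  refine hfin.subset fun t ht => ?_
  by_contra hcon
  have hne : ∀ q ∈ Q, p q ≠ 0 → (p q).eval t ≠ 0 := fun q hq hpq h0 =>
    hcon (Set.mem_biUnion (x := q) ⟨hq, hpq⟩ h0)
  have hsign : ∀ᶠ t' in 𝓝 t, ∀ q ∈ Q,
      SignType.sign ((p q).eval t) = SignType.sign ((p q).eval t') := by
    refine (Finset.eventually_all Q).mpr fun q hq => ?_
    by_cases hpq : p q = 0
    · simp [hpq]
    · have h1 : ContinuousAt (fun t' => SignType.sign ((p q).eval t')) t :=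
        ContinuousAt.comp (continuousAt_sign_of_ne_zero (hne q hq hpq)) (p q).continuousAt
      filter_upwards [h1.tendsto.eventually ((isOpen_discrete
        {SignType.sign ((p q).eval t)}).mem_nhds rfl)] with t' ht' using ht'.symm
  have hnhds : {t : ℝ | A realField fun _ => t} ∈ 𝓝 t := by
    filter_upwards [hsign] with t' ht'
    refine (hQ realField realField (fun _ => t) (fun _ => t') fun q hq => ?_).mp ht
    have := ht' q hq
    rw [heval, heval] at this
    exact this
  have hdense := hc.dense_compl ℝ
  rw [← interior_eq_empty_iff_dense_compl] at hdense
  have := mem_interior_iff_mem_nhds.mpr hnhds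
  rw [hdense] at this
  exact this

theorem countable_of_forall_isolated {E : Type*} [MetricSpace E] [SecondCountableTopology E]
    {D : Set E} (h : ∀ x ∈ D, ∃ ρ > 0, ∀ y ∈ D, dist y x < ρ → y = x) : D.Countable := by
  have hd : DiscreteTopology D := by
    refine discreteTopology_subtype_iff'.mpr fun x hx => ?_
    obtain ⟨ρ, hρ, hiso⟩ := h x hx
    refine ⟨Metric.ball x ρ, Metric.isOpen_ball, Set.eq_singleton_iff_unique_mem.mpr
      ⟨⟨Metric.mem_ball_self hρ, hx⟩, fun y hy => hiso y hy.2 hy.1⟩⟩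
  exact Set.countable_coe_iff.mp countable_of_Lindelof_of_discrete

variable {n : ℕ} {A : ∀ F : RealClosedExt, (Fin n → F.carrier) → Prop}

theorem IsSemialgebraic.finite_of_forall_isolated (hA : IsSemialgebraic A)
    (h : ∀ x ∈ {x | A realField x}, ∃ ρ > 0, ∀ y ∈ {x | A realField x}, dist y x < ρ → y = x) :
    {x | A realField x}.Finite := by
  have hc := countable_of_forall_isolated h
  have hfin : ∀ i, ((fun x : Fin n → ℝ => x i) '' {x | A realField x}).Finite := by
    intro i
    have hB : IsSemialgebraic (σ := Unit) fun F z => ∃ x : Fin n → F.carrier, A F x ∧ x i = z () :=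
      .exists_tuple (.and (hA.comp fun i => .var _) (.eq (.var _) (.var _)))
    have heq : ((fun x : Fin n → ℝ => x i) '' {x | A realField x}) =
        {t : ℝ | ∃ x : Fin n → ℝ, A realField x ∧ x i = t} := rfl
    rw [heq]
    exact hB.finite_of_countable (hc.image _)
  exact (Set.Finite.pi hfin).subset fun x hx i _ => ⟨x, hx, rfl⟩

/-- The part of A in the fibre through `a` is discrete, hence countable, hence finite. Its points
other than `a` therefore keep a positive distance from `a`, whether or not `a` belongs to A. -/
theorem exists_isolatedWithin (hA : IsSemialgebraic fun F x => A F x)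
    {P : (Fin n → ℝ) →L[ℝ] Fin n → ℝ}
    (h : ∀ x, A realField x → ∃ ρ > 0, IsolatedWithin A P realField x ρ) (a : Fin n → ℝ) :
    ∃ ρ > 0, IsolatedWithin A P realField a ρ := by
  have hD : IsSemialgebraic fun F x => A F x ∧ extend F P x = extend F P (F.point a) :=
    hA.and (.tuple_eq (.extend P fun i => .var _) (.extend P fun i => .const _))
  have hfin := hD.finite_of_forall_isolated (by
    rintro x ⟨hx, hPx⟩
    obtain ⟨ρ, hρ, hiso⟩ := h x hx
    refine ⟨√(ρ / (n + 1)), Real.sqrt_pos.mpr (by positivity), fun y hy hyx => ?_⟩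
    exact hiso y hy.1 (hy.2.trans hPx.symm) (sqNorm_lt_of_norm_lt (by rwa [← dist_eq_norm])))
  have hnhds := (hfin.subset (Set.sdiff_subset (t := {a}))).isClosed.isOpen_compl.mem_nhds
    (show a ∈ _ from fun h => h.2 rfl)
  obtain ⟨ρ, hρ, hball⟩ := Metric.mem_nhds_iff.mp hnhds
  refine ⟨ρ ^ 2, by positivity, fun x hx hPx hxa => ?_⟩
  by_contra hne
  have h1 : x ∈ Metric.ball a ρ := by
    rw [Metric.mem_ball, dist_eq_norm]
    exact norm_lt_of_sqNorm_lt hρ hxa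
  exact hball h1 ⟨⟨hx, hPx⟩, hne⟩

end Finiteness

/-! ### The two implications -/

section Main

variable {n d : ℕ} {A : ∀ F : RealClosedExt, (Fin n → F.carrier) → Prop} {a : Fin n → ℝ}
  {P : (Fin n → ℝ) →L[ℝ] Fin n → ℝ}

theorem point_mem_infNhd (a : Fin n → ℝ) : starField.point a ∈ infNhd a := by
  rw [mem_infNhd_iff]
  have : (starField.point a - fun i => toStarHom (a i)) = 0 := sub_self _
  rw [this, tupleVal_zero]
  exact WithTop.coe_lt_top 0

/-- From |z|² ≤ 2|z - w|² + 2|w|² and |z - w|² < |z|²/4 follows |z|² ≤ 4|w|². -/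
theorem sqNorm_le_of_tupleVal_lt_sub {z w : Fin n → RStar}
    (h : tupleVal val z < tupleVal val (z - w)) : sqNorm z ≤ toStarHom 4 * sqNorm w := by
  have h1 := sqNorm_lt_of_tupleVal_lt h (ε := 1 / 4) (by norm_num)
  have h2 := sqNorm_add_le (z - w) w
  rw [sub_add_cancel] at h2
  have h3 : toStarHom (1 / 4 : ℝ) = (1 / 4 : RStar) := by rw [map_div₀, map_one, map_ofNat]
  have h4 : toStarHom (4 : ℝ) = (4 : RStar) := map_ofNat _ 4
  rw [h3] at h1
  rw [h4]
  linarith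

theorem Trivialization.exists_uniformlyFullWithin (hA : IsSemialgebraic fun F x => A F x)
    (T : Trivialization A a P) : ∃ ρ > 0, UniformlyFullWithin A P a realField 4 ρ := by
  refine exists_pos_real_of_infinitesimal (B := fun F r => UniformlyFullWithin A P a F 4 r)
    (isSemialgebraic_uniformlyFullWithin P a hA 4) fun x y hx hxa hya => ?_
  have hxa := mem_infNhd_of_sqNorm_lt hxa
  obtain ⟨x', hx', hxa', hR, hrel⟩ := T.exists_rel hx hxa (mem_infNhd_of_sqNorm_lt hya)
  refine ⟨x', hx', hR, ?_⟩
  have hz : extend starField P (y - x) = extend starField P (x' - x) := by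
    rw [map_sub, map_sub, hR]
  rw [hz]
  by_cases hne : x' = x
  · subst hne
    rw [sub_self, map_zero, sqNorm_zero, mul_zero]
  · exact sqNorm_le_of_tupleVal_lt_sub (T.lt_sub_extend_of_rel hxa' hxa hrel hne)

theorem Trivialization.exists_isFullAt (hA : IsSemialgebraic fun F x => A F x)
    (T : Trivialization A a P) :
    ∃ r > 0, ∀ c, A realField c → ‖c - a‖ < r → IsFullAt {x | A realField x} c P := by
  obtain ⟨ρ, hρ, h⟩ := T.exists_uniformlyFullWithin hA
  exact exists_isFullAt_of_uniformlyFullWithin (by norm_num) hρ h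

/-- The upper bound compares the flat projection of the chart with the full projection coming from a
trivialization of maximal dimension; the lower bound is the shear. -/
theorem rtrdim_eq_of_hasC1ChartAt (hA : IsSemialgebraic fun F x => A F x) (ha : A realField a)
    (h : HasC1ChartAt d {x | A realField x} a) :
    rtrdim val {x | A starField x} (infNhd a) = d := by
  obtain ⟨P, hP, hPd, hflat, hfull⟩ := h.exists_isFlatAt_isFullAt ha
  have hgreat := isGreatest_rtrdim val (fun x => val_eq_top_iff.mp) {x | A starField x} (infNhd a)
  refine le_antisymm ?_ ?_
  · obtain ⟨P', hP'd, ⟨T⟩⟩ := exists_trivialization hgreat.1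
    obtain ⟨r, hr, hfull'⟩ := T.exists_isFullAt hA
    have := finrank_range_le_of_isFullAt ha hflat T.idem (hfull' a ha (by simpa using hr))
    rwa [hP'd, hPd] at this
  · refine hgreat.2 ?_
    rw [← hPd]
    exact isRisoTrivial_of_isFlatAt_isFullAt hA hP hflat hfull

/-- A chart point c near `a` has a chart of dimension d, since the riso-triviality dimension at c is
d. The flat projection of the chart and the full projection P then have equal rank, so c is isolated
in its fibre. -/
theorem exists_isolatedInFiber (hA : IsSemialgebraic fun F x => A F x)
    (hX : ∀ c, A realField c → rtrdim val {x | A starField x} (infNhd c) = d)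
    (T : Trivialization A a P)
    (hPd : Module.finrank ℝ (LinearMap.range (P : (Fin n → ℝ) →ₗ[ℝ] Fin n → ℝ)) = d)
    (ha : A realField a) {ε : ℝ} (hε : 0 < ε) :
    ∃ c, IsolatedInFiber A P realField c ∧ ‖c - a‖ < ε := by
  obtain ⟨r, hr, hfull⟩ := T.exists_isFullAt hA
  have hA' := hA
  obtain ⟨Q, hQ⟩ := hA'
  obtain ⟨c, ⟨hc, hca⟩, e, hchart⟩ := exists_hasC1ChartAt (X := {x | A realField x}) Q
    (fun x x' hxx' => hQ realField realField x x' hxx') (Metric.isOpen_ball (x := a) (ε := min ε r))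
    ⟨a, ha, Metric.mem_ball_self (lt_min hε hr)⟩
  rw [Metric.mem_ball, dist_eq_norm, lt_min_iff] at hca
  have hed : e = d := (rtrdim_eq_of_hasC1ChartAt hA hc hchart).symm.trans (hX c hc)
  obtain ⟨Pc, hPc, hPcd, hflat, -⟩ := hchart.exists_isFlatAt_isFullAt hc
  obtain ⟨ρ, hρ, hiso⟩ := eventually_eq_of_isFullAt hc hflat T.idem (hfull c hc hca.2)
    (by rw [hPcd, hPd, hed])
  refine ⟨c, ⟨hc, ρ ^ 2, pow_pos hρ 2, fun x hx hPx hxc => ?_⟩, hca.1⟩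
  rw [extend_realField, extend_realField] at hPx
  exact hiso x hx (norm_lt_of_sqNorm_lt hρ hxc) hPx

theorem Trivialization.isolatedInFiber_of_rel (T : Trivialization A a P) {c c' : Fin n → RStar}
    (hc : IsolatedInFiber A P starField c) (hca : c ∈ infNhd a) (hc' : A starField c')
    (hca' : c' ∈ infNhd a) (hrel : T.Rel c' c) : IsolatedInFiber A P starField c' := by
  obtain ⟨-, δ, hδ, hiso⟩ := hc
  have hδ : 0 < δ := hδ
  have hmin : 0 < min δ 1 := lt_min hδ one_pos
  -- The infinitesimal factor keeps x' infinitely near `a` and absorbs the unknown real constant C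
  -- that arises when equality of valuations is turned into an inequality of square norms.
  refine ⟨hc', infinitesimal * min δ 1, mul_pos infinitesimal_pos hmin, fun x' hx' hR hlt => ?_⟩
  have hlt : sqNorm (x' - c') < infinitesimal * min δ 1 := hlt
  have h1 : infinitesimal * min δ 1 ≤ infinitesimal :=
    mul_le_of_le_one_right infinitesimal_pos.le (min_le_right _ _)
  have hxc : 0 < tupleVal val (x' - c') :=
    val_pos_iff_forall_lt.mpr fun ε hε => (hlt.trans_le h1).trans (infinitesimal_lt hε)
  have hxa' : x' ∈ infNhd a := by
    have := lt_tupleVal_add hxc (mem_infNhd_iff.mp hca')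
    rwa [sub_add_sub_cancel] at this
  obtain ⟨x, hx, hxa, hRx, hrelx⟩ := T.exists_rel hx' hxa' hca
  have hval := T.tupleVal_sub_eq_of_rel hxa hca hxa' hca' hRx hR hrelx hrel.symm
  obtain ⟨C, hC, hle⟩ := exists_sqNorm_le_of_tupleVal_le hval.ge
  have hC' : 0 < toStarHom C := toStarHom_pos_iff.mpr hC
  have hCδ : sqNorm (x - c) < δ := by
    have h2 := infinitesimal_lt (inv_pos.mpr hC)
    have h3 : toStarHom C * infinitesimal < 1 := by
      have := mul_lt_mul_of_pos_left h2 hC'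
      rwa [← map_mul, mul_inv_cancel₀ hC.ne', map_one] at this
    calc sqNorm (x - c) ≤ toStarHom C * sqNorm (x' - c') := hle
      _ ≤ toStarHom C * (infinitesimal * min δ 1) := mul_le_mul_of_nonneg_left hlt.le hC'.le
      _ = toStarHom C * infinitesimal * min δ 1 := (mul_assoc _ _ _).symm
      _ < 1 * min δ 1 := mul_lt_mul_of_pos_right h3 hmin
      _ ≤ δ := by rw [one_mul]; exact min_le_left _ _
  have hxc' := hiso x hx hRx hCδ
  rw [hxc', sub_self, tupleVal_zero] at hval
  exact sub_eq_zero.mp (tupleVal_val_eq_top_iff.mp hval.symm)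

theorem isolatedInFiber_of_rtrdim_eq (hA : IsSemialgebraic fun F x => A F x)
    (hX : ∀ c, A realField c → rtrdim val {x | A starField x} (infNhd c) = d)
    (T : Trivialization A a P)
    (hPd : Module.finrank ℝ (LinearMap.range (P : (Fin n → ℝ) →ₗ[ℝ] Fin n → ℝ)) = d)
    (ha : A realField a) : IsolatedInFiber A P realField a := by
  have hI := isSemialgebraic_isolatedInFiber P hA
  have hB : IsSemialgebraic (σ := Unit) fun F z =>
      ∃ c, IsolatedInFiber A P F c ∧ sqNorm (c - F.point a) < z () :=
    .exists_tuple (.and (hI.comp fun i => .var _)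
      (.lt (.sqNorm fun i => .sub (.var _) (.const _)) (.var _)))
  -- Isolated points exist at every real distance, hence at an infinitesimal one over ℝ*.
  obtain ⟨c, hc, hca⟩ := star_infinitesimal_of_forall_real
    (B := fun F r => ∃ c, IsolatedInFiber A P F c ∧ sqNorm (c - F.point a) < r) hB fun r hr => by
      obtain ⟨c, hc, hca⟩ := exists_isolatedInFiber hA hX T hPd ha
        (ε := √(r / (n + 1))) (Real.sqrt_pos.mpr (by positivity))
      exact ⟨c, hc, sqNorm_lt_of_norm_lt hca⟩
  have hca : c ∈ infNhd a := mem_infNhd_of_sqNorm_lt hca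
  obtain ⟨c', hc', hca', hR, hrel⟩ := T.exists_rel hc.1 hca (point_mem_infNhd a)
  have hiso := T.isolatedInFiber_of_rel hc hca hc' hca' hrel
  -- The finiteness argument is applied to the set of points isolated in their fibres: in the fibre
  -- through `a` only `a` itself can be infinitely near `a`, which identifies c' with `a`.
  obtain ⟨ρ, hρ, hDa⟩ := exists_isolatedWithin hI (P := P) (by
    rintro x ⟨hx, ρ, hρ, hxρ⟩
    exact ⟨ρ, hρ, fun y hy => hxρ y hy.1⟩) a
  have heq := transfer_of_real
    (B := fun F r => IsolatedWithin (IsolatedInFiber A P) P F (F.point a) r)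
    (isSemialgebraic_isolatedWithin P a hI) hDa c' hiso hR (sqNorm_lt_of_mem_infNhd hca' hρ)
  rw [heq] at hiso
  exact (hI.transfer a).mpr hiso

theorem isFlatAt_of_rtrdim_eq (hA : IsSemialgebraic fun F x => A F x)
    (hX : ∀ c, A realField c → rtrdim val {x | A starField x} (infNhd c) = d)
    (T : Trivialization A a P)
    (hPd : Module.finrank ℝ (LinearMap.range (P : (Fin n → ℝ) →ₗ[ℝ] Fin n → ℝ)) = d)
    (ha : A realField a) : IsFlatAt {x | A realField x} a P := by
  obtain ⟨-, ρ, hρ, hiso⟩ := isolatedInFiber_of_rtrdim_eq hA hX T hPd ha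
  have hiso' := transfer_of_real (B := fun F r => IsolatedWithin A P F (F.point a) r)
    (isSemialgebraic_isolatedWithin P a hA) hiso
  -- Any point infinitely near `a` moves along the translations into the fibre through `a`, where
  -- isolation leaves only `a`.
  have hrel : ∀ x, A starField x → x ∈ infNhd a → T.Rel (starField.point a) x := by
    intro x hx hxa
    obtain ⟨x', hx', hxa', hR, hrel⟩ := T.exists_rel hx hxa (point_mem_infNhd a)
    rwa [hiso' x' hx' hR (sqNorm_lt_of_mem_infNhd hxa' hρ)] at hrel
  refine isFlatAt_of_flatWithin fun ε hε => ?_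
  refine exists_pos_real_of_infinitesimal (B := fun F r => FlatWithin A P a F ε r)
    (isSemialgebraic_flatWithin P a hA ε) fun x x' hx hx' hxa hxa' => ?_
  have hxa := mem_infNhd_of_sqNorm_lt hxa
  have hxa' := mem_infNhd_of_sqNorm_lt hxa'
  by_cases hne : x = x'
  · subst hne
    rw [sub_self, map_zero, sub_zero, sqNorm_zero, mul_zero]
  · exact (sqNorm_lt_of_tupleVal_lt (T.lt_sub_extend_of_rel hxa hxa'
      ((hrel x hx hxa).symm.trans (hrel x' hx' hxa')) hne) hε).le

theorem isC1Submanifold_iff_rtrdim_eq (hA : IsSemialgebraic fun F x => A F x) :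
    IsC1Submanifold d {x | A realField x} ↔
      ∀ a, A realField a → rtrdim val {x | A starField x} (infNhd a) = d := by
  constructor
  · intro h a ha
    exact rtrdim_eq_of_hasC1ChartAt hA ha (h a ha)
  · intro h
    refine isC1Submanifold_of_isFlatAt_isFullAt fun a ha => ?_
    obtain ⟨P, hPd, ⟨T⟩⟩ := exists_trivialization (h a ha ▸
      (isGreatest_rtrdim val (fun x => val_eq_top_iff.mp) {x | A starField x} (infNhd a)).1)
    obtain ⟨r, hr, hfull⟩ := T.exists_isFullAt hA
    exact ⟨P, T.idem, hPd, isFlatAt_of_rtrdim_eq hA h T hPd ha, hfull a ha (by simpa using hr)⟩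

end Main

end RisoTriviality

open RisoTriviality in
theorem proposition5p1 (n d : ℕ) (φ : L.Formula (Fin n)) :
    IsC1Submanifold d (realSet φ) ↔
      ∀ a ∈ realSet φ, rtrdim val (starSet φ) (infNhd a) = d :=
  isC1Submanifold_iff_rtrdim_eq (isSemialgebraic_definedSet φ)
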